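/- Let $\Omega=(a,b)$ be a bounded interval, $T>0$, $\alpha\ge 0$, $\beta\ge -1$, $\alpha^*:=\min\{\alpha,1+\beta\}$, and let $E_0,E_1,\omega_0,\omega_1$ be functions on $\overline\Omega$ independent of $\varepsilon$. For every $\varepsilon\in(0,1]$ let $G^\varepsilon$ be the classical ($C^2$ on $\overline\Omega\times[0,T]$) solution of $$\partial_{tt}G^\varepsilon-\tfrac1{\varepsilon^2}\partial_{xx}G^\varepsilon=0,\quad G^\varepsilon(x,0)=\varepsilon^\alpha\omega_0(x),\quad \partial_tG^\varepsilon(x,0)=\varepsilon^\beta\omega_1(x),$$ let $(E^\varepsilon,F^\varepsilon)$ be a solution of the asymptotic consistent Klein–Gordon–Zakharov system $$\partial_{tt}E^\varepsilon-\partial_{xx}E^\varepsilon+[1-(E^\varepsilon)^2+F^\varepsilon+G^\varepsilon]E^\varepsilon=0,\qquad \partial_{tt}F^\varepsilon-\tfrac1{\varepsilon^2}\partial_{xx}F^\varepsilon-\partial_{tt}|E^\varepsilon|^2=0,$$ $$E^\varepsilon(x,0)=E_0(x),\quad \partial_tE^\varepsilon(x,0)=E_1(x),\quad F^\varepsilon(x,0)=\partial_tF^\varepsilon(x,0)=0,$$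 and let $\widetilde E^\varepsilon$ be a solution of $$\partial_{tt}\widetilde E^\varepsilon-\partial_{xx}\widetilde E^\varepsilon+[1-(\widetilde E^\varepsilon)^2+G^\varepsilon]\widetilde E^\varepsilon=0,\quad \widetilde E^\varepsilon(x,0)=E_0(x),\quad \partial_t\widetilde E^\varepsilon(x,0)=E_1(x),$$ all on $\overline\Omega\times[0,T]$ with homogeneous Dirichlet boundary conditions at $x=a,b$; here $E^\varepsilon,F^\varepsilon,\widetilde E^\varepsilon$ are $C^2$ on $\overline\Omega\times[0,T]$ with a continuous third time derivative. Assume that, with a constant independent of $\varepsilon\in(0,1]$ and $t\in[0,T]$ (the meaning of $\lesssim$ here), (A) $\|E^\varepsilon\|_{W^{4,\infty}(\Omega)}+\|\partial_tE^\varepsilon\|_{W^{2,\infty}(\Omega)}+\|\partial_{tt}E^\varepsilon\|_{W^{2,\infty}(\Omega)}+\varepsilon\|\partial_t^3E^\varepsilon\|_{W^{2,\infty}(\Omega)}\lesssim1$, $\|\widetilde E^\varepsilon\|_{W^{4,\infty}(\Omega)}+\|\partial_t\widetilde E^\varepsilon\|_{W^{2,\infty}(\Omega)}+\|\partial_{tt}\widetilde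 E^\varepsilon\|_{W^{2,\infty}(\Omega)}\lesssim1$, $\ \|\partial_t^3\widetilde E^\varepsilon\|_{L^\infty(\Omega)}\lesssim \varepsilon^{-(1-\min\{\alpha^*,1\})}$, $\|F^\varepsilon\|_{W^{4,\infty}(\Omega)}\lesssim\varepsilon$, $\ \|\partial_tF^\varepsilon\|_{W^{4,\infty}(\Omega)}+\|\partial_{tt}F^\varepsilon\|_{W^{2,\infty}(\Omega)}+\varepsilon\|\partial_t^3F^\varepsilon\|_{W^{2,\infty}(\Omega)}\lesssim1$; (B) $E_0,E_1\in W^{5,\infty}(\Omega)$ and $\omega_0,\omega_1\in W^{3,\infty}(\Omega)$. For an integer $M\ge1$ and $\tau>0$ put $h=(b-a)/M$, $x_j=a+jh$, $t_k=k\tau$, and, for a grid function $v$, $\delta_x^+v_j=\frac{v_{j+1}-v_j}{h}$, $\delta_x^2v_j=\frac{v_{j+1}-2v_j+v_{j-1}}{h^2}$, $\delta_t^2v^k=\frac{v^{k+1}-2v^k+v^{k-1}}{\tau^2}$, $\|v\|^2=h\sum_{j=1}^{M-1}|v_j|^2$, $\|\delta_x^+v\|^2=h\sum_{j=0}^{M-1}|\delta_x^+v_j|^2$.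 Consider the scheme, for $1\le j\le M-1$ and $k\ge1$ with $t_{k+1}\le T$, $$\delta_t^2E_j^{\varepsilon,k}=\bigl(\delta_x^2-1+|E_j^{\varepsilon,k}|^2-F_j^{\varepsilon,k}-H_j^{\varepsilon,k}\bigr)\tfrac{E_j^{\varepsilon,k+1}+E_j^{\varepsilon,k-1}}2,\qquad \delta_t^2F_j^{\varepsilon,k}=\tfrac1{2\varepsilon^2}\delta_x^2\bigl(F_j^{\varepsilon,k+1}+F_j^{\varepsilon,k-1}\bigr)+\delta_t^2|E_j^{\varepsilon,k}|^2,$$ with $H_j^{\varepsilon,k}=\int_{-1}^1(1-|s|)G^\varepsilon(x_j,t_k+s\tau)\,ds$, boundary values $E_0^{\varepsilon,k}=E_M^{\varepsilon,k}=F_0^{\varepsilon,k}=F_M^{\varepsilon,k}=0$, initial values $E_j^{\varepsilon,0}=E_0(x_j)$, $F_j^{\varepsilon,0}=0$ ($0\le j\le M$), and first step, for $1\le j\le M-1$, $$E_j^{\varepsilon,1}=E_0(x_j)+\tau E_1(x_j)+\tfrac{\tau^2}2D(x_j),\quad F_j^{\varepsilon,1}=\tfrac{\tau^2}2\bigl(2E_1(x_j)^2+2E_0(x_j)D(x_j)\bigr),\quad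 D:=E_0''-E_0-(-E_0^2+\varepsilon^\alpha\omega_0)E_0.$$ Then there exist $h_0>0$, $\tau_0>0$ and $C>0$, independent of $\varepsilon$, $h$, $\tau$, such that for all $\varepsilon\in(0,1]$, $0<h\le h_0$, $0<\tau\le\tau_0$ the scheme has a solution, and for every solution the errors $e_j^{\varepsilon,k}=E^\varepsilon(x_j,t_k)-E_j^{\varepsilon,k}$ and $f_j^{\varepsilon,k}=F^\varepsilon(x_j,t_k)-F_j^{\varepsilon,k}$ satisfy, for all integers $0\le k\le T/\tau$, $$\|e^{\varepsilon,k}\|+\|\delta_x^+e^{\varepsilon,k}\|+\|f^{\varepsilon,k}\|\le C\bigl(h^2+\tau^2/\varepsilon\bigr),$$ $$\|e^{\varepsilon,k}\|+\|\delta_x^+e^{\varepsilon,k}\|+\|f^{\varepsilon,k}\|\le C\bigl(h^2+\tau^2+\tau\varepsilon^{\alpha^*}+\varepsilon\bigr),$$ and hence, uniformly in $\varepsilon$, $$\|e^{\varepsilon,k}\|+\|\delta_x^+e^{\varepsilon,k}\|+\|f^{\varepsilon,k}\|\le C(h^2+\tau).$$ -/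

import Mathlib

open Set MeasureTheory
open scoped ENNReal ContDiff

noncomputable section

namespace KGZ

/-! Sobolev norms on a bounded interval and time derivatives -/

/-- `w` is a weak derivative of order `l` of `v` on the open interval `(a, b)`. -/
def HasWeakDeriv (a b : ℝ) (l : ℕ) (v w : ℝ → ℝ) : Prop :=
  LocallyIntegrableOn v (Ioo a b) ∧ LocallyIntegrableOn w (Ioo a b) ∧
    ∀ φ : ℝ → ℝ, ContDiff ℝ ∞ φ → HasCompactSupport φ → tsupport φ ⊆ Ioo a b →
      ∫ x in Ioo a b, v x * iteratedDeriv l φ x = (-1) ^ l * ∫ x in Ioo a b, w x * φ x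

/-- The `L^∞(a, b)` norm, with values in `[0, ∞]`. -/
def linftyNorm (a b : ℝ) (v : ℝ → ℝ) : ℝ≥0∞ :=
  eLpNorm v ⊤ (volume.restrict (Ioo a b))

/-- The norm of `W^{n,∞}(a, b)`: the sum of the `L^∞` norms of the weak derivatives of order
`0, …, n`; it is `∞` if one of these does not exist. Weak derivatives are unique almost
everywhere, so the infimum ranges over representatives of the same functions. -/
def sobolevNorm (a b : ℝ) (n : ℕ) (v : ℝ → ℝ) : ℝ≥0∞ :=
  ⨅ (w : ℕ → ℝ → ℝ) (_ : ∀ l ≤ n, HasWeakDeriv a b l v (w l)),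
    ∑ l ∈ Finset.range (n + 1), linftyNorm a b (w l)

/-- The time derivative `∂_t^m u (x, t)`, one-sided at `t = 0` and `t = T`. -/
def dt (T : ℝ) (m : ℕ) (u : ℝ → ℝ → ℝ) (x t : ℝ) : ℝ :=
  iteratedDerivWithin m (fun s => u x s) (Icc 0 T) t

/-- The space derivative `∂_x^m u (x, t)`, one-sided at `x = a` and `x = b`. -/
def dx (a b : ℝ) (m : ℕ) (u : ℝ → ℝ → ℝ) (x t : ℝ) : ℝ :=
  iteratedDerivWithin m (fun y => u y t) (Icc a b) x

/-- `u (x, t)` is of class `C^2` on the closed rectangle `[a, b] × [0, T]`. -/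
def IsC2 (a b T : ℝ) (u : ℝ → ℝ → ℝ) : Prop :=
  ContDiffOn ℝ 2 (Function.uncurry u) (Icc a b ×ˢ Icc 0 T)

/-- `u` is of class `C^2` on `[a, b] × [0, T]`, and `∂_t^3 u` exists and is continuous there. -/
structure IsRegular (a b T : ℝ) (u : ℝ → ℝ → ℝ) : Prop where
  isC2 : IsC2 a b T u
  contDiffOn_time : ∀ x ∈ Icc a b, ContDiffOn ℝ 3 (fun s => u x s) (Icc 0 T)
  continuousOn_dt3 : ContinuousOn (Function.uncurry (dt T 3 u)) (Icc a b ×ˢ Icc 0 T)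

/-! The initial-boundary value problems -/

/-- Homogeneous Dirichlet boundary condition at `x = a` and `x = b`. -/
def Dirichlet (a b T : ℝ) (u : ℝ → ℝ → ℝ) : Prop :=
  ∀ t ∈ Icc 0 T, u a t = 0 ∧ u b t = 0

/-- Initial conditions `u (·, 0) = u₀`, `∂_t u (·, 0) = u₁` on `[a, b]`. -/
def InitialData (a b T : ℝ) (u : ℝ → ℝ → ℝ) (u₀ u₁ : ℝ → ℝ) : Prop :=
  ∀ x ∈ Icc a b, u x 0 = u₀ x ∧ dt T 1 u x 0 = u₁ x

/-- `G` is the classical solution on `[a, b] × [0, T]` of the linear wave equation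
`∂_tt G - ε⁻² ∂_xx G = 0` with Dirichlet boundary conditions and initial data
`ε^α ω₀`, `ε^β ω₁`. -/
structure IsWaveSolution (a b T α β ε : ℝ) (ω₀ ω₁ : ℝ → ℝ) (G : ℝ → ℝ → ℝ) : Prop where
  regular : IsC2 a b T G
  eqn : ∀ x ∈ Ioo a b, ∀ t ∈ Ioo 0 T, dt T 2 G x t - 1 / ε ^ 2 * dx a b 2 G x t = 0
  init : InitialData a b T G (fun x => ε ^ α * ω₀ x) (fun x => ε ^ β * ω₁ x)
  bdry : Dirichlet a b T G

/-- `(E, F)` is a solution on `[a, b] × [0, T]` of the asymptotic consistent formulation of the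
Klein-Gordon-Zakharov system, with the potential `G`. -/
structure IsKGZSolution (a b T ε : ℝ) (E₀ E₁ : ℝ → ℝ) (G E F : ℝ → ℝ → ℝ) : Prop where
  regular_E : IsRegular a b T E
  regular_F : IsRegular a b T F
  eqn_E : ∀ x ∈ Ioo a b, ∀ t ∈ Ioo 0 T,
    dt T 2 E x t - dx a b 2 E x t + (1 - E x t ^ 2 + F x t + G x t) * E x t = 0
  eqn_F : ∀ x ∈ Ioo a b, ∀ t ∈ Ioo 0 T,
    dt T 2 F x t - 1 / ε ^ 2 * dx a b 2 F x t - dt T 2 (fun y s => |E y s| ^ 2) x t = 0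
  init_E : InitialData a b T E E₀ E₁
  init_F : InitialData a b T F (fun _ => 0) (fun _ => 0)
  bdry_E : Dirichlet a b T E
  bdry_F : Dirichlet a b T F

/-- `Et` is a solution on `[a, b] × [0, T]` of the Klein-Gordon equation with the oscillatory
potential `G`. -/
structure IsKGOPSolution (a b T : ℝ) (E₀ E₁ : ℝ → ℝ) (G Et : ℝ → ℝ → ℝ) : Prop where
  regular : IsRegular a b T Et
  eqn : ∀ x ∈ Ioo a b, ∀ t ∈ Ioo 0 T,
    dt T 2 Et x t - dx a b 2 Et x t + (1 - Et x t ^ 2 + G x t) * Et x t = 0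
  init : InitialData a b T Et E₀ E₁
  bdry : Dirichlet a b T Et

/-! The assumptions -/

/-- `α^* = min {α, 1 + β}`. -/
def alphaStar (α β : ℝ) : ℝ := min α (1 + β)

/-- The bounds on the exact solutions, uniform in `ε ∈ (0, 1]` and `t ∈ [0, T]`. -/
def AssumptionA (a b T α β : ℝ) (E F Et : ℝ → ℝ → ℝ → ℝ) : Prop :=
  ∃ C : ℝ, ∀ ε ∈ Ioc (0 : ℝ) 1, ∀ t ∈ Icc 0 T,
    (sobolevNorm a b 4 (fun x => E ε x t) + sobolevNorm a b 2 (fun x => dt T 1 (E ε) x t)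
        + sobolevNorm a b 2 (fun x => dt T 2 (E ε) x t)
        + ENNReal.ofReal ε * sobolevNorm a b 2 (fun x => dt T 3 (E ε) x t)
      ≤ ENNReal.ofReal C) ∧
    (sobolevNorm a b 4 (fun x => Et ε x t) + sobolevNorm a b 2 (fun x => dt T 1 (Et ε) x t)
        + sobolevNorm a b 2 (fun x => dt T 2 (Et ε) x t)
      ≤ ENNReal.ofReal C) ∧
    (linftyNorm a b (fun x => dt T 3 (Et ε) x t)
      ≤ ENNReal.ofReal (C * (1 / ε ^ (1 - min (alphaStar α β) 1)))) ∧
    (sobolevNorm a b 4 (fun x => F ε x t) ≤ ENNReal.ofReal (C * ε)) ∧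
    (sobolevNorm a b 4 (fun x => dt T 1 (F ε) x t) + sobolevNorm a b 2 (fun x => dt T 2 (F ε) x t)
        + ENNReal.ofReal ε * sobolevNorm a b 2 (fun x => dt T 3 (F ε) x t)
      ≤ ENNReal.ofReal C)

/-- The bounds on the initial data. -/
def AssumptionB (a b : ℝ) (E₀ E₁ ω₀ ω₁ : ℝ → ℝ) : Prop :=
  sobolevNorm a b 5 E₀ + sobolevNorm a b 5 E₁ + sobolevNorm a b 3 ω₀ + sobolevNorm a b 3 ω₁ < ⊤

/-! The finite difference scheme; a grid function `U k j` stands for `U_j^k`. -/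

/-- Mesh size. -/
def mesh (a b : ℝ) (M : ℕ) : ℝ := (b - a) / M

/-- Grid points. -/
def node (a b : ℝ) (M j : ℕ) : ℝ := a + j * mesh a b M

/-- Forward difference quotient in space. -/
def deltaX (h : ℝ) (v : ℕ → ℝ) (j : ℕ) : ℝ := (v (j + 1) - v j) / h

/-- Second difference quotient in space (used for `j ≥ 1`). -/
def deltaX2 (h : ℝ) (v : ℕ → ℝ) (j : ℕ) : ℝ := (v (j + 1) - 2 * v j + v (j - 1)) / h ^ 2

/-- Second difference quotient in time (used for `k ≥ 1`). -/
def deltaT2 (τ : ℝ) (U : ℕ → ℕ → ℝ) (k j : ℕ) : ℝ :=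
  (U (k + 1) j - 2 * U k j + U (k - 1) j) / τ ^ 2

/-- The average in time at `t_{k+1}` and `t_{k-1}` (used for `k ≥ 1`). -/
def avg (U : ℕ → ℕ → ℝ) (k j : ℕ) : ℝ := (U (k + 1) j + U (k - 1) j) / 2

/-- The averaged potential `H_j^k`. -/
def potential (a b : ℝ) (M : ℕ) (τ : ℝ) (G : ℝ → ℝ → ℝ) (k j : ℕ) : ℝ :=
  ∫ s in (-1 : ℝ)..1, (1 - |s|) * G (node a b M j) (k * τ + s * τ)

/-- `∂_tt E (x, 0)` computed from the data, with `N_0 = -E₀^2 + ε^α ω₀`. -/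
def ett0 (a b α ε : ℝ) (E₀ ω₀ : ℝ → ℝ) (x : ℝ) : ℝ :=
  iteratedDerivWithin 2 E₀ (Icc a b) x - E₀ x - (-(E₀ x) ^ 2 + ε ^ α * ω₀ x) * E₀ x

/-- `∂_tt F (x, 0)` computed from the data. -/
def ftt0 (a b α ε : ℝ) (E₀ E₁ ω₀ : ℝ → ℝ) (x : ℝ) : ℝ :=
  2 * E₁ x ^ 2 + 2 * E₀ x * ett0 a b α ε E₀ ω₀ x

/-- `(U, V)` solves the finite difference scheme on the time levels `0 ≤ t_k ≤ T`, with `M`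
mesh intervals and time step `τ`. -/
structure IsSchemeSolution (a b T α ε : ℝ) (E₀ E₁ ω₀ : ℝ → ℝ) (G : ℝ → ℝ → ℝ)
    (M : ℕ) (τ : ℝ) (U V : ℕ → ℕ → ℝ) : Prop where
  eqn_E : ∀ k : ℕ, 1 ≤ k → ((k : ℝ) + 1) * τ ≤ T → ∀ j : ℕ, 1 ≤ j → j < M →
    deltaT2 τ U k j = deltaX2 (mesh a b M) (avg U k) j
      + (-1 + |U k j| ^ 2 - V k j - potential a b M τ G k j) * avg U k j
  eqn_F : ∀ k : ℕ, 1 ≤ k → ((k : ℝ) + 1) * τ ≤ T → ∀ j : ℕ, 1 ≤ j → j < M →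
    deltaT2 τ V k j
      = 1 / (2 * ε ^ 2) * deltaX2 (mesh a b M) (fun i => V (k + 1) i + V (k - 1) i) j
        + deltaT2 τ (fun l i => |U l i| ^ 2) k j
  bdry : ∀ k : ℕ, k * τ ≤ T → U k 0 = 0 ∧ U k M = 0 ∧ V k 0 = 0 ∧ V k M = 0
  init : ∀ j : ℕ, j ≤ M → U 0 j = E₀ (node a b M j) ∧ V 0 j = 0
  first : ∀ j : ℕ, 1 ≤ j → j < M →
    U 1 j = E₀ (node a b M j) + τ * E₁ (node a b M j)
        + τ ^ 2 / 2 * ett0 a b α ε E₀ ω₀ (node a b M j) ∧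
      V 1 j = τ ^ 2 / 2 * ftt0 a b α ε E₀ E₁ ω₀ (node a b M j)

/-- The discrete `L^2` norm of a grid function vanishing at the end points. -/
def gridNorm (M : ℕ) (h : ℝ) (v : ℕ → ℝ) : ℝ :=
  √(h * ∑ j ∈ Finset.Ico 1 M, |v j| ^ 2)

/-- The discrete `H^1` seminorm, that is the `L^2` norm of the forward difference quotients. -/
def gridSemiNorm (M : ℕ) (h : ℝ) (v : ℕ → ℝ) : ℝ :=
  √(h * ∑ j ∈ Finset.range M, |deltaX h v j| ^ 2)

/-- The error at the grid points and time level `k`. -/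
def gridError (a b : ℝ) (M : ℕ) (τ : ℝ) (u : ℝ → ℝ → ℝ) (U : ℕ → ℕ → ℝ) (k j : ℕ) : ℝ :=
  u (node a b M j) (k * τ) - U k j

/-- The total error `‖e^k‖ + ‖δ_x^+ e^k‖ + ‖f^k‖`. -/
def totalError (a b : ℝ) (M : ℕ) (τ : ℝ) (E F : ℝ → ℝ → ℝ) (U V : ℕ → ℕ → ℝ) (k : ℕ) : ℝ :=
  gridNorm M (mesh a b M) (gridError a b M τ E U k)
    + gridSemiNorm M (mesh a b M) (gridError a b M τ E U k)
    + gridNorm M (mesh a b M) (gridError a b M τ F V k)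

end KGZ

end

/-!
The error is controlled by comparing the scheme with a *reference solution*: grid functions `X`, `Φ`
that are bounded, together with the difference quotients of `X`, and satisfy the scheme up to a
residual of size `R`. The theorem `stability` says that a solution of the scheme whose first two
levels are `R`-close to a reference solution stays `O(R)`-close to it, with a constant that does not
depend on `ε`, `h`, `τ`. Two reference solutions are used, according to the size of the time step.

* For `τ ≤ ε` it is the exact solution `(E, F)` on the grid, with `R ≲ h² + τ² / ε`
  (`isReference_sample`).
* For `ε < τ` it is `(E, 0)`, with `R ≲ h² + τ² + τ ε^{α*} + ε` (`isReference_sample_zero`), which is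
  possible because `F = O(ε)`.

In each regime the bound obtained is the smaller of the two up to a constant, and it is at most of
size `h² + τ`, which gives all three estimates.

**Stability.** The error `e` of `E` satisfies a discrete wave equation with lower order terms, and is
measured in the energy `waveEnergy`. The error `f` of `F` satisfies a wave equation with the large
velocity `1 / ε` and the source `δ_t² (X² - U²)`, which contains `δ_t² e`. This source is estimated
in the norm dual to the discrete `H¹` seminorm: by the equation for `e`, `δ_t² e` is `δ_x² e` up to
lower order terms, and one difference quotient is moved to the test function. Accordingly `f` is
measured in the energy `dualEnergy`, built on the solution `w` of `-δ_x² w = f` and scaled by `ε²`,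
so that no negative power of `ε` appears, and the second residual may even be of size `R / ε`. The
nonlinear terms need a bound on the numerical solution; it comes from the error bound itself, since
`R` is small and the discrete Sobolev inequality bounds `‖e‖_∞` by `‖δ_x⁺ e‖`. No relation between
`τ`, `h` and `ε` is required. The same a priori bound makes the linear problems that define
the next level of the scheme uniquely solvable for small `τ`, whence `exists_levelSolution`.

**Consistency.** Taylor expansion at the times `t_k ± s τ`, weighted with `1 - |s|`, leaves for the
first equation only terms of size `h² + τ²` and `τ` times the increment of `G` between two times
symmetric about `t_k`, because the scheme averages `G` with the same weight (`abs_residual_E_le`).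
That increment is at most `2 τ ‖∂_t G‖_∞` and at most `2 ‖G‖_∞`. The Riemann invariants
`∂_t G ± ε⁻¹ ∂_x G` are transported and reflected at the boundary, so `G = O(ε^{α*})` and
`∂_t G = O(ε^{α* - 1})` (`exists_wave_bound`). In the second equation, insertion of the
differential equation leaves `ε⁻²` times increments of `∂_xx F` in time, which are `O(τ²)` because
`∂_tt F` is bounded in `W^{2,∞}` (`abs_residual_F_le`). The assumed Sobolev bounds are on weak
derivatives; mollification turns them into the bounds on difference quotients that enter these
expansions (`exists_uniformBounds`).
-/


namespace KGZ

/-! ### Weighted sums and discrete norms -/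

/-- The inner product `h ∑_{j ∈ s} f_j g_j`. -/
def wInner (s : Finset ℕ) (h : ℝ) (f g : ℕ → ℝ) : ℝ := h * ∑ j ∈ s, f j * g j

/-- The norm `(h ∑_{j ∈ s} f_j²)^{1/2}`. Both `gridNorm` and `gridSemiNorm` are of this form. -/
noncomputable def wNorm (s : Finset ℕ) (h : ℝ) (f : ℕ → ℝ) : ℝ := √(h * ∑ j ∈ s, |f j| ^ 2)

section WeightedSums

variable {s : Finset ℕ} {h : ℝ} {f g : ℕ → ℝ}

lemma gridSemiNorm_eq (M : ℕ) (h : ℝ) (v : ℕ → ℝ) :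
    gridSemiNorm M h v = wNorm (Finset.range M) h (deltaX h v) := rfl

lemma wNorm_nonneg (s : Finset ℕ) (h : ℝ) (f : ℕ → ℝ) : 0 ≤ wNorm s h f := Real.sqrt_nonneg _

lemma wNorm_sq (hh : 0 ≤ h) : wNorm s h f ^ 2 = wInner s h f f := by
  unfold wNorm wInner
  rw [Real.sq_sqrt (mul_nonneg hh (Finset.sum_nonneg fun _ _ => by positivity))]
  simp only [sq_abs]
  simp only [pow_two]

lemma wInner_congr {f' g' : ℕ → ℝ} (hf : ∀ j ∈ s, f j = f' j) (hg : ∀ j ∈ s, g j = g' j) :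
    wInner s h f g = wInner s h f' g' := by
  unfold wInner
  rw [Finset.sum_congr rfl fun j hj => by rw [hf j hj, hg j hj]]

lemma abs_wInner_le (hh : 0 ≤ h) : |wInner s h f g| ≤ wNorm s h f * wNorm s h g := by
  apply abs_le_of_sq_le_sq _ (mul_nonneg (wNorm_nonneg _ _ _) (wNorm_nonneg _ _ _))
  rw [mul_pow, wNorm_sq hh, wNorm_sq hh]
  unfold wInner
  have := Finset.sum_mul_sq_le_sq_mul_sq s f g
  simp only [← pow_two]
  nlinarith [mul_le_mul_of_nonneg_left this (sq_nonneg h)]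

lemma wInner_add_left (f₁ f₂ g : ℕ → ℝ) :
    wInner s h (fun j => f₁ j + f₂ j) g = wInner s h f₁ g + wInner s h f₂ g := by
  unfold wInner
  rw [← mul_add, ← Finset.sum_add_distrib]
  simp only [add_mul]

lemma wInner_sub_left (f₁ f₂ g : ℕ → ℝ) :
    wInner s h (fun j => f₁ j - f₂ j) g = wInner s h f₁ g - wInner s h f₂ g := by
  unfold wInner
  rw [← mul_sub, ← Finset.sum_sub_distrib]
  simp only [sub_mul]

lemma wNorm_add_le (hh : 0 ≤ h) (f g : ℕ → ℝ) :
    wNorm s h (fun j => f j + g j) ≤ wNorm s h f + wNorm s h g := by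
  have h0 := add_nonneg (wNorm_nonneg s h f) (wNorm_nonneg s h g)
  apply le_of_sq_le_sq _ h0
  have h1 : wNorm s h (fun j => f j + g j) ^ 2
      = wNorm s h f ^ 2 + 2 * wInner s h f g + wNorm s h g ^ 2 := by
    rw [wNorm_sq hh, wNorm_sq hh, wNorm_sq hh]
    unfold wInner
    rw [mul_left_comm 2, ← mul_add, ← mul_add, Finset.mul_sum _ _ (2 : ℝ), ← Finset.sum_add_distrib,
      ← Finset.sum_add_distrib]
    congr 1
    exact Finset.sum_congr rfl fun _ _ => by ring
  have h2 := (le_abs_self _).trans (abs_wInner_le (s := s) (f := f) (g := g) hh)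
  rw [h1]
  nlinarith

lemma wNorm_mono (hh : 0 ≤ h) (hfg : ∀ j ∈ s, |f j| ≤ |g j|) : wNorm s h f ≤ wNorm s h g := by
  unfold wNorm
  apply Real.sqrt_le_sqrt
  apply mul_le_mul_of_nonneg_left _ hh
  exact Finset.sum_le_sum fun j hj => pow_le_pow_left₀ (abs_nonneg _) (hfg j hj) 2

lemma wNorm_const_mul (c : ℝ) (f : ℕ → ℝ) :
    wNorm s h (fun j => c * f j) = |c| * wNorm s h f := by
  unfold wNorm
  rw [← Real.sqrt_sq (abs_nonneg c), ← Real.sqrt_mul (sq_nonneg _)]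
  congr 1
  simp only [abs_mul, mul_pow, ← Finset.mul_sum]
  ring

lemma wNorm_le_mul (hh : 0 ≤ h) {c : ℝ} (hc : 0 ≤ c) (hfg : ∀ j ∈ s, |f j| ≤ c * |g j|) :
    wNorm s h f ≤ c * wNorm s h g := by
  have := wNorm_mono (s := s) (f := f) (g := fun j => c * g j) hh fun j hj => by
    rw [abs_mul, abs_of_nonneg hc]; exact hfg j hj
  rwa [wNorm_const_mul, abs_of_nonneg hc] at this

lemma wNorm_sub_le (hh : 0 ≤ h) (f g : ℕ → ℝ) :
    wNorm s h (fun j => f j - g j) ≤ wNorm s h f + wNorm s h g := by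
  have h1 := wNorm_add_le (s := s) hh f (fun j => -1 * g j)
  rw [wNorm_const_mul, abs_neg, abs_one, one_mul] at h1
  simpa [sub_eq_add_neg] using h1

/-- A discrete `L²` norm is bounded by the sup norm; `L ≥ 1` bounds the length of the interval, so that
`L` also bounds its square root. -/
lemma wNorm_le_sup (hh : 0 ≤ h) {c L : ℝ} (hL : s.card * h ≤ L) (h1 : 1 ≤ L) (hc : 0 ≤ c)
    (hf : ∀ j ∈ s, |f j| ≤ c) : wNorm s h f ≤ L * c := by
  unfold wNorm
  apply Real.sqrt_le_iff.2 ⟨by positivity, ?_⟩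
  have h2 : ∑ j ∈ s, |f j| ^ 2 ≤ s.card * c ^ 2 := by
    rw [← nsmul_eq_mul]
    exact Finset.sum_le_card_nsmul _ _ _ fun j hj => pow_le_pow_left₀ (abs_nonneg _) (hf j hj) 2
  calc h * ∑ j ∈ s, |f j| ^ 2 ≤ h * (s.card * c ^ 2) := by gcongr
    _ = (s.card * h) * c ^ 2 := by ring
    _ ≤ L * c ^ 2 := by gcongr
    _ ≤ L ^ 2 * c ^ 2 := by gcongr; nlinarith
    _ = _ := by ring

end WeightedSums

/-! ### Grid functions vanishing at the end points -/

section Grid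

variable {M : ℕ} {h L : ℝ}

lemma gridNorm_nonneg (v : ℕ → ℝ) : 0 ≤ gridNorm M h v := Real.sqrt_nonneg _

lemma gridSemiNorm_nonneg (v : ℕ → ℝ) : 0 ≤ gridSemiNorm M h v := Real.sqrt_nonneg _

lemma card_Ico_mul_le (hh : 0 ≤ h) (hL : M * h ≤ L) : (Finset.Ico 1 M).card * h ≤ L := by
  refine le_trans (mul_le_mul_of_nonneg_right ?_ hh) hL
  simp

lemma card_range_mul_le (hL : M * h ≤ L) : (Finset.range M).card * h ≤ L := by
  simpa using hL

lemma gridNorm_le_sup (hh : 0 ≤ h) (hL : M * h ≤ L) (h1 : 1 ≤ L) {c : ℝ} (hc : 0 ≤ c)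
    {v : ℕ → ℝ} (hv : ∀ j, 1 ≤ j → j < M → |v j| ≤ c) : gridNorm M h v ≤ L * c :=
  wNorm_le_sup hh (card_Ico_mul_le hh hL) h1 hc fun j hj => by
    rw [Finset.mem_Ico] at hj; exact hv j hj.1 hj.2

lemma gridSemiNorm_le_sup (hh : 0 ≤ h) (hL : M * h ≤ L) (h1 : 1 ≤ L) {c : ℝ} (hc : 0 ≤ c)
    {v : ℕ → ℝ} (hv : ∀ j, j < M → |deltaX h v j| ≤ c) : gridSemiNorm M h v ≤ L * c :=
  wNorm_le_sup hh (card_range_mul_le hL) h1 hc fun j hj => hv j (Finset.mem_range.1 hj)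

lemma gridNorm_add_le (hh : 0 ≤ h) (v w : ℕ → ℝ) :
    gridNorm M h (fun j => v j + w j) ≤ gridNorm M h v + gridNorm M h w :=
  wNorm_add_le hh v w

lemma deltaX_add (v w : ℕ → ℝ) (j : ℕ) :
    deltaX h (fun i => v i + w i) j = deltaX h v j + deltaX h w j := by
  unfold deltaX; ring

lemma deltaX_sub (v w : ℕ → ℝ) (j : ℕ) :
    deltaX h (fun i => v i - w i) j = deltaX h v j - deltaX h w j := by
  unfold deltaX; ring

lemma deltaX_const_mul (c : ℝ) (w : ℕ → ℝ) (j : ℕ) :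
    deltaX h (fun i => c * w i) j = c * deltaX h w j := by
  unfold deltaX; ring

lemma deltaX_mul (v w : ℕ → ℝ) (j : ℕ) :
    deltaX h (fun i => v i * w i) j = v (j + 1) * deltaX h w j + w j * deltaX h v j := by
  unfold deltaX; ring

lemma gridSemiNorm_add_le (hh : 0 ≤ h) (v w : ℕ → ℝ) :
    gridSemiNorm M h (fun j => v j + w j) ≤ gridSemiNorm M h v + gridSemiNorm M h w := by
  rw [gridSemiNorm_eq, gridSemiNorm_eq, gridSemiNorm_eq, funext (deltaX_add v w)]
  exact wNorm_add_le hh _ _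

lemma gridSemiNorm_sub_le (hh : 0 ≤ h) (v w : ℕ → ℝ) :
    gridSemiNorm M h (fun j => v j - w j) ≤ gridSemiNorm M h v + gridSemiNorm M h w := by
  rw [gridSemiNorm_eq, gridSemiNorm_eq, gridSemiNorm_eq, funext (deltaX_sub v w)]
  exact wNorm_sub_le hh _ _

lemma gridSemiNorm_const_mul (c : ℝ) (v : ℕ → ℝ) :
    gridSemiNorm M h (fun j => c * v j) = |c| * gridSemiNorm M h v := by
  rw [gridSemiNorm_eq, gridSemiNorm_eq, funext (deltaX_const_mul c v)]
  exact wNorm_const_mul _ _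

/-- Discrete Sobolev inequality `‖v‖_∞ ≤ L ‖δ_x⁺ v‖` for grid functions with `v_0 = 0`. -/
lemma abs_le_gridSemiNorm (hh : 0 < h) (hL : M * h ≤ L) (h1 : 1 ≤ L) {v : ℕ → ℝ}
    (hv : v 0 = 0) {j : ℕ} (hj : j ≤ M) : |v j| ≤ L * gridSemiNorm M h v := by
  have e1 : v j = wInner (Finset.range j) h (deltaX h v) (fun _ => 1) := by
    unfold wInner deltaX
    rw [Finset.mul_sum]
    have : ∀ i ∈ Finset.range j, h * ((v (i + 1) - v i) / h * 1) = v (i + 1) - v i := by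
      intro i _; field_simp
    rw [Finset.sum_congr rfl this, Finset.sum_range_sub, hv, sub_zero]
  rw [e1]
  refine (abs_wInner_le hh.le).trans ?_
  have e2 : wNorm (Finset.range j) h (fun _ => 1) ≤ L * 1 := by
    apply wNorm_le_sup hh.le _ h1 zero_le_one (by simp)
    rw [Finset.card_range]
    exact le_trans (by gcongr) hL
  have e3 : wNorm (Finset.range j) h (deltaX h v) ≤ gridSemiNorm M h v := by
    unfold wNorm gridSemiNorm
    apply Real.sqrt_le_sqrt
    apply mul_le_mul_of_nonneg_left _ hh.le
    exact Finset.sum_le_sum_of_subset_of_nonneg (by simpa using hj) fun _ _ _ => by positivity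
  rw [mul_one] at e2
  rw [mul_comm L]
  exact mul_le_mul e3 e2 (wNorm_nonneg _ _ _) (gridSemiNorm_nonneg _)

/-- Discrete Poincaré inequality. -/
lemma gridNorm_le_gridSemiNorm (hh : 0 < h) (hL : M * h ≤ L) (h1 : 1 ≤ L) {v : ℕ → ℝ}
    (hv : v 0 = 0) : gridNorm M h v ≤ L ^ 2 * gridSemiNorm M h v := by
  have := gridNorm_le_sup (M := M) (v := v) hh.le hL h1
    (mul_nonneg (zero_le_one.trans h1) (gridSemiNorm_nonneg (M := M) (h := h) v))
    fun j _ hj => abs_le_gridSemiNorm hh hL h1 hv hj.le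
  linarith

/-- Summation by parts. -/
lemma wInner_deltaX2 (hh : h ≠ 0) (v : ℕ → ℝ) {w : ℕ → ℝ} (hw0 : w 0 = 0) (hwM : w M = 0) :
    wInner (Finset.Ico 1 M) h (deltaX2 h v) w
      = -wInner (Finset.range M) h (deltaX h v) (deltaX h w) := by
  rcases Nat.eq_zero_or_pos M with rfl | hM
  · simp [wInner]
  obtain ⟨m, rfl⟩ : ∃ m, M = m + 1 := ⟨M - 1, by omega⟩
  unfold wInner
  have key : ∀ n : ℕ, ∑ j ∈ Finset.range n, deltaX2 h v (j + 1) * w (j + 1)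
      + ∑ j ∈ Finset.range (n + 1), deltaX h v j * deltaX h w j
        = deltaX h v n / h * w (n + 1) - deltaX h v 0 / h * w 0 := by
    intro n
    induction n with
    | zero => simp [deltaX]; ring
    | succ n ih =>
      rw [Finset.sum_range_succ, Finset.sum_range_succ (n := n + 1)]
      have : deltaX2 h v (n + 1) * w (n + 1) + deltaX h v (n + 1) * deltaX h w (n + 1)
          = deltaX h v (n + 1) / h * w (n + 1 + 1) - deltaX h v n / h * w (n + 1) := by
        simp only [deltaX2, deltaX, Nat.add_sub_cancel]
        field_simp
        ring
      linarith
  have := key m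
  rw [hw0, hwM, mul_zero, mul_zero, sub_zero] at this
  rw [Finset.sum_Ico_eq_sum_range, Nat.add_sub_cancel]
  simp only [add_comm 1]
  rw [eq_neg_of_add_eq_zero_left this, mul_neg]

end Grid

/-! ### Discrete energies -/

/-- Forward difference quotient in time. -/
noncomputable def deltaT (τ : ℝ) (y : ℕ → ℕ → ℝ) (k j : ℕ) : ℝ := (y (k + 1) j - y k j) / τ

/-- The energy of the discrete wave operator `δ_t² - δ_x²` (with averaging in time) between the
levels `k` and `k + 1`. -/
noncomputable def waveEnergy (M : ℕ) (h τ : ℝ) (y : ℕ → ℕ → ℝ) (k : ℕ) : ℝ :=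
  gridNorm M h (deltaT τ y k) ^ 2
    + (gridSemiNorm M h (y (k + 1)) ^ 2 + gridSemiNorm M h (y k) ^ 2) / 2

/-- The energy of the fast discrete wave equation, one order of regularity lower: here
`-δ_x² w = g`, so that `‖δ_x⁺ δ_t⁺ w‖` is the norm of `δ_t⁺ g` dual to the discrete `H¹`
seminorm. The energy is scaled by `ε²`. -/
noncomputable def dualEnergy (M : ℕ) (h τ ε : ℝ) (g w : ℕ → ℕ → ℝ) (k : ℕ) : ℝ :=
  (ε * gridSemiNorm M h (deltaT τ w k)) ^ 2
    + (gridNorm M h (g (k + 1)) ^ 2 + gridNorm M h (g k) ^ 2) / 2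

section Energies

variable {M : ℕ} {h τ ε : ℝ}

lemma gridNorm_sq (hh : 0 ≤ h) (v : ℕ → ℝ) :
    gridNorm M h v ^ 2 = wInner (Finset.Ico 1 M) h v v := wNorm_sq hh

lemma gridSemiNorm_sq (hh : 0 ≤ h) (v : ℕ → ℝ) :
    gridSemiNorm M h v ^ 2 = wInner (Finset.range M) h (deltaX h v) (deltaX h v) := wNorm_sq hh

/-- A discrete sum of products `(a - b)(a + b)` is a difference of squares. -/
lemma wInner_sub_add (s : Finset ℕ) (f₁ f₂ a b : ℕ → ℝ)
    (H : ∀ j ∈ s, f₁ j * f₂ j = a j * a j - b j * b j) :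
    wInner s h f₁ f₂ = wInner s h a a - wInner s h b b := by
  unfold wInner
  rw [← mul_sub, ← Finset.sum_sub_distrib, Finset.sum_congr rfl H]

/-- Energy identity for `δ_t² y = δ_x² avg y + r`. -/
lemma waveEnergy_succ_sub (hh : 0 < h) (hτ : 0 < τ) (y : ℕ → ℕ → ℝ) (r : ℕ → ℝ) (k : ℕ)
    (h0 : y k 0 = 0) (hM : y k M = 0) (h0' : y (k + 2) 0 = 0) (hM' : y (k + 2) M = 0)
    (heq : ∀ j, 1 ≤ j → j < M →
      deltaT2 τ y (k + 1) j = deltaX2 h (avg y (k + 1)) j + r j) :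
    waveEnergy M h τ y (k + 1) - waveEnergy M h τ y k
      = wInner (Finset.Ico 1 M) h r (fun j => y (k + 2) j - y k j) := by
  have e1 : wInner (Finset.Ico 1 M) h (deltaT2 τ y (k + 1)) (fun j => y (k + 2) j - y k j)
      = gridNorm M h (deltaT τ y (k + 1)) ^ 2 - gridNorm M h (deltaT τ y k) ^ 2 := by
    rw [gridNorm_sq hh.le, gridNorm_sq hh.le]
    apply wInner_sub_add
    intro j _
    simp only [deltaT2, deltaT, Nat.add_sub_cancel]
    field_simp
    ring
  have e2 : wInner (Finset.Ico 1 M) h (deltaX2 h (avg y (k + 1)))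
      (fun j => y (k + 2) j - y k j)
      = -((gridSemiNorm M h (y (k + 2)) ^ 2 - gridSemiNorm M h (y k) ^ 2) / 2) := by
    rw [wInner_deltaX2 hh.ne' _ (by simp [h0, h0']) (by simp [hM, hM']),
      gridSemiNorm_sq hh.le, gridSemiNorm_sq hh.le]
    unfold wInner
    rw [← mul_sub, ← Finset.sum_sub_distrib, mul_div_assoc, Finset.sum_div]
    congr 2
    refine Finset.sum_congr rfl fun j _ => ?_
    simp only [deltaX, avg, Nat.add_sub_cancel]
    field_simp
    ring
  have e3 : wInner (Finset.Ico 1 M) h r (fun j => y (k + 2) j - y k j)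
      = wInner (Finset.Ico 1 M) h (deltaT2 τ y (k + 1)) (fun j => y (k + 2) j - y k j)
        - wInner (Finset.Ico 1 M) h (deltaX2 h (avg y (k + 1)))
            (fun j => y (k + 2) j - y k j) := by
    rw [← wInner_sub_left]
    refine wInner_congr (fun j hj => ?_) fun _ _ => rfl
    rw [Finset.mem_Ico] at hj
    rw [heq j hj.1 hj.2]; ring
  rw [e3, e1, e2]
  unfold waveEnergy
  ring

/-- Energy identity for `δ_t² g = (2 ε²)⁻¹ δ_x² (g^{k+1} + g^{k-1}) + ζ`, tested with the
increments of `w`, where `-δ_x² w = g`. -/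
lemma dualEnergy_succ_sub (hh : 0 < h) (hτ : 0 < τ) (hε : 0 < ε) (g w : ℕ → ℕ → ℝ)
    (ζ : ℕ → ℝ) (k : ℕ) (hw0 : ∀ i, w i 0 = 0) (hwM : ∀ i, w i M = 0)
    (hw : ∀ i ≤ k + 2, ∀ j, 1 ≤ j → j < M → -deltaX2 h (w i) j = g i j)
    (h0 : ∀ i ≤ k + 2, g i 0 = 0) (hM : ∀ i ≤ k + 2, g i M = 0)
    (heq : ∀ j, 1 ≤ j → j < M →
      deltaT2 τ g (k + 1) j
        = 1 / (2 * ε ^ 2) * deltaX2 h (fun i => g (k + 2) i + g k i) j + ζ j) :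
    dualEnergy M h τ ε g w (k + 1) - dualEnergy M h τ ε g w k
      = ε ^ 2 * wInner (Finset.Ico 1 M) h ζ (fun j => w (k + 2) j - w k j) := by
  set W : ℕ → ℝ := fun j => w (k + 2) j - w k j with hW
  have hW0 : W 0 = 0 := by simp [hW, hw0]
  have hWM : W M = 0 := by simp [hW, hwM]
  have e1 : wInner (Finset.Ico 1 M) h (deltaT2 τ g (k + 1)) W
      = gridSemiNorm M h (deltaT τ w (k + 1)) ^ 2 - gridSemiNorm M h (deltaT τ w k) ^ 2 := by
    have : wInner (Finset.Ico 1 M) h (deltaT2 τ g (k + 1)) W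
        = wInner (Finset.Ico 1 M) h (deltaX2 h (fun j => -deltaT2 τ w (k + 1) j)) W := by
      refine wInner_congr (fun j hj => ?_) fun _ _ => rfl
      rw [Finset.mem_Ico] at hj
      simp only [deltaT2, Nat.add_sub_cancel]
      rw [← hw (k + 1 + 1) (by omega) j hj.1 hj.2, ← hw (k + 1) (by omega) j hj.1 hj.2,
        ← hw k (by omega) j hj.1 hj.2]
      simp only [deltaX2]
      field_simp
      ring
    rw [this, wInner_deltaX2 hh.ne' _ hW0 hWM, gridSemiNorm_sq hh.le, gridSemiNorm_sq hh.le]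
    unfold wInner
    rw [← mul_sub, ← Finset.sum_sub_distrib, ← mul_neg, ← Finset.sum_neg_distrib]
    congr 1
    refine Finset.sum_congr rfl fun j _ => ?_
    simp only [deltaX, deltaT, deltaT2, hW, Nat.add_sub_cancel]
    field_simp
    ring
  have e2 : wInner (Finset.Ico 1 M) h (deltaX2 h (fun i => g (k + 2) i + g k i)) W
      = -(gridNorm M h (g (k + 2)) ^ 2 - gridNorm M h (g k) ^ 2) := by
    have h1 := wInner_deltaX2 (M := M) hh.ne' (fun i => g (k + 2) i + g k i) hW0 hWM
    have h2 := wInner_deltaX2 (M := M) hh.ne' W (w := fun i => g (k + 2) i + g k i)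
      (by simp [h0]) (by simp [hM])
    have h3 : wInner (Finset.range M) h (deltaX h (fun i => g (k + 2) i + g k i)) (deltaX h W)
        = wInner (Finset.range M) h (deltaX h W) (deltaX h (fun i => g (k + 2) i + g k i)) := by
      unfold wInner; simp only [mul_comm]
    rw [h1, h3, ← h2, gridNorm_sq hh.le, gridNorm_sq hh.le]
    unfold wInner
    rw [← mul_sub, ← Finset.sum_sub_distrib, ← mul_neg, ← Finset.sum_neg_distrib]
    congr 1
    refine Finset.sum_congr rfl fun j hj => ?_
    rw [Finset.mem_Ico] at hj
    have h4 : deltaX2 h W j = g k j - g (k + 2) j := by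
      rw [← hw (k + 2) le_rfl j hj.1 hj.2, ← hw k (by omega) j hj.1 hj.2]
      simp only [deltaX2, hW]
      field_simp
      ring
    rw [h4]
    ring
  have e3 : wInner (Finset.Ico 1 M) h ζ W
      = wInner (Finset.Ico 1 M) h (deltaT2 τ g (k + 1)) W
        - 1 / (2 * ε ^ 2)
          * wInner (Finset.Ico 1 M) h (deltaX2 h (fun i => g (k + 2) i + g k i)) W := by
    have : wInner (Finset.Ico 1 M) h ζ W = wInner (Finset.Ico 1 M) h
        (fun j => deltaT2 τ g (k + 1) j
          - 1 / (2 * ε ^ 2) * deltaX2 h (fun i => g (k + 2) i + g k i) j) W := by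
      refine wInner_congr (fun j hj => ?_) fun _ _ => rfl
      rw [Finset.mem_Ico] at hj
      rw [heq j hj.1 hj.2]; ring
    rw [this, wInner_sub_left]
    congr 1
    unfold wInner
    simp only [mul_assoc, ← Finset.mul_sum]
    ring
  rw [e3, e1, e2]
  unfold dualEnergy
  field_simp
  ring

lemma waveEnergy_nonneg (y : ℕ → ℕ → ℝ) (k : ℕ) : 0 ≤ waveEnergy M h τ y k := by
  unfold waveEnergy; positivity

lemma dualEnergy_nonneg (g w : ℕ → ℕ → ℝ) (k : ℕ) : 0 ≤ dualEnergy M h τ ε g w k := by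
  unfold dualEnergy; positivity

end Energies

/-! ### Estimates of the nonlinear terms -/

section Nonlinear

variable {M : ℕ} {h L R : ℝ}

/-- The lower order terms in the equation for the error of `E`. Here `q` is the average of the
error `e` in time, and `V` is only controlled in the discrete `L²` norm, so that the product
`V q` needs the Sobolev bound for `q`. -/
lemma gridNorm_lowerOrder_le (hh : 0 < h) (hL : M * h ≤ L) (h1 : 1 ≤ L) (hR : 0 ≤ R)
    {q e g V A₁ A₂ A₃ ξ : ℕ → ℝ} (hq : q 0 = 0) (he : e 0 = 0)
    (hA₁ : ∀ j, 1 ≤ j → j < M → |A₁ j| ≤ 3 * L ^ 2)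
    (hA₂ : ∀ j, 1 ≤ j → j < M → |A₂ j| ≤ 2 * L ^ 2)
    (hA₃ : ∀ j, 1 ≤ j → j < M → |A₃ j| ≤ L) (hV : gridNorm M h V ≤ L)
    (hξ : ∀ j, 1 ≤ j → j < M → |ξ j| ≤ R) :
    gridNorm M h (fun j => A₁ j * q j + A₂ j * e j + A₃ j * g j + V j * q j + ξ j)
      ≤ 4 * L ^ 4 * (gridSemiNorm M h q + gridSemiNorm M h e + gridNorm M h g + R) := by
  have hL0 : 0 ≤ L := zero_le_one.trans h1
  have nq := gridNorm_le_gridSemiNorm hh hL h1 hq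
  have ne := gridNorm_le_gridSemiNorm hh hL h1 he
  have sq := gridSemiNorm_nonneg (M := M) (h := h) q
  have se := gridSemiNorm_nonneg (M := M) (h := h) e
  have ng := gridNorm_nonneg (M := M) (h := h) g
  have b1 : gridNorm M h (fun j => A₁ j * q j) ≤ 3 * L ^ 2 * gridNorm M h q :=
    wNorm_le_mul hh.le (by positivity) fun j hj => by
      rw [Finset.mem_Ico] at hj; rw [abs_mul]; gcongr; exact hA₁ j hj.1 hj.2
  have b2 : gridNorm M h (fun j => A₂ j * e j) ≤ 2 * L ^ 2 * gridNorm M h e :=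
    wNorm_le_mul hh.le (by positivity) fun j hj => by
      rw [Finset.mem_Ico] at hj; rw [abs_mul]; gcongr; exact hA₂ j hj.1 hj.2
  have b3 : gridNorm M h (fun j => A₃ j * g j) ≤ L * gridNorm M h g :=
    wNorm_le_mul hh.le hL0 fun j hj => by
      rw [Finset.mem_Ico] at hj; rw [abs_mul]; gcongr; exact hA₃ j hj.1 hj.2
  have b4 : gridNorm M h (fun j => V j * q j) ≤ L * gridSemiNorm M h q * gridNorm M h V :=
    wNorm_le_mul hh.le (by positivity) fun j hj => by
      rw [Finset.mem_Ico] at hj; rw [abs_mul, mul_comm]; gcongr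
      exact abs_le_gridSemiNorm hh hL h1 hq hj.2.le
  have b5 : gridNorm M h ξ ≤ L * R := gridNorm_le_sup hh.le hL h1 hR hξ
  have t1 := gridNorm_add_le (M := M) hh.le (fun j => A₁ j * q j) (fun j => A₂ j * e j)
  have t2 := gridNorm_add_le (M := M) hh.le (fun j => A₁ j * q j + A₂ j * e j)
    (fun j => A₃ j * g j)
  have t3 := gridNorm_add_le (M := M) hh.le (fun j => A₁ j * q j + A₂ j * e j + A₃ j * g j)
    (fun j => V j * q j)
  have t4 := gridNorm_add_le (M := M) hh.le
    (fun j => A₁ j * q j + A₂ j * e j + A₃ j * g j + V j * q j) ξ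
  have L2 : L ≤ L ^ 4 := le_self_pow₀ h1 (by norm_num)
  have L3 : L ^ 2 ≤ L ^ 4 := pow_le_pow_right₀ h1 (by norm_num)
  have c1 : 3 * L ^ 2 * gridNorm M h q ≤ 3 * L ^ 4 * gridSemiNorm M h q := by
    calc _ ≤ 3 * L ^ 2 * (L ^ 2 * gridSemiNorm M h q) := by gcongr
      _ = _ := by ring
  have c2 : 2 * L ^ 2 * gridNorm M h e ≤ 2 * L ^ 4 * gridSemiNorm M h e := by
    calc _ ≤ 2 * L ^ 2 * (L ^ 2 * gridSemiNorm M h e) := by gcongr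
      _ = _ := by ring
  have c3 : L * gridNorm M h g ≤ L ^ 4 * gridNorm M h g := by gcongr
  have c4 : L * gridSemiNorm M h q * gridNorm M h V ≤ L ^ 4 * gridSemiNorm M h q := by
    calc _ ≤ L * gridSemiNorm M h q * L := by gcongr
      _ = L ^ 2 * gridSemiNorm M h q := by ring
      _ ≤ _ := by gcongr
  have c5 : L * R ≤ L ^ 4 * R := by gcongr
  have p1 : 0 ≤ L ^ 4 * gridSemiNorm M h q := by positivity
  have p2 : 0 ≤ L ^ 4 * gridSemiNorm M h e := by positivity
  have p3 : 0 ≤ L ^ 4 * gridNorm M h g := by positivity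
  have p4 : 0 ≤ L ^ 4 * R := by positivity
  linarith

/-- Bound in the norm dual to the discrete `H¹` seminorm of the second time difference of the
error of `E²`. The second time difference of `e` enters through the equation
`δ_t² e = δ_x² q + r`, and one `δ_x⁺` is moved to the test function. -/
lemma abs_wInner_deltaT2_sq_le (hh : 0 < h) (hL : M * h ≤ L) (h1 : 1 ≤ L)
    {q e r d Q W X₂ Xc : ℕ → ℝ} (hq : q 0 = 0) (he : e 0 = 0) (hW0 : W 0 = 0) (hWM : W M = 0)
    (hQ : ∀ j ≤ M, |Q j| ≤ 2 * L) (hSQ : gridSemiNorm M h Q ≤ 2 * L)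
    (hX₂ : ∀ j, 1 ≤ j → j < M → |X₂ j| ≤ L) (hXc : ∀ j, 1 ≤ j → j < M → |Xc j| ≤ L)
    (hd : gridNorm M h d ≤ L) :
    |wInner (Finset.Ico 1 M) h (fun j => X₂ j * (q j + e j) + (deltaX2 h q j + r j) * Q j
        + 4 * (Xc j * d j) - 2 * d j ^ 2) W|
      ≤ L ^ 5 * gridSemiNorm M h W * (5 * gridSemiNorm M h q + gridSemiNorm M h e
        + 2 * gridNorm M h r + 6 * gridNorm M h d) := by
  have hL0 : 0 ≤ L := zero_le_one.trans h1
  have nq := gridNorm_le_gridSemiNorm hh hL h1 hq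
  have ne := gridNorm_le_gridSemiNorm hh hL h1 he
  have nW := gridNorm_le_gridSemiNorm hh hL h1 hW0
  have sq := gridSemiNorm_nonneg (M := M) (h := h) q
  have se := gridSemiNorm_nonneg (M := M) (h := h) e
  have sW := gridSemiNorm_nonneg (M := M) (h := h) W
  have nr := gridNorm_nonneg (M := M) (h := h) r
  have nd := gridNorm_nonneg (M := M) (h := h) d
  set I := Finset.Ico 1 M with hI
  set ρ : ℕ → ℝ := fun j => X₂ j * q j + X₂ j * e j + Q j * r j + 4 * Xc j * d j with hρ
  have split : wInner I h (fun j => X₂ j * (q j + e j) + (deltaX2 h q j + r j) * Q j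
        + 4 * (Xc j * d j) - 2 * d j ^ 2) W
      = wInner I h ρ W + wInner I h (deltaX2 h q) (fun j => Q j * W j)
        - 2 * wInner I h d (fun j => W j * d j) := by
    unfold wInner
    rw [← mul_add, ← Finset.sum_add_distrib, mul_left_comm, ← mul_sub, Finset.mul_sum _ _ (2 : ℝ),
      ← Finset.sum_sub_distrib]
    congr 1
    exact Finset.sum_congr rfl fun j _ => by simp only [hρ]; ring
  have nρ : gridNorm M h ρ ≤ L * gridNorm M h q + L * gridNorm M h e + 2 * L * gridNorm M h r
      + 4 * L * gridNorm M h d := by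
    have b1 : gridNorm M h (fun j => X₂ j * q j) ≤ L * gridNorm M h q :=
      wNorm_le_mul hh.le hL0 fun j hj => by
        rw [Finset.mem_Ico] at hj; rw [abs_mul]; gcongr; exact hX₂ j hj.1 hj.2
    have b2 : gridNorm M h (fun j => X₂ j * e j) ≤ L * gridNorm M h e :=
      wNorm_le_mul hh.le hL0 fun j hj => by
        rw [Finset.mem_Ico] at hj; rw [abs_mul]; gcongr; exact hX₂ j hj.1 hj.2
    have b3 : gridNorm M h (fun j => Q j * r j) ≤ 2 * L * gridNorm M h r :=
      wNorm_le_mul hh.le (by positivity) fun j hj => by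
        rw [Finset.mem_Ico] at hj; rw [abs_mul]; gcongr; exact hQ j hj.2.le
    have b4 : gridNorm M h (fun j => 4 * Xc j * d j) ≤ 4 * L * gridNorm M h d :=
      wNorm_le_mul hh.le (by positivity) fun j hj => by
        rw [Finset.mem_Ico] at hj; rw [abs_mul, abs_mul, abs_of_pos (by norm_num : (0 : ℝ) < 4)]
        gcongr; exact hXc j hj.1 hj.2
    have t1 := gridNorm_add_le (M := M) hh.le (fun j => X₂ j * q j) (fun j => X₂ j * e j)
    have t2 := gridNorm_add_le (M := M) hh.le (fun j => X₂ j * q j + X₂ j * e j)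
      (fun j => Q j * r j)
    have t3 := gridNorm_add_le (M := M) hh.le (fun j => X₂ j * q j + X₂ j * e j + Q j * r j)
      (fun j => 4 * Xc j * d j)
    linarith
  have i1 : |wInner I h ρ W| ≤ gridNorm M h ρ * gridNorm M h W := abs_wInner_le hh.le
  have sQW : gridSemiNorm M h (fun j => Q j * W j) ≤ 4 * L ^ 2 * gridSemiNorm M h W := by
    rw [gridSemiNorm_eq, funext (deltaX_mul Q W)]
    refine (wNorm_add_le hh.le _ _).trans ?_
    have c1 : wNorm (Finset.range M) h (fun j => Q (j + 1) * deltaX h W j)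
        ≤ 2 * L * gridSemiNorm M h W :=
      wNorm_le_mul hh.le (by positivity) fun j hj => by
        rw [Finset.mem_range] at hj; rw [abs_mul]; gcongr; exact hQ _ hj
    have c2 : wNorm (Finset.range M) h (fun j => W j * deltaX h Q j)
        ≤ L * gridSemiNorm M h W * gridSemiNorm M h Q :=
      wNorm_le_mul hh.le (by positivity) fun j hj => by
        rw [Finset.mem_range] at hj; rw [abs_mul]; gcongr
        exact abs_le_gridSemiNorm hh hL h1 hW0 hj.le
    have c3 : L * gridSemiNorm M h W * gridSemiNorm M h Q
        ≤ 2 * L ^ 2 * gridSemiNorm M h W := by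
      calc _ ≤ L * gridSemiNorm M h W * (2 * L) := by gcongr
        _ = _ := by ring
    have c4 : 2 * L * gridSemiNorm M h W ≤ 2 * L ^ 2 * gridSemiNorm M h W := by
      gcongr; exact le_self_pow₀ h1 (by norm_num)
    linarith
  have i2 : |wInner I h (deltaX2 h q) (fun j => Q j * W j)|
      ≤ gridSemiNorm M h q * (4 * L ^ 2 * gridSemiNorm M h W) := by
    rw [hI, wInner_deltaX2 hh.ne' _ (by simp [hW0]) (by simp [hWM]), abs_neg]
    exact (abs_wInner_le hh.le).trans (mul_le_mul_of_nonneg_left sQW sq)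
  have i3 : |wInner I h d (fun j => W j * d j)|
      ≤ L * (L * gridSemiNorm M h W * gridNorm M h d) := by
    refine (abs_wInner_le hh.le).trans ?_
    refine mul_le_mul hd ?_ (wNorm_nonneg _ _ _) hL0
    exact wNorm_le_mul hh.le (by positivity) fun j hj => by
      rw [Finset.mem_Ico] at hj; rw [abs_mul]; gcongr
      exact abs_le_gridSemiNorm hh hL h1 hW0 hj.2.le
  have i1' : gridNorm M h ρ * gridNorm M h W
      ≤ (L ^ 3 * gridSemiNorm M h q + L ^ 3 * gridSemiNorm M h e + 2 * L * gridNorm M h r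
        + 4 * L * gridNorm M h d) * (L ^ 2 * gridSemiNorm M h W) := by
    apply mul_le_mul _ nW (gridNorm_nonneg _) (by positivity)
    refine nρ.trans ?_
    have : L * gridNorm M h q ≤ L ^ 3 * gridSemiNorm M h q := by
      calc _ ≤ L * (L ^ 2 * gridSemiNorm M h q) := by gcongr
        _ = _ := by ring
    have : L * gridNorm M h e ≤ L ^ 3 * gridSemiNorm M h e := by
      calc _ ≤ L * (L ^ 2 * gridSemiNorm M h e) := by gcongr
        _ = _ := by ring
    linarith
  have L2 : L ^ 2 ≤ L ^ 5 := pow_le_pow_right₀ h1 (by norm_num)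
  have L3 : L ^ 3 ≤ L ^ 5 := pow_le_pow_right₀ h1 (by norm_num)
  rw [split]
  refine (abs_sub _ _).trans (le_trans (add_le_add (abs_add_le _ _) le_rfl) ?_)
  rw [abs_mul, abs_of_pos (by norm_num : (0 : ℝ) < 2)]
  have f1 : L ^ 2 * (gridSemiNorm M h q * gridSemiNorm M h W)
      ≤ L ^ 5 * (gridSemiNorm M h q * gridSemiNorm M h W) := by gcongr
  have f2 : L ^ 3 * (gridNorm M h r * gridSemiNorm M h W)
      ≤ L ^ 5 * (gridNorm M h r * gridSemiNorm M h W) := by gcongr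
  have f3 : L ^ 3 * (gridNorm M h d * gridSemiNorm M h W)
      ≤ L ^ 5 * (gridNorm M h d * gridSemiNorm M h W) := by gcongr
  have f4 : L ^ 2 * (gridNorm M h d * gridSemiNorm M h W)
      ≤ L ^ 5 * (gridNorm M h d * gridSemiNorm M h W) := by gcongr
  linarith

/-- The solution `w` of `-δ_x² w = g` is bounded in the discrete `H¹` seminorm. -/
lemma gridSemiNorm_le_of_neg_deltaX2 (hh : 0 < h) (hL : M * h ≤ L) (h1 : 1 ≤ L)
    {w g : ℕ → ℝ} (hw0 : w 0 = 0) (hwM : w M = 0)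
    (hw : ∀ j, 1 ≤ j → j < M → -deltaX2 h w j = g j) :
    gridSemiNorm M h w ≤ L ^ 2 * gridNorm M h g := by
  have e1 : gridSemiNorm M h w ^ 2 = wInner (Finset.Ico 1 M) h g w := by
    have h2 : wInner (Finset.Ico 1 M) h g w = -wInner (Finset.Ico 1 M) h (deltaX2 h w) w := by
      unfold wInner
      rw [← mul_neg, ← Finset.sum_neg_distrib]
      congr 1
      refine Finset.sum_congr rfl fun j hj => ?_
      rw [Finset.mem_Ico] at hj
      rw [← hw j hj.1 hj.2]; ring
    rw [h2, wInner_deltaX2 hh.ne' _ hw0 hwM, gridSemiNorm_sq hh.le, neg_neg]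
  have e2 : gridSemiNorm M h w ^ 2 ≤ L ^ 2 * gridNorm M h g * gridSemiNorm M h w := by
    rw [e1]
    refine (le_abs_self _).trans ((abs_wInner_le hh.le).trans ?_)
    have := gridNorm_le_gridSemiNorm hh hL h1 hw0
    calc gridNorm M h g * gridNorm M h w
        ≤ gridNorm M h g * (L ^ 2 * gridSemiNorm M h w) := by
          gcongr; exact gridNorm_nonneg _
      _ = _ := by ring
  rcases (gridSemiNorm_nonneg (M := M) (h := h) w).eq_or_lt with h0 | h0
  · rw [← h0]; have := gridNorm_nonneg (M := M) (h := h) g; positivity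
  · rw [pow_two] at e2
    exact le_of_mul_le_mul_right e2 h0

end Nonlinear

/-! ### Solvability of the discrete elliptic problems -/

/-- Extension by zero of a function on the interior grid points. -/
def extendZero (M : ℕ) : ({j // j ∈ Finset.Ico 1 M} → ℝ) →ₗ[ℝ] (ℕ → ℝ) where
  toFun v j := if hj : j ∈ Finset.Ico 1 M then v ⟨j, hj⟩ else 0
  map_add' v w := by ext j; by_cases hj : j ∈ Finset.Ico 1 M <;> simp only [hj, dite_true,
    dite_false, Pi.add_apply, add_zero]
  map_smul' c v := by ext j; by_cases hj : j ∈ Finset.Ico 1 M <;> simp only [hj, dite_true,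
    dite_false, Pi.smul_apply, smul_zero, RingHom.id_apply]

section Solver

variable {M : ℕ} {h L : ℝ}

lemma extendZero_apply {v : {j // j ∈ Finset.Ico 1 M} → ℝ} (j : {j // j ∈ Finset.Ico 1 M}) :
    extendZero M v j = v j := by
  simp only [extendZero, LinearMap.coe_mk, AddHom.coe_mk, j.2, dite_true]

lemma extendZero_of_notMem {v : {j // j ∈ Finset.Ico 1 M} → ℝ} {j : ℕ}
    (hj : j ∉ Finset.Ico 1 M) : extendZero M v j = 0 := by
  simp only [extendZero, LinearMap.coe_mk, AddHom.coe_mk, hj, dite_false]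

/-- The problem `c v - κ δ_x² v = ρ` with zero boundary values is solvable if the quadratic
form of the operator has no nontrivial zero. -/
lemma exists_grid_solution (hh : 0 < h) (c : ℕ → ℝ) (κ : ℝ)
    (hpos : ∀ v : ℕ → ℝ, v 0 = 0 → v M = 0 →
      wInner (Finset.Ico 1 M) h (fun j => c j * v j - κ * deltaX2 h v j) v = 0 →
        gridSemiNorm M h v = 0) (ρ : ℕ → ℝ) :
    ∃ v : ℕ → ℝ, v 0 = 0 ∧ v M = 0 ∧
      ∀ j, 1 ≤ j → j < M → c j * v j - κ * deltaX2 h v j = ρ j := by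
  let A : ({j // j ∈ Finset.Ico 1 M} → ℝ) →ₗ[ℝ] ({j // j ∈ Finset.Ico 1 M} → ℝ) :=
    { toFun := fun v j => c j * extendZero M v j - κ * deltaX2 h (extendZero M v) j
      map_add' := fun v w => by
        ext j
        simp only [map_add, Pi.add_apply, deltaX2]
        ring
      map_smul' := fun a v => by
        ext j
        simp only [map_smul, Pi.smul_apply, deltaX2, smul_eq_mul, RingHom.id_apply]
        ring }
  have hA : ∀ v (j : {j // j ∈ Finset.Ico 1 M}),
      A v j = c j * extendZero M v j - κ * deltaX2 h (extendZero M v) j := fun _ _ => rfl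
  have h0 : ∀ v, extendZero M v 0 = 0 := fun v => extendZero_of_notMem (by simp)
  have hM : ∀ v, extendZero M v M = 0 := fun v => extendZero_of_notMem (by simp)
  have inj : Function.Injective A := by
    rw [injective_iff_map_eq_zero]
    intro v hv
    have h1 : gridSemiNorm M h (extendZero M v) = 0 := by
      apply hpos _ (h0 v) (hM v)
      unfold wInner
      rw [Finset.sum_eq_zero, mul_zero]
      intro j hj
      have := congrFun hv ⟨j, hj⟩
      rw [hA] at this
      simp only [Pi.zero_apply] at this
      exact mul_eq_zero_of_left this _
    ext j
    have h2 := abs_le_gridSemiNorm (M := M) (L := max (M * h) 1) hh (le_max_left _ _)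
      (le_max_right _ _) (h0 v) (Finset.mem_Ico.1 j.2).2.le
    rw [h1, mul_zero, extendZero_apply] at h2
    exact abs_nonpos_iff.1 h2
  obtain ⟨v, hv⟩ := LinearMap.injective_iff_surjective.1 inj (fun j => ρ j)
  refine ⟨extendZero M v, h0 v, hM v, fun j hj hjM => ?_⟩
  have := congrFun hv ⟨j, Finset.mem_Ico.2 ⟨hj, hjM⟩⟩
  rwa [hA] at this

/-- The quadratic form of `c - κ δ_x²`. -/
lemma wInner_elliptic (hh : 0 < h) (c : ℕ → ℝ) (κ : ℝ) {v : ℕ → ℝ} (h0 : v 0 = 0)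
    (hM : v M = 0) :
    wInner (Finset.Ico 1 M) h (fun j => c j * v j - κ * deltaX2 h v j) v
      = wInner (Finset.Ico 1 M) h (fun j => c j * v j) v + κ * gridSemiNorm M h v ^ 2 := by
  rw [wInner_sub_left, gridSemiNorm_sq hh.le]
  have : wInner (Finset.Ico 1 M) h (fun j => κ * deltaX2 h v j) v
      = κ * wInner (Finset.Ico 1 M) h (deltaX2 h v) v := by
    unfold wInner; simp only [mul_assoc, ← Finset.mul_sum]; ring
  rw [this, wInner_deltaX2 hh.ne' _ h0 hM]
  ring

/-- The case of a nonnegative constant `c` and `κ > 0`. -/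
lemma exists_grid_solution_const (hh : 0 < h) {c κ : ℝ} (hc : 0 ≤ c) (hκ : 0 < κ) (ρ : ℕ → ℝ) :
    ∃ v : ℕ → ℝ, v 0 = 0 ∧ v M = 0 ∧
      ∀ j, 1 ≤ j → j < M → c * v j - κ * deltaX2 h v j = ρ j := by
  refine exists_grid_solution hh (fun _ => c) κ (fun v h0 hM hv => ?_) ρ
  rw [wInner_elliptic hh _ _ h0 hM] at hv
  have h1 : 0 ≤ wInner (Finset.Ico 1 M) h (fun j => c * v j) v := by
    unfold wInner
    refine mul_nonneg hh.le (Finset.sum_nonneg fun j _ => ?_)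
    rw [mul_assoc]
    exact mul_nonneg hc (mul_self_nonneg _)
  have h2 : 0 ≤ κ * gridSemiNorm M h v ^ 2 := by positivity
  have h3 : κ * gridSemiNorm M h v ^ 2 = 0 := by linarith
  rcases mul_eq_zero.1 h3 with h4 | h4
  · exact absurd h4 hκ.ne'
  · exact pow_eq_zero_iff (two_ne_zero) |>.1 h4

/-- The case of a potential bounded below by `-L²` up to a part `V` that is only bounded in the
discrete `L²` norm, for a large multiple of the identity. -/
lemma exists_grid_solution_potential (hh : 0 < h) (hL : M * h ≤ L) (h1 : 1 ≤ L) {c : ℝ}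
    (hc : 2 * L ^ 4 ≤ c) {A V : ℕ → ℝ} (hA : ∀ j, 1 ≤ j → j < M → -(2 * L ^ 2) ≤ A j)
    (hV : gridNorm M h V ≤ L) (ρ : ℕ → ℝ) :
    ∃ v : ℕ → ℝ, v 0 = 0 ∧ v M = 0 ∧
      ∀ j, 1 ≤ j → j < M → (c + (A j + V j) / 2) * v j - 1 / 2 * deltaX2 h v j = ρ j := by
  refine exists_grid_solution hh (fun j => c + (A j + V j) / 2) (1 / 2) (fun v h0 hM hv => ?_) ρ
  rw [wInner_elliptic hh _ _ h0 hM] at hv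
  have hL0 : 0 ≤ L := zero_le_one.trans h1
  have sv := gridSemiNorm_nonneg (M := M) (h := h) v
  have nv := gridNorm_nonneg (M := M) (h := h) v
  have b1 : (c - L ^ 2) * gridNorm M h v ^ 2 + 1 / 2 * wInner (Finset.Ico 1 M) h
      (fun j => V j * v j) v
      ≤ wInner (Finset.Ico 1 M) h (fun j => (c + (A j + V j) / 2) * v j) v := by
    rw [gridNorm_sq hh.le]
    unfold wInner
    rw [mul_left_comm, mul_left_comm (1 / 2), ← mul_add, Finset.mul_sum, Finset.mul_sum,
      ← Finset.sum_add_distrib]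
    apply mul_le_mul_of_nonneg_left _ hh.le
    refine Finset.sum_le_sum fun j hj => ?_
    rw [Finset.mem_Ico] at hj
    nlinarith [hA j hj.1 hj.2, mul_self_nonneg (v j)]
  have b2 : |wInner (Finset.Ico 1 M) h (fun j => V j * v j) v|
      ≤ L * gridSemiNorm M h v * L * gridNorm M h v := by
    refine (abs_wInner_le hh.le).trans ?_
    refine mul_le_mul_of_nonneg_right ?_ nv
    refine le_trans ?_ (mul_le_mul_of_nonneg_left hV (by positivity))
    exact wNorm_le_mul hh.le (by positivity) fun j hj => by
      rw [Finset.mem_Ico] at hj; rw [abs_mul, mul_comm]; gcongr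
      exact abs_le_gridSemiNorm hh hL h1 h0 hj.2.le
  have b3 := (abs_le.1 b2).1
  have b4 : L ^ 2 ≤ L ^ 4 := pow_le_pow_right₀ h1 (by norm_num)
  have b5 : (L ^ 4) * gridNorm M h v ^ 2 ≤ (c - L ^ 2) * gridNorm M h v ^ 2 := by
    gcongr; linarith
  have b6 : gridSemiNorm M h v ^ 2 ≤ 0 := by
    nlinarith [sq_nonneg (gridSemiNorm M h v - L ^ 2 * gridNorm M h v),
      sq_nonneg (L ^ 2 * gridNorm M h v)]
  exact pow_eq_zero_iff two_ne_zero |>.1 (le_antisymm b6 (sq_nonneg _))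

end Solver

/-! ### Stability of the scheme -/

/-- The grid functions `X`, `Φ` satisfy the scheme with the potential `P` on the time levels
`0, …, n` up to residuals of size `R`, and they are bounded by `K` together with the difference
quotients of `X`. The residual of the second equation may be of size `R / ε`, which is what the
scaling of `dualEnergy` allows. -/
structure IsReference (M : ℕ) (h τ ε K R : ℝ) (n : ℕ) (P X Φ : ℕ → ℕ → ℝ) : Prop where
  bdry : ∀ k ≤ n, X k 0 = 0 ∧ X k M = 0 ∧ Φ k 0 = 0 ∧ Φ k M = 0
  X_le : ∀ k ≤ n, ∀ j ≤ M, |X k j| ≤ K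
  X_dx : ∀ k ≤ n, ∀ j < M, |deltaX h (X k) j| ≤ K
  X_dt : ∀ k, k + 1 ≤ n → ∀ j, 1 ≤ j → j < M → |deltaT τ X k j| ≤ K
  X_dtt : ∀ k, k + 2 ≤ n → ∀ j, 1 ≤ j → j < M → |deltaT2 τ X (k + 1) j| ≤ K
  Φ_le : ∀ k ≤ n, ∀ j, 1 ≤ j → j < M → |Φ k j| ≤ K
  P_le : ∀ k, k + 2 ≤ n → ∀ j, 1 ≤ j → j < M → |P (k + 1) j| ≤ K
  res_E : ∀ k, k + 2 ≤ n → ∀ j, 1 ≤ j → j < M →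
    |deltaT2 τ X (k + 1) j - (deltaX2 h (avg X (k + 1)) j
      + (-1 + X (k + 1) j ^ 2 - Φ (k + 1) j - P (k + 1) j) * avg X (k + 1) j)| ≤ R
  res_F : ∀ k, k + 2 ≤ n → ∀ j, 1 ≤ j → j < M →
    ε * |deltaT2 τ Φ (k + 1) j
      - (1 / (2 * ε ^ 2) * deltaX2 h (fun i => Φ (k + 2) i + Φ k i) j
        + deltaT2 τ (fun l i => X l i ^ 2) (k + 1) j)| ≤ R

/-- The scheme on the time levels `0, …, n`, with potential `P`, without initial conditions. -/
structure IsLevelSolution (M : ℕ) (h τ ε : ℝ) (n : ℕ) (P U V : ℕ → ℕ → ℝ) : Prop where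
  bdry : ∀ k ≤ n, U k 0 = 0 ∧ U k M = 0 ∧ V k 0 = 0 ∧ V k M = 0
  eqn_E : ∀ k, k + 2 ≤ n → ∀ j, 1 ≤ j → j < M →
    deltaT2 τ U (k + 1) j = deltaX2 h (avg U (k + 1)) j
      + (-1 + U (k + 1) j ^ 2 - V (k + 1) j - P (k + 1) j) * avg U (k + 1) j
  eqn_F : ∀ k, k + 2 ≤ n → ∀ j, 1 ≤ j → j < M →
    deltaT2 τ V (k + 1) j
      = 1 / (2 * ε ^ 2) * deltaX2 h (fun i => V (k + 2) i + V k i) j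
        + deltaT2 τ (fun l i => U l i ^ 2) (k + 1) j

section Stability

variable {M n : ℕ} {h τ ε K L R : ℝ} {P X Φ U V w : ℕ → ℕ → ℝ}

lemma quintuple_mul_le (s₂ s₁ s₀ g R a₁ a₀ : ℝ) :
    (s₂ + s₁ + s₀ + g + R) * (a₁ + a₀)
      ≤ 5 / 2 * (s₂ ^ 2 + s₁ ^ 2 + s₀ ^ 2 + g ^ 2 + R ^ 2) + (a₁ ^ 2 + a₀ ^ 2) := by
  nlinarith [sq_nonneg (s₂ + s₁ + s₀ + g + R - (a₁ + a₀)), sq_nonneg (s₂ - s₁),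
    sq_nonneg (s₂ - s₀), sq_nonneg (s₂ - g), sq_nonneg (s₂ - R), sq_nonneg (s₁ - s₀),
    sq_nonneg (s₁ - g), sq_nonneg (s₁ - R), sq_nonneg (s₀ - g), sq_nonneg (s₀ - R),
    sq_nonneg (g - R), sq_nonneg (a₁ - a₀)]

lemma septuple_mul_le (s₂ s₁ s₀ g R b₁ b₀ a₁ a₀ : ℝ) :
    (s₂ + s₁ + s₀ + g + R + b₁ + b₀) * (a₁ + a₀)
      ≤ 5 * (s₂ ^ 2 + s₁ ^ 2 + s₀ ^ 2 + g ^ 2 + R ^ 2) + 2 * (b₁ ^ 2 + b₀ ^ 2)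
        + (a₁ ^ 2 + a₀ ^ 2) := by
  have h1 := quintuple_mul_le s₂ s₁ s₀ g R a₁ a₀
  have h2 : (s₂ + s₁ + s₀ + g + R) ^ 2 ≤ 5 * (s₂ ^ 2 + s₁ ^ 2 + s₀ ^ 2 + g ^ 2 + R ^ 2) := by
    nlinarith [sq_nonneg (s₂ - s₁),
      sq_nonneg (s₂ - s₀), sq_nonneg (s₂ - g), sq_nonneg (s₂ - R), sq_nonneg (s₁ - s₀),
      sq_nonneg (s₁ - g), sq_nonneg (s₁ - R), sq_nonneg (s₀ - g), sq_nonneg (s₀ - R),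
      sq_nonneg (g - R)]
  nlinarith [sq_nonneg (s₂ + s₁ + s₀ + g + R - (b₁ + b₀)), sq_nonneg (b₁ - b₀),
    sq_nonneg (s₂ + s₁ + s₀ + g + R + b₁ + b₀ - (a₁ + a₀)), sq_nonneg (a₁ - a₀)]

lemma gridNorm_deltaT_sq_le (k : ℕ) (y : ℕ → ℕ → ℝ) :
    gridNorm M h (deltaT τ y k) ^ 2 ≤ waveEnergy M h τ y k := by
  unfold waveEnergy
  have := sq_nonneg (gridSemiNorm M h (y (k + 1)))
  have := sq_nonneg (gridSemiNorm M h (y k))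
  linarith

lemma gridSemiNorm_succ_sq_le (k : ℕ) (y : ℕ → ℕ → ℝ) :
    gridSemiNorm M h (y (k + 1)) ^ 2 ≤ 2 * waveEnergy M h τ y k := by
  unfold waveEnergy
  have := sq_nonneg (gridNorm M h (deltaT τ y k))
  have := sq_nonneg (gridSemiNorm M h (y k))
  linarith

lemma gridSemiNorm_sq_le (k : ℕ) (y : ℕ → ℕ → ℝ) :
    gridSemiNorm M h (y k) ^ 2 ≤ 2 * waveEnergy M h τ y k := by
  unfold waveEnergy
  have := sq_nonneg (gridNorm M h (deltaT τ y k))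
  have := sq_nonneg (gridSemiNorm M h (y (k + 1)))
  linarith

lemma gridNorm_succ_sq_le (k : ℕ) (g w : ℕ → ℕ → ℝ) :
    gridNorm M h (g (k + 1)) ^ 2 ≤ 2 * dualEnergy M h τ ε g w k := by
  unfold dualEnergy
  have := sq_nonneg (ε * gridSemiNorm M h (deltaT τ w k))
  have := sq_nonneg (gridNorm M h (g k))
  linarith

lemma gridNorm_sq_le (k : ℕ) (g w : ℕ → ℕ → ℝ) :
    gridNorm M h (g k) ^ 2 ≤ 2 * dualEnergy M h τ ε g w k := by
  unfold dualEnergy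
  have := sq_nonneg (ε * gridSemiNorm M h (deltaT τ w k))
  have := sq_nonneg (gridNorm M h (g (k + 1)))
  linarith

lemma gridSemiNorm_deltaT_sq_le (k : ℕ) (g w : ℕ → ℕ → ℝ) :
    (ε * gridSemiNorm M h (deltaT τ w k)) ^ 2 ≤ dualEnergy M h τ ε g w k := by
  unfold dualEnergy
  have := sq_nonneg (gridNorm M h (g k))
  have := sq_nonneg (gridNorm M h (g (k + 1)))
  linarith

lemma gridNorm_const_mul (c : ℝ) (v : ℕ → ℝ) :
    gridNorm M h (fun j => c * v j) = |c| * gridNorm M h v := wNorm_const_mul c v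

lemma gridNorm_two_step_le (hh : 0 ≤ h) (hτ : 0 < τ) (y : ℕ → ℕ → ℝ) (k : ℕ) :
    gridNorm M h (fun j => y (k + 2) j - y k j)
      ≤ τ * (gridNorm M h (deltaT τ y (k + 1)) + gridNorm M h (deltaT τ y k)) := by
  have : (fun j => y (k + 2) j - y k j)
      = fun j => τ * (deltaT τ y (k + 1) j + deltaT τ y k j) := by
    ext j; simp only [deltaT]; field_simp; ring
  rw [this, gridNorm_const_mul, abs_of_pos hτ]
  gcongr
  exact gridNorm_add_le hh _ _

lemma gridSemiNorm_two_step_le (hh : 0 ≤ h) (hτ : 0 < τ) (y : ℕ → ℕ → ℝ) (k : ℕ) :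
    gridSemiNorm M h (fun j => y (k + 2) j - y k j)
      ≤ τ * (gridSemiNorm M h (deltaT τ y (k + 1)) + gridSemiNorm M h (deltaT τ y k)) := by
  have : (fun j => y (k + 2) j - y k j)
      = fun j => τ * (deltaT τ y (k + 1) j + deltaT τ y k j) := by
    ext j; simp only [deltaT]; field_simp; ring
  rw [this, gridSemiNorm_const_mul, abs_of_pos hτ]
  gcongr
  exact gridSemiNorm_add_le hh _ _

lemma gridSemiNorm_avg_le (hh : 0 ≤ h) (y : ℕ → ℕ → ℝ) (k : ℕ) :
    gridSemiNorm M h (avg y (k + 1))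
      ≤ (gridSemiNorm M h (y (k + 2)) + gridSemiNorm M h (y k)) / 2 := by
  have : avg y (k + 1) = fun j => 1 / 2 * (y (k + 2) j + y k j) := by
    ext j; simp only [avg, Nat.add_sub_cancel]; ring
  rw [this, gridSemiNorm_const_mul, abs_of_pos (by norm_num)]
  have := gridSemiNorm_add_le (M := M) hh (y (k + 2)) (y k)
  linarith

/-- The lower order part of the equation for the error of `E` at the level `k + 1`. -/
noncomputable def errorForce (h τ : ℝ) (P X Φ U V : ℕ → ℕ → ℝ) (k j : ℕ) : ℝ :=
  (-1 - P (k + 1) j + U (k + 1) j ^ 2) * avg (fun l i => X l i - U l i) (k + 1) j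
    + ((X (k + 1) j + U (k + 1) j) * avg X (k + 1) j) * (X (k + 1) j - U (k + 1) j)
    + -avg X (k + 1) j * (Φ (k + 1) j - V (k + 1) j)
    + -V (k + 1) j * avg (fun l i => X l i - U l i) (k + 1) j
    + (deltaT2 τ X (k + 1) j - (deltaX2 h (avg X (k + 1)) j
      + (-1 + X (k + 1) j ^ 2 - Φ (k + 1) j - P (k + 1) j) * avg X (k + 1) j))

/-- The discrete wave equation for the error `X - U`. -/
lemma deltaT2_error (hU : IsLevelSolution M h τ ε n P U V) {k : ℕ} (hk : k + 2 ≤ n) {j : ℕ}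
    (hj : 1 ≤ j) (hjM : j < M) :
    deltaT2 τ (fun l i => X l i - U l i) (k + 1) j
      = deltaX2 h (avg (fun l i => X l i - U l i) (k + 1)) j
        + errorForce h τ P X Φ U V k j := by
  have h1 := hU.eqn_E k hk j hj hjM
  have h2 : deltaT2 τ (fun l i => X l i - U l i) (k + 1) j
      = deltaT2 τ X (k + 1) j - deltaT2 τ U (k + 1) j := by
    simp only [deltaT2]; ring
  have h3 : deltaX2 h (avg (fun l i => X l i - U l i) (k + 1)) j
      = deltaX2 h (avg X (k + 1)) j - deltaX2 h (avg U (k + 1)) j := by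
    simp only [deltaX2, avg]; ring
  have h4 : avg (fun l i => X l i - U l i) (k + 1) j = avg X (k + 1) j - avg U (k + 1) j := by
    simp only [avg]; ring
  rw [h2, h3, h1, errorForce, h4]
  ring

/-- The bound `L` on `U` and `V` is only needed at the middle level `k + 1`, since the scheme is linear
in the level `k + 2`. -/
lemma gridNorm_errorForce_le (hh : 0 < h) (hL : M * h ≤ L) (h1 : 1 ≤ L) (hR : 0 ≤ R) (hKL : K ≤ L)
    (hX : IsReference M h τ ε K R n P X Φ) (hU : IsLevelSolution M h τ ε n P U V) {k : ℕ}
    (hk : k + 2 ≤ n) (hUL : ∀ j ≤ M, |U (k + 1) j| ≤ L) (hVL : gridNorm M h (V (k + 1)) ≤ L) :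
    gridNorm M h (errorForce h τ P X Φ U V k)
      ≤ 4 * L ^ 4 * (gridSemiNorm M h (avg (fun l i => X l i - U l i) (k + 1))
        + gridSemiNorm M h (fun i => X (k + 1) i - U (k + 1) i)
        + gridNorm M h (fun i => Φ (k + 1) i - V (k + 1) i) + R) := by
  have hL0 : 0 ≤ L := zero_le_one.trans h1
  have L2 : L ≤ L ^ 2 := le_self_pow₀ h1 (by norm_num)
  have hav : ∀ j ≤ M, |avg X (k + 1) j| ≤ L := fun j hj => by
    have a1 := abs_le.1 (hX.X_le (k + 2) hk j hj)
    have a2 := abs_le.1 (hX.X_le k (by omega) j hj)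
    simp only [avg, Nat.add_sub_cancel, abs_le]
    constructor <;> linarith
  refine gridNorm_lowerOrder_le (A₁ := fun j => -1 - P (k + 1) j + U (k + 1) j ^ 2)
    (A₂ := fun j => (X (k + 1) j + U (k + 1) j) * avg X (k + 1) j)
    (A₃ := fun j => -avg X (k + 1) j) (V := fun j => -V (k + 1) j) hh hL h1 hR ?_ ?_ ?_ ?_ ?_ ?_ ?_
  · simp only [avg, Nat.add_sub_cancel, (hX.bdry (k + 1 + 1) (by omega)).1,
      (hX.bdry k (by omega)).1, (hU.bdry (k + 1 + 1) (by omega)).1, (hU.bdry k (by omega)).1]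
    norm_num
  · simp only [(hX.bdry (k + 1) (by omega)).1, (hU.bdry (k + 1) (by omega)).1, sub_zero]
  · intro j hj hjM
    have a1 := abs_le.1 (hX.P_le k hk j hj hjM)
    have a2 : U (k + 1) j ^ 2 ≤ L ^ 2 := sq_le_sq' (abs_le.1 (hUL j hjM.le)).1
      (abs_le.1 (hUL j hjM.le)).2
    rw [abs_le]
    constructor <;> nlinarith [sq_nonneg (U (k + 1) j)]
  · intro j hj hjM
    have a1 := abs_add_le (X (k + 1) j) (U (k + 1) j)
    have a2 := hX.X_le (k + 1) (by omega) j hjM.le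
    have a3 := hUL j hjM.le
    rw [abs_mul]
    calc _ ≤ (2 * L) * L := by gcongr; · linarith
                               · exact hav j hjM.le
      _ = _ := by ring
  · intro j hj hjM
    rw [abs_neg]; exact hav j hjM.le
  · have : gridNorm M h (fun j => -V (k + 1) j) = gridNorm M h (V (k + 1)) := by
      unfold gridNorm; simp only [abs_neg]
    rw [this]; exact hVL
  · exact hX.res_E k hk

/-- Energy estimate for the error of `E`. The error of `F` enters only at the level `k + 1`, hence
through the energy between the levels `k` and `k + 1`. -/
lemma waveEnergy_step_le (hh : 0 < h) (hτ : 0 < τ) (hL : M * h ≤ L) (h1 : 1 ≤ L) (hR : 0 ≤ R)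
    (hKL : K ≤ L)
    (hX : IsReference M h τ ε K R n P X Φ) (hU : IsLevelSolution M h τ ε n P U V) {k : ℕ}
    (hk : k + 2 ≤ n) (hUL : ∀ j ≤ M, |U (k + 1) j| ≤ L) (hVL : gridNorm M h (V (k + 1)) ≤ L) :
    waveEnergy M h τ (fun l i => X l i - U l i) (k + 1)
        - waveEnergy M h τ (fun l i => X l i - U l i) k
      ≤ 100 * L ^ 4 * τ * (waveEnergy M h τ (fun l i => X l i - U l i) (k + 1)
        + waveEnergy M h τ (fun l i => X l i - U l i) k
        + dualEnergy M h τ ε (fun l i => Φ l i - V l i) w k + R ^ 2) := by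
  have hr := gridNorm_errorForce_le hh hL h1 hR hKL hX hU hk hUL hVL
  set e : ℕ → ℕ → ℝ := fun l i => X l i - U l i with he
  set g : ℕ → ℕ → ℝ := fun l i => Φ l i - V l i with hg
  have b0 := hX.bdry k (by omega)
  have b2 := hX.bdry (k + 2) hk
  have u0 := hU.bdry k (by omega)
  have u2 := hU.bdry (k + 2) hk
  rw [waveEnergy_succ_sub hh hτ e (errorForce h τ P X Φ U V k) k (by simp [he, b0, u0])
    (by simp [he, b0, u0]) (by simp [he, b2, u2]) (by simp [he, b2, u2])
    (fun j hj hjM => deltaT2_error hU hk hj hjM)]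
  refine (le_abs_self _).trans ((abs_wInner_le hh.le).trans ?_)
  have hq := gridSemiNorm_avg_le (M := M) hh.le e k
  have h2 := gridNorm_two_step_le (M := M) hh.le hτ e k
  have s2 := gridSemiNorm_nonneg (M := M) (h := h) (e (k + 2))
  have s1 := gridSemiNorm_nonneg (M := M) (h := h) (e (k + 1))
  have s0 := gridSemiNorm_nonneg (M := M) (h := h) (e k)
  have gg := gridNorm_nonneg (M := M) (h := h) (g (k + 1))
  have a1 := gridNorm_nonneg (M := M) (h := h) (deltaT τ e (k + 1))
  have a0 := gridNorm_nonneg (M := M) (h := h) (deltaT τ e k)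
  have hr' : gridNorm M h (errorForce h τ P X Φ U V k) ≤ 4 * L ^ 4 *
      (gridSemiNorm M h (e (k + 2)) + gridSemiNorm M h (e (k + 1)) + gridSemiNorm M h (e k)
        + gridNorm M h (g (k + 1)) + R) := by
    refine hr.trans ?_
    gcongr 4 * L ^ 4 * ?_
    change gridSemiNorm M h (avg e (k + 1)) + gridSemiNorm M h (e (k + 1))
      + gridNorm M h (g (k + 1)) + R ≤ _
    linarith
  have h3 := quintuple_mul_le (gridSemiNorm M h (e (k + 2))) (gridSemiNorm M h (e (k + 1)))
    (gridSemiNorm M h (e k)) (gridNorm M h (g (k + 1))) R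
    (gridNorm M h (deltaT τ e (k + 1))) (gridNorm M h (deltaT τ e k))
  have e1 := gridSemiNorm_succ_sq_le (M := M) (h := h) (τ := τ) (k + 1) e
  have e2 := gridSemiNorm_sq_le (M := M) (h := h) (τ := τ) k e
  have e3 := gridSemiNorm_succ_sq_le (M := M) (h := h) (τ := τ) k e
  have e4 := gridNorm_deltaT_sq_le (M := M) (h := h) (τ := τ) k e
  have e5 := gridNorm_deltaT_sq_le (M := M) (h := h) (τ := τ) (k + 1) e
  have e6 := gridNorm_succ_sq_le (M := M) (h := h) (τ := τ) (ε := ε) k g w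
  have n1 := waveEnergy_nonneg (M := M) (h := h) (τ := τ) e k
  have n2 := waveEnergy_nonneg (M := M) (h := h) (τ := τ) e (k + 1)
  have n3 := dualEnergy_nonneg (M := M) (h := h) (τ := τ) (ε := ε) g w k
  calc _ ≤ 4 * L ^ 4 * (gridSemiNorm M h (e (k + 2)) + gridSemiNorm M h (e (k + 1))
        + gridSemiNorm M h (e k) + gridNorm M h (g (k + 1)) + R)
        * (τ * (gridNorm M h (deltaT τ e (k + 1)) + gridNorm M h (deltaT τ e k))) := by
        apply mul_le_mul hr' h2 (gridNorm_nonneg _) (by positivity)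
    _ = 4 * L ^ 4 * τ * ((gridSemiNorm M h (e (k + 2)) + gridSemiNorm M h (e (k + 1))
        + gridSemiNorm M h (e k) + gridNorm M h (g (k + 1)) + R)
        * (gridNorm M h (deltaT τ e (k + 1)) + gridNorm M h (deltaT τ e k))) := by ring
    _ ≤ 4 * L ^ 4 * τ * (25 * (waveEnergy M h τ e (k + 1) + waveEnergy M h τ e k
        + dualEnergy M h τ ε g w k + R ^ 2)) := by
        gcongr 4 * L ^ 4 * τ * ?_
        have : gridSemiNorm M h (e (k + 1 + 1)) = gridSemiNorm M h (e (k + 2)) := rfl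
        rw [this] at e1
        have := sq_nonneg R
        linarith
    _ = _ := by ring

/-- Energy estimate for the error of `F`. Besides bounds on `U` on three levels it uses a bound on the
time difference quotient of `X - U`, for the quadratic term in the expansion of `δ_t² (X² - U²)`. -/
lemma dualEnergy_step_le (hh : 0 < h) (hτ : 0 < τ) (hε : 0 < ε) (hε1 : ε ≤ 1)
    (hL : M * h ≤ L) (h1 : 1 ≤ L) (hR : 0 ≤ R) (hKL : K ≤ L)
    (hX : IsReference M h τ ε K R n P X Φ) (hU : IsLevelSolution M h τ ε n P U V)
    (hw0 : ∀ i, w i 0 = 0) (hwM : ∀ i, w i M = 0)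
    (hw : ∀ i, ∀ j, 1 ≤ j → j < M → -deltaX2 h (w i) j = Φ i j - V i j) {k : ℕ}
    (hk : k + 2 ≤ n) (hUL : ∀ i ≤ k + 2, k ≤ i → ∀ j ≤ M, |U i j| ≤ L)
    (hVL : gridNorm M h (V (k + 1)) ≤ L)
    (hSU : ∀ i ≤ k + 2, k ≤ i → gridSemiNorm M h (U i) ≤ L)
    (hd : gridNorm M h (deltaT τ (fun l i => X l i - U l i) (k + 1))
      + gridNorm M h (deltaT τ (fun l i => X l i - U l i) k) ≤ 2 * L) :
    dualEnergy M h τ ε (fun l i => Φ l i - V l i) w (k + 1)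
        - dualEnergy M h τ ε (fun l i => Φ l i - V l i) w k
      ≤ 400 * L ^ 9 * τ * (waveEnergy M h τ (fun l i => X l i - U l i) (k + 1)
        + waveEnergy M h τ (fun l i => X l i - U l i) k
        + dualEnergy M h τ ε (fun l i => Φ l i - V l i) w (k + 1)
        + dualEnergy M h τ ε (fun l i => Φ l i - V l i) w k + R ^ 2) := by
  have hr := gridNorm_errorForce_le hh hL h1 hR hKL hX hU hk
    (hUL (k + 1) (by omega) (by omega)) hVL
  set e : ℕ → ℕ → ℝ := fun l i => X l i - U l i with he
  set g : ℕ → ℕ → ℝ := fun l i => Φ l i - V l i with hg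
  have hL0 : 0 ≤ L := zero_le_one.trans h1
  set r := errorForce h τ P X Φ U V k with hrdef
  set q := avg e (k + 1) with hqdef
  set d : ℕ → ℝ := fun j => 1 / 2 * (deltaT τ e (k + 1) j + deltaT τ e k j) with hddef
  set Q : ℕ → ℝ := fun j => avg U (k + 1) j + U (k + 1) j with hQdef
  set Xc : ℕ → ℝ := fun j => 1 / 2 * (deltaT τ X (k + 1) j + deltaT τ X k j) with hXc
  set W : ℕ → ℝ := fun j => w (k + 2) j - w k j with hWdef
  set ζ₀ : ℕ → ℝ := fun j => deltaT2 τ X (k + 1) j * (q j + e (k + 1) j)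
    + (deltaX2 h q j + r j) * Q j + 4 * (Xc j * d j) - 2 * d j ^ 2 with hζ₀
  set η : ℕ → ℝ := fun j => deltaT2 τ Φ (k + 1) j
      - (1 / (2 * ε ^ 2) * deltaX2 h (fun i => Φ (k + 2) i + Φ k i) j
        + deltaT2 τ (fun l i => X l i ^ 2) (k + 1) j) with hη
  have hW0 : W 0 = 0 := by simp [hWdef, hw0]
  have hWM : W M = 0 := by simp [hWdef, hwM]
  have he0 : ∀ i ≤ n, e i 0 = 0 := fun i hi => by
    simp only [he, (hX.bdry i hi).1, (hU.bdry i hi).1, sub_zero]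
  have hq0 : q 0 = 0 := by
    simp only [hqdef, avg, Nat.add_sub_cancel, he0 (k + 1 + 1) hk, he0 k (by omega)]; norm_num
  -- the error equation for the density
  have heq : ∀ j, 1 ≤ j → j < M → deltaT2 τ g (k + 1) j
      = 1 / (2 * ε ^ 2) * deltaX2 h (fun i => g (k + 2) i + g k i) j + (ζ₀ j + η j) := by
    intro j hj hjM
    have c1 := hU.eqn_F k hk j hj hjM
    have c2 : deltaT2 τ e (k + 1) j = deltaX2 h q j + r j := deltaT2_error hU hk hj hjM
    have c3 : deltaT2 τ g (k + 1) j = deltaT2 τ Φ (k + 1) j - deltaT2 τ V (k + 1) j := by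
      simp only [deltaT2, hg]; ring
    have c4 : deltaX2 h (fun i => g (k + 2) i + g k i) j
        = deltaX2 h (fun i => Φ (k + 2) i + Φ k i) j
          - deltaX2 h (fun i => V (k + 2) i + V k i) j := by
      simp only [deltaX2, hg]; ring
    have c5 : ζ₀ j = deltaT2 τ (fun l i => X l i ^ 2) (k + 1) j
        - deltaT2 τ (fun l i => U l i ^ 2) (k + 1) j := by
      simp only [hζ₀, ← c2]
      simp only [hXc, hQdef, hddef, hqdef, he, deltaT2, deltaT, avg, Nat.add_sub_cancel]
      field_simp
      ring
    rw [c3, c4, c1, c5]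
    simp only [hη]
    ring
  rw [dualEnergy_succ_sub hh hτ hε g w (fun j => ζ₀ j + η j) k hw0 hwM (fun i _ => hw i)
    (fun i hi => by
      simp only [hg, (hX.bdry i (by omega)).2.2.1, (hU.bdry i (by omega)).2.2.1, sub_zero])
    (fun i hi => by
      simp only [hg, (hX.bdry i (by omega)).2.2.2, (hU.bdry i (by omega)).2.2.2, sub_zero]) heq,
    wInner_add_left]
  have hd' : gridNorm M h d ≤ (gridNorm M h (deltaT τ e (k + 1)) + gridNorm M h (deltaT τ e k)) / 2 := by
    rw [hddef, gridNorm_const_mul, abs_of_pos (by norm_num : (0 : ℝ) < 1 / 2)]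
    have := gridNorm_add_le (M := M) hh.le (deltaT τ e (k + 1)) (deltaT τ e k)
    linarith
  have i1 : |wInner (Finset.Ico 1 M) h ζ₀ W| ≤ L ^ 5 * gridSemiNorm M h W
      * (5 * gridSemiNorm M h q + gridSemiNorm M h (e (k + 1)) + 2 * gridNorm M h r
        + 6 * gridNorm M h d) := by
    refine abs_wInner_deltaT2_sq_le hh hL h1 hq0 (he0 (k + 1) (by omega)) hW0 hWM ?_ ?_ ?_ ?_ ?_
    · intro j hj
      have a0 := abs_le.1 (hUL k (by omega) le_rfl j hj)
      have a1 := abs_le.1 (hUL (k + 1) (by omega) (by omega) j hj)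
      have a2 := abs_le.1 (hUL (k + 2) le_rfl (by omega) j hj)
      simp only [hQdef, avg, Nat.add_sub_cancel, abs_le]
      constructor <;> linarith
    · have b1 := gridSemiNorm_add_le (M := M) hh.le (avg U (k + 1)) (U (k + 1))
      have b2 := gridSemiNorm_avg_le (M := M) hh.le U k
      have a0 := hSU k (by omega) le_rfl
      have a1 := hSU (k + 1) (by omega) (by omega)
      have a2 := hSU (k + 2) le_rfl (by omega)
      simp only [hQdef]
      linarith
    · exact fun j hj hjM => (hX.X_dtt k hk j hj hjM).trans hKL
    · intro j hj hjM
      have a0 := abs_le.1 (hX.X_dt k (by omega) j hj hjM)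
      have a1 := abs_le.1 (hX.X_dt (k + 1) hk j hj hjM)
      simp only [hXc, abs_le]
      constructor <;> linarith
    · linarith
  -- of the factor `ε²` in front of the sources, one `ε` goes to the residual and the other one
  -- to `W`
  have i2 : ε * |wInner (Finset.Ico 1 M) h η W| ≤ L * R * (L ^ 2 * gridSemiNorm M h W) := by
    have c1 : ε * |wInner (Finset.Ico 1 M) h η W|
        = |wInner (Finset.Ico 1 M) h (fun j => ε * η j) W| := by
      rw [← abs_of_pos hε, ← abs_mul, abs_of_pos hε]
      congr 1
      unfold wInner; simp only [mul_assoc, ← Finset.mul_sum]; ring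
    rw [c1]
    refine (abs_wInner_le hh.le).trans ?_
    apply mul_le_mul _ (gridNorm_le_gridSemiNorm hh hL h1 hW0) (gridNorm_nonneg _) (by positivity)
    refine gridNorm_le_sup hh.le hL h1 hR fun j hj hjM => ?_
    rw [abs_mul, abs_of_pos hε]
    exact hX.res_F k hk j hj hjM
  have hq := gridSemiNorm_avg_le (M := M) hh.le e k
  have hSW : gridSemiNorm M h W ≤ _ := gridSemiNorm_two_step_le (M := M) hh.le hτ w k
  have s2 := gridSemiNorm_nonneg (M := M) (h := h) (e (k + 2))
  have s1 := gridSemiNorm_nonneg (M := M) (h := h) (e (k + 1))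
  have s0 := gridSemiNorm_nonneg (M := M) (h := h) (e k)
  have gg := gridNorm_nonneg (M := M) (h := h) (g (k + 1))
  have a1 := gridNorm_nonneg (M := M) (h := h) (deltaT τ e (k + 1))
  have a0 := gridNorm_nonneg (M := M) (h := h) (deltaT τ e k)
  have d1 := gridSemiNorm_nonneg (M := M) (h := h) (deltaT τ w (k + 1))
  have d0 := gridSemiNorm_nonneg (M := M) (h := h) (deltaT τ w k)
  have sW := gridSemiNorm_nonneg (M := M) (h := h) W
  set Y := gridSemiNorm M h (e (k + 2)) + gridSemiNorm M h (e (k + 1)) + gridSemiNorm M h (e k)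
    + gridNorm M h (g (k + 1)) + R + gridNorm M h (deltaT τ e (k + 1))
    + gridNorm M h (deltaT τ e k) with hY
  have hY0 : 0 ≤ Y := by positivity
  have L4 : 1 ≤ L ^ 4 := one_le_pow₀ h1
  have hbr : 5 * gridSemiNorm M h q + gridSemiNorm M h (e (k + 1)) + 2 * gridNorm M h r
        + 6 * gridNorm M h d ≤ 14 * L ^ 4 * Y := by
    have c1 : gridNorm M h r ≤ 4 * L ^ 4 * (gridSemiNorm M h q + gridSemiNorm M h (e (k + 1))
      + gridNorm M h (g (k + 1)) + R) := hr
    have c2 : gridSemiNorm M h q + gridSemiNorm M h (e (k + 1)) + gridNorm M h (g (k + 1)) + R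
        + (gridNorm M h (deltaT τ e (k + 1)) + gridNorm M h (deltaT τ e k)) / 2
          ≤ Y := by
      linarith
    have c3 : 6 * gridSemiNorm M h q + 6 * gridSemiNorm M h (e (k + 1)) + 6 * gridNorm M h d
        ≤ 6 * L ^ 4 * Y := by
      have := mul_le_mul_of_nonneg_right L4 hY0
      linarith
    have c4 : 2 * gridNorm M h r ≤ 8 * L ^ 4 * Y := by
      have : 8 * L ^ 4 * (gridSemiNorm M h q + gridSemiNorm M h (e (k + 1))
        + gridNorm M h (g (k + 1)) + R) ≤ 8 * L ^ 4 * Y := by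
        gcongr 8 * L ^ 4 * ?_
        linarith
      linarith
    have := gridSemiNorm_nonneg (M := M) (h := h) q
    linarith
  have h3 := septuple_mul_le (gridSemiNorm M h (e (k + 2))) (gridSemiNorm M h (e (k + 1)))
    (gridSemiNorm M h (e k)) (gridNorm M h (g (k + 1))) R
    (gridNorm M h (deltaT τ e (k + 1))) (gridNorm M h (deltaT τ e k))
    (ε * gridSemiNorm M h (deltaT τ w (k + 1))) (ε * gridSemiNorm M h (deltaT τ w k))
  rw [← hY] at h3
  have e1 := gridSemiNorm_succ_sq_le (M := M) (h := h) (τ := τ) (k + 1) e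
  have e2 := gridSemiNorm_sq_le (M := M) (h := h) (τ := τ) k e
  have e3 := gridSemiNorm_succ_sq_le (M := M) (h := h) (τ := τ) k e
  have e4 := gridNorm_deltaT_sq_le (M := M) (h := h) (τ := τ) k e
  have e5 := gridNorm_deltaT_sq_le (M := M) (h := h) (τ := τ) (k + 1) e
  have e6 := gridNorm_succ_sq_le (M := M) (h := h) (τ := τ) (ε := ε) k g w
  have e7 := gridSemiNorm_deltaT_sq_le (M := M) (h := h) (τ := τ) (ε := ε) k g w
  have e8 := gridSemiNorm_deltaT_sq_le (M := M) (h := h) (τ := τ) (ε := ε) (k + 1) g w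
  have n1 := waveEnergy_nonneg (M := M) (h := h) (τ := τ) e k
  have n2 := waveEnergy_nonneg (M := M) (h := h) (τ := τ) e (k + 1)
  have n3 := dualEnergy_nonneg (M := M) (h := h) (τ := τ) (ε := ε) g w k
  have n4 := dualEnergy_nonneg (M := M) (h := h) (τ := τ) (ε := ε) g w (k + 1)
  set σ := ε * gridSemiNorm M h (deltaT τ w (k + 1)) + ε * gridSemiNorm M h (deltaT τ w k) with hσ
  have hσ0 : 0 ≤ σ := by positivity
  have hWσ : ε * gridSemiNorm M h W ≤ τ * σ := by
    calc _ ≤ ε * (τ * (gridSemiNorm M h (deltaT τ w (k + 1))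
        + gridSemiNorm M h (deltaT τ w k))) := by gcongr
      _ = _ := by rw [hσ]; ring
  have f1 : ε ^ 2 * |wInner (Finset.Ico 1 M) h ζ₀ W| ≤ 14 * L ^ 9 * τ * (Y * σ) := by
    calc ε ^ 2 * |wInner (Finset.Ico 1 M) h ζ₀ W|
        ≤ ε ^ 2 * (L ^ 5 * gridSemiNorm M h W * (14 * L ^ 4 * Y)) := by
          gcongr; exact i1.trans (by gcongr)
      _ = ε * (14 * L ^ 9 * (Y * (ε * gridSemiNorm M h W))) := by ring
      _ ≤ 1 * (14 * L ^ 9 * (Y * (τ * σ))) := by gcongr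
      _ = _ := by ring
  have f2 : ε ^ 2 * |wInner (Finset.Ico 1 M) h η W| ≤ L ^ 9 * τ * (Y * σ) := by
    calc ε ^ 2 * |wInner (Finset.Ico 1 M) h η W|
        = ε * (ε * |wInner (Finset.Ico 1 M) h η W|) := by ring
      _ ≤ ε * (L * R * (L ^ 2 * gridSemiNorm M h W)) := by gcongr
      _ = L ^ 3 * (R * (ε * gridSemiNorm M h W)) := by ring
      _ ≤ L ^ 9 * (Y * (τ * σ)) := by
          gcongr
          · norm_num
          · linarith
      _ = _ := by ring
  calc ε ^ 2 * (wInner (Finset.Ico 1 M) h ζ₀ W + wInner (Finset.Ico 1 M) h η W)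
      ≤ ε ^ 2 * (|wInner (Finset.Ico 1 M) h ζ₀ W| + |wInner (Finset.Ico 1 M) h η W|) := by
        gcongr <;> exact le_abs_self _
    _ ≤ 15 * L ^ 9 * τ * (Y * σ) := by linarith
    _ ≤ 15 * L ^ 9 * τ * (26 * (waveEnergy M h τ e (k + 1) + waveEnergy M h τ e k
        + dualEnergy M h τ ε g w (k + 1) + dualEnergy M h τ ε g w k + R ^ 2)) := by
        gcongr 15 * L ^ 9 * τ * ?_
        have : gridSemiNorm M h (e (k + 1 + 1)) = gridSemiNorm M h (e (k + 2)) := rfl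
        rw [this] at e1
        have := sq_nonneg R
        linarith
    _ ≤ _ := by
        have : 0 ≤ L ^ 9 * τ * (waveEnergy M h τ e (k + 1) + waveEnergy M h τ e k
          + dualEnergy M h τ ε g w (k + 1) + dualEnergy M h τ ε g w k + R ^ 2) := by positivity
        linarith

end Stability

/-- No error at the level zero, and an error of size `R` in the energies between the first two
levels. The time difference quotient of the error of `E` accounts for the factor `τ` in `one_E`;
`one_F'` bounds the time difference quotient of the error of `F`, which has the weight `ε` in
`dualEnergy`. -/
structure IsClose (M : ℕ) (h τ ε R : ℝ) (X Φ U V : ℕ → ℕ → ℝ) : Prop where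
  zero_E : ∀ j ≤ M, X 0 j = U 0 j
  zero_F : ∀ j ≤ M, Φ 0 j = V 0 j
  one_E : ∀ j, 1 ≤ j → j < M → |X 1 j - U 1 j| ≤ R * τ
  one_dx : ∀ j < M, |deltaX h (fun i => X 1 i - U 1 i) j| ≤ R
  one_F : ∀ j, 1 ≤ j → j < M → |Φ 1 j - V 1 j| ≤ R
  one_F' : ∀ j, 1 ≤ j → j < M → ε * |Φ 1 j - V 1 j| ≤ R * τ

/-- The growth factor of the error energy on `[0, T]`: the factor from the discrete Gronwall
inequality, times the factor `4 K⁶` from the comparison of the initial energy with `R²`. -/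
noncomputable def growth (K T : ℝ) : ℝ := Real.exp (2000 * (4 * K ^ 2) ^ 9 * T) * (4 * K ^ 6)

section Stability

variable {M n : ℕ} {h τ ε K R T : ℝ} {P X Φ U V w : ℕ → ℕ → ℝ}

lemma IsReference.mono {m : ℕ} (hX : IsReference M h τ ε K R n P X Φ) (hm : m ≤ n) :
    IsReference M h τ ε K R m P X Φ where
  bdry k hk := hX.bdry k (hk.trans hm)
  X_le k hk := hX.X_le k (hk.trans hm)
  X_dx k hk := hX.X_dx k (hk.trans hm)
  X_dt k hk := hX.X_dt k (hk.trans hm)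
  X_dtt k hk := hX.X_dtt k (hk.trans hm)
  Φ_le k hk := hX.Φ_le k (hk.trans hm)
  P_le k hk := hX.P_le k (hk.trans hm)
  res_E k hk := hX.res_E k (hk.trans hm)
  res_F k hk := hX.res_F k (hk.trans hm)

lemma one_le_growth (hK : 1 ≤ K) (hT : 0 ≤ T) : 1 ≤ growth K T := by
  have h1 : 1 ≤ Real.exp (2000 * (4 * K ^ 2) ^ 9 * T) := Real.one_le_exp (by positivity)
  have h2 : 1 ≤ 4 * K ^ 6 := by nlinarith [one_le_pow₀ (n := 6) hK]
  unfold growth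
  nlinarith

/-- If the error of `E` is bounded in the discrete `H¹` seminorm, then `U` is bounded in the maximum
norm and in the discrete `H¹` seminorm. -/
lemma abs_le_of_waveEnergy_le (hh : 0 < h) (hL : M * h ≤ K) (h1 : 1 ≤ K)
    (hX : IsReference M h τ ε K R n P X Φ) (hU : IsLevelSolution M h τ ε n P U V) {i : ℕ}
    (hi : i ≤ n) (hS : gridSemiNorm M h (fun j => X i j - U i j) ^ 2 ≤ 4) :
    (∀ j ≤ M, |U i j| ≤ 4 * K ^ 2) ∧ gridSemiNorm M h (U i) ≤ 4 * K ^ 2 := by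
  have hS' : gridSemiNorm M h (fun j => X i j - U i j) ≤ 2 :=
    le_of_sq_le_sq (hS.trans (by norm_num)) (by norm_num)
  have K2 : K ≤ K ^ 2 := le_self_pow₀ h1 (by norm_num)
  constructor
  · intro j hj
    have a1 := abs_le_gridSemiNorm (M := M) (v := fun j => X i j - U i j) hh hL h1
      (by simp only [(hX.bdry i hi).1, (hU.bdry i hi).1, sub_zero]) hj
    have a2 := hX.X_le i hi j hj
    have a3 : |U i j| ≤ |X i j| + |X i j - U i j| := by
      have := abs_sub (X i j) (X i j - U i j)
      rwa [sub_sub_cancel] at this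
    have a4 : K * gridSemiNorm M h (fun j => X i j - U i j) ≤ K * 2 := by gcongr
    linarith
  · have a1 := gridSemiNorm_sub_le (M := M) hh.le (X i) (fun j => X i j - U i j)
    simp only [sub_sub_cancel] at a1
    have a2 := gridSemiNorm_le_sup hh.le hL h1 (zero_le_one.trans h1) (hX.X_dx i hi)
    have a3 : gridSemiNorm M h (U i) = gridSemiNorm M h (fun j => U i j) := rfl
    nlinarith

lemma gridNorm_le_of_sq_le (hh : 0 < h) (hL : M * h ≤ K) (h1 : 1 ≤ K)
    (hX : IsReference M h τ ε K R n P X Φ) {i : ℕ}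
    (hi : i ≤ n) (hS : gridNorm M h (fun j => Φ i j - V i j) ^ 2 ≤ 4) :
    gridNorm M h (V i) ≤ 4 * K ^ 2 := by
  have hS' : gridNorm M h (fun j => Φ i j - V i j) ≤ 2 :=
    le_of_sq_le_sq (hS.trans (by norm_num)) (by norm_num)
  have a1 : gridNorm M h (fun j => Φ i j - (Φ i j - V i j))
      ≤ gridNorm M h (Φ i) + gridNorm M h (fun j => Φ i j - V i j) := wNorm_sub_le hh.le _ _
  simp only [sub_sub_cancel] at a1
  have a2 := gridNorm_le_sup hh.le hL h1 (zero_le_one.trans h1) (hX.Φ_le i hi)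
  have a3 : gridNorm M h (V i) = gridNorm M h (fun j => V i j) := rfl
  nlinarith

/-- The error energy on the first two levels. -/
lemma energy_zero_le (hh : 0 < h) (hτ : 0 < τ) (hε : 0 < ε) (hL : M * h ≤ K) (h1 : 1 ≤ K)
    (hR : 0 ≤ R) (hc : IsClose M h τ ε R X Φ U V)
    (hw0 : ∀ i, w i 0 = 0) (hwM : ∀ i, w i M = 0)
    (hw : ∀ i, ∀ j, 1 ≤ j → j < M → -deltaX2 h (w i) j = Φ i j - V i j) :
    waveEnergy M h τ (fun l i => X l i - U l i) 0
        + dualEnergy M h τ ε (fun l i => Φ l i - V l i) w 0 + R ^ 2 ≤ 4 * K ^ 6 * R ^ 2 := by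
  have hK0 : 0 ≤ K := zero_le_one.trans h1
  have z1 : ∀ j ≤ M, X 0 j - U 0 j = 0 := fun j hj => by rw [hc.zero_E j hj, sub_self]
  have z2 : ∀ j ≤ M, Φ 0 j - V 0 j = 0 := fun j hj => by rw [hc.zero_F j hj, sub_self]
  have a1 : gridNorm M h (deltaT τ (fun l i => X l i - U l i) 0) ≤ K * R := by
    refine gridNorm_le_sup hh.le hL h1 hR fun j hj hjM => ?_
    simp only [deltaT, z1 j hjM.le, sub_zero, zero_add]
    rw [abs_div, abs_of_pos hτ, div_le_iff₀ hτ]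
    exact hc.one_E j hj hjM
  have a2 : gridSemiNorm M h (fun i => X (0 + 1) i - U (0 + 1) i) ≤ K * R :=
    gridSemiNorm_le_sup hh.le hL h1 hR hc.one_dx
  have a3 : gridSemiNorm M h (fun i => X 0 i - U 0 i) ≤ K * 0 :=
    gridSemiNorm_le_sup hh.le hL h1 le_rfl fun j hj => by
      simp only [deltaX, z1 j hj.le, z1 (j + 1) hj, sub_zero, zero_div, abs_zero, le_refl]
  have a4 : gridNorm M h (fun i => Φ (0 + 1) i - V (0 + 1) i) ≤ K * R :=
    gridNorm_le_sup hh.le hL h1 hR hc.one_F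
  have a5 : gridNorm M h (fun i => Φ 0 i - V 0 i) ≤ K * 0 :=
    gridNorm_le_sup hh.le hL h1 le_rfl fun j _ hj => by
      simp only [z2 j hj.le, abs_zero, le_refl]
  have a6 : ε * gridSemiNorm M h (deltaT τ w 0) ≤ K ^ 3 * R := by
    have b1 : gridNorm M h (fun j => ε / τ * (Φ 1 j - V 1 j)) ≤ K * R :=
      gridNorm_le_sup hh.le hL h1 hR fun j hj hjM => by
        rw [abs_mul, abs_div, abs_of_pos hτ, abs_of_pos hε, div_mul_eq_mul_div, div_le_iff₀ hτ]
        exact hc.one_F' j hj hjM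
    have b2 := gridSemiNorm_le_of_neg_deltaX2 (M := M) (w := fun j => ε * deltaT τ w 0 j)
      (g := fun j => ε / τ * (Φ 1 j - V 1 j)) hh hL h1 (by simp [deltaT, hw0])
      (by simp [deltaT, hwM]) (fun j hj hjM => by
        rw [← hw 1 j hj hjM]
        have b3 : deltaX2 h (w 0) j = 0 := by
          have := hw 0 j hj hjM; rw [z2 j hjM.le] at this; linarith
        have b4 : deltaX2 h (fun j => ε * deltaT τ w 0 j) j
            = ε / τ * (deltaX2 h (w 1) j - deltaX2 h (w 0) j) := by
          simp only [deltaX2, deltaT]; field_simp; ring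
        rw [b4, b3]; ring)
    rw [gridSemiNorm_const_mul, abs_of_pos hε] at b2
    calc _ ≤ K ^ 2 * (K * R) := b2.trans (by gcongr)
      _ = _ := by ring
  have s1 := gridNorm_nonneg (M := M) (h := h) (deltaT τ (fun l i => X l i - U l i) 0)
  have s2 := gridSemiNorm_nonneg (M := M) (h := h) (fun i => X (0 + 1) i - U (0 + 1) i)
  have s3 := gridSemiNorm_nonneg (M := M) (h := h) (fun i => X 0 i - U 0 i)
  have s4 := gridNorm_nonneg (M := M) (h := h) (fun i => Φ (0 + 1) i - V (0 + 1) i)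
  have s5 := gridNorm_nonneg (M := M) (h := h) (fun i => Φ 0 i - V 0 i)
  have s6 : 0 ≤ ε * gridSemiNorm M h (deltaT τ w 0) :=
    mul_nonneg hε.le (gridSemiNorm_nonneg _)
  have q1 := pow_le_pow_left₀ s1 a1 2
  have q2 := pow_le_pow_left₀ s2 a2 2
  have q3 := pow_le_pow_left₀ s3 a3 2
  have q4 := pow_le_pow_left₀ s4 a4 2
  have q5 := pow_le_pow_left₀ s5 a5 2
  have q6 := pow_le_pow_left₀ s6 a6 2
  have k1 : K ^ 2 * R ^ 2 ≤ K ^ 6 * R ^ 2 := by gcongr; norm_num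
  have k2 : 1 * R ^ 2 ≤ K ^ 6 * R ^ 2 := by gcongr; exact one_le_pow₀ h1
  unfold waveEnergy dualEnergy
  simp only [mul_pow] at q1 q2 q3 q4 q5 q6 ⊢
  ring_nf at q1 q2 q3 q4 q5 q6 k1 k2 ⊢
  linarith

/-- Growth of the total error energy over one time step, once the energy is at most `1`. The
estimate for `waveEnergy` needs `U` and `V` only up to the level `k + 1`, where they are bounded by
assumption; it yields the bound on `U` at the level `k + 2` that the estimate for `dualEnergy`
needs. -/
lemma energy_succ_le (hh : 0 < h) (hτ : 0 < τ) (hε : 0 < ε) (hε1 : ε ≤ 1)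
    (hL : M * h ≤ K) (h1 : 1 ≤ K) (hR : 0 ≤ R) (hτK : 500 * (4 * K ^ 2) ^ 9 * τ ≤ 1 / 2)
    (hX : IsReference M h τ ε K R n P X Φ) (hU : IsLevelSolution M h τ ε n P U V)
    (hw0 : ∀ i, w i 0 = 0) (hwM : ∀ i, w i M = 0)
    (hw : ∀ i, ∀ j, 1 ≤ j → j < M → -deltaX2 h (w i) j = Φ i j - V i j) {k : ℕ}
    (hk : k + 2 ≤ n)
    (hE : waveEnergy M h τ (fun l i => X l i - U l i) k
        + dualEnergy M h τ ε (fun l i => Φ l i - V l i) w k + R ^ 2 ≤ 1) :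
    waveEnergy M h τ (fun l i => X l i - U l i) (k + 1)
        + dualEnergy M h τ ε (fun l i => Φ l i - V l i) w (k + 1) + R ^ 2
      ≤ (1 + 2000 * (4 * K ^ 2) ^ 9 * τ) * (waveEnergy M h τ (fun l i => X l i - U l i) k
        + dualEnergy M h τ ε (fun l i => Φ l i - V l i) w k + R ^ 2) := by
  have K2 : K ≤ K ^ 2 := le_self_pow₀ h1 (by norm_num)
  set L := 4 * K ^ 2 with hLdef
  have hL4 : 4 ≤ L := by nlinarith
  have hL1 : 1 ≤ L := by linarith
  have hKL : K ≤ L := by nlinarith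
  have hML : M * h ≤ L := hL.trans hKL
  have nA := waveEnergy_nonneg (M := M) (h := h) (τ := τ) (fun l i => X l i - U l i) k
  have nB := dualEnergy_nonneg (M := M) (h := h) (τ := τ) (ε := ε) (fun l i => Φ l i - V l i) w k
  have nA' := waveEnergy_nonneg (M := M) (h := h) (τ := τ) (fun l i => X l i - U l i) (k + 1)
  have nB' := dualEnergy_nonneg (M := M) (h := h) (τ := τ) (ε := ε)
    (fun l i => Φ l i - V l i) w (k + 1)
  have nR := sq_nonneg R
  have u0 := abs_le_of_waveEnergy_le hh hL h1 hX hU (i := k) (by omega)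
    ((gridSemiNorm_sq_le (τ := τ) k (fun l i => X l i - U l i)).trans (by linarith))
  have u1 := abs_le_of_waveEnergy_le hh hL h1 hX hU (i := k + 1) (by omega)
    ((gridSemiNorm_succ_sq_le (τ := τ) k (fun l i => X l i - U l i)).trans (by linarith))
  have v1 := gridNorm_le_of_sq_le (V := V) hh hL h1 hX (i := k + 1) (by omega)
    ((gridNorm_succ_sq_le (τ := τ) (ε := ε) k (fun l i => Φ l i - V l i) w).trans (by linarith))
  have hA := waveEnergy_step_le (w := w) hh hτ hML hL1 hR hKL hX hU hk u1.1 v1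
  have c1 : 100 * L ^ 4 * τ ≤ 1 / 10 := by
    have : L ^ 4 * τ ≤ L ^ 9 * τ := by gcongr; norm_num
    linarith
  have c0 : 0 ≤ 100 * L ^ 4 * τ := by positivity
  set A := waveEnergy M h τ (fun l i => X l i - U l i) k
  set A' := waveEnergy M h τ (fun l i => X l i - U l i) (k + 1) with hA'
  set B := dualEnergy M h τ ε (fun l i => Φ l i - V l i) w k
  set B' := dualEnergy M h τ ε (fun l i => Φ l i - V l i) w (k + 1)
  have c2 : A' - A ≤ 1 / 10 * (A' + A + B + R ^ 2) :=
    hA.trans (mul_le_mul_of_nonneg_right c1 (by linarith))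
  -- the new wave energy is bounded, and so is `U` at the new level
  have c3 : A' ≤ 2 := by linarith
  have u2 := abs_le_of_waveEnergy_le hh hL h1 hX hU (i := k + 2) hk
    ((gridSemiNorm_succ_sq_le (τ := τ) (k + 1) (fun l i => X l i - U l i)).trans
      (by linarith))
  have d0 : gridNorm M h (deltaT τ (fun l i => X l i - U l i) k) ≤ 2 :=
    le_of_sq_le_sq ((gridNorm_deltaT_sq_le k _).trans (by linarith)) (by norm_num)
  have d1 : gridNorm M h (deltaT τ (fun l i => X l i - U l i) (k + 1)) ≤ 2 :=
    le_of_sq_le_sq ((gridNorm_deltaT_sq_le (k + 1) _).trans (by linarith)) (by norm_num)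
  have hB := dualEnergy_step_le hh hτ hε hε1 hML hL1 hR hKL hX hU hw0 hwM hw hk
    (fun i hi hi' => by
      rcases (by omega : i = k ∨ i = k + 1 ∨ i = k + 2) with rfl | rfl | rfl
      exacts [u0.1, u1.1, u2.1]) v1
    (fun i hi hi' => by
      rcases (by omega : i = k ∨ i = k + 1 ∨ i = k + 2) with rfl | rfl | rfl
      exacts [u0.2, u1.2, u2.2]) (by linarith)
  have c4 : 100 * L ^ 4 * τ * (A' + A + B + R ^ 2)
      ≤ 100 * L ^ 9 * τ * (A' + A + B' + B + R ^ 2) := by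
    have l1 : 100 * L ^ 4 * τ ≤ 100 * L ^ 9 * τ := by gcongr; norm_num
    exact mul_le_mul l1 (by linarith) (by positivity) (by positivity)
  have c5 : (A' + B') - (A + B) ≤ (500 * L ^ 9 * τ) * ((A' + B') + (A + B) + R ^ 2) := by
    linarith
  have x0 : 0 ≤ 500 * L ^ 9 * τ := by positivity
  have e2 : 2000 * L ^ 9 * τ = 4 * (500 * L ^ 9 * τ) := by ring
  rw [e2]
  set x := 500 * L ^ 9 * τ
  set E := A + B
  set E' := A' + B'
  have f1 : (1 - x) * E' ≤ (1 + x) * E + x * R ^ 2 := by linarith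
  -- `(1 + x) / (1 - x) ≤ 1 + 4 x` for `0 ≤ x ≤ 1 / 2`
  have f2 : (1 - x) * ((1 + 4 * x) * (E + R ^ 2) - R ^ 2 - E') ≥ 0 := by
    have : 0 ≤ (2 * x - 4 * x ^ 2) * (E + R ^ 2) := by
      apply mul_nonneg _ (by positivity)
      nlinarith
    nlinarith
  have f3 := nonneg_of_mul_nonneg_right f2 (by linarith)
  linarith

/-- Discrete Gronwall argument: the energy stays below `1`, hence the bootstrap closes. -/
lemma energy_le (hh : 0 < h) (hτ : 0 < τ) (hε : 0 < ε) (hε1 : ε ≤ 1)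
    (hL : M * h ≤ K) (h1 : 1 ≤ K) (hR : 0 ≤ R) (hτK : 500 * (4 * K ^ 2) ^ 9 * τ ≤ 1 / 2)
    (hRK : growth K T * R ^ 2 ≤ 1) (hnT : n * τ ≤ T)
    (hX : IsReference M h τ ε K R n P X Φ) (hU : IsLevelSolution M h τ ε n P U V)
    (hc : IsClose M h τ ε R X Φ U V)
    (hw0 : ∀ i, w i 0 = 0) (hwM : ∀ i, w i M = 0)
    (hw : ∀ i, ∀ j, 1 ≤ j → j < M → -deltaX2 h (w i) j = Φ i j - V i j) {k : ℕ}
    (hk : k + 1 ≤ n) :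
    waveEnergy M h τ (fun l i => X l i - U l i) k
        + dualEnergy M h τ ε (fun l i => Φ l i - V l i) w k + R ^ 2 ≤ growth K T * R ^ 2 := by
  have key : ∀ i ≤ n, (1 + 2000 * (4 * K ^ 2) ^ 9 * τ) ^ i * (4 * K ^ 6 * R ^ 2)
      ≤ growth K T * R ^ 2 := by
    intro i hi
    have a1 : (1 + 2000 * (4 * K ^ 2) ^ 9 * τ) ^ i
        ≤ Real.exp (2000 * (4 * K ^ 2) ^ 9 * T) := by
      calc _ ≤ Real.exp (2000 * (4 * K ^ 2) ^ 9 * τ) ^ i := by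
            gcongr
            have := Real.add_one_le_exp (2000 * (4 * K ^ 2) ^ 9 * τ)
            linarith
        _ = Real.exp (2000 * (4 * K ^ 2) ^ 9 * (i * τ)) := by
            rw [← Real.exp_nat_mul]; congr 1; ring
        _ ≤ _ := by
            gcongr
            refine le_trans ?_ hnT
            gcongr
    unfold growth
    calc _ ≤ Real.exp (2000 * (4 * K ^ 2) ^ 9 * T) * (4 * K ^ 6 * R ^ 2) := by gcongr
      _ = _ := by ring
  have main : ∀ i, i + 1 ≤ n → waveEnergy M h τ (fun l i => X l i - U l i) i
        + dualEnergy M h τ ε (fun l i => Φ l i - V l i) w i + R ^ 2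
          ≤ (1 + 2000 * (4 * K ^ 2) ^ 9 * τ) ^ i * (4 * K ^ 6 * R ^ 2) := by
    intro i
    induction i with
    | zero =>
      intro _
      rw [pow_zero, one_mul]
      exact energy_zero_le hh hτ hε hL h1 hR hc hw0 hwM hw
    | succ i ih =>
      intro hi
      have h2 := ih (by omega)
      have h3 := energy_succ_le hh hτ hε hε1 hL h1 hR hτK hX hU hw0 hwM hw (k := i) hi
        ((h2.trans (key i (by omega))).trans hRK)
      refine h3.trans ?_
      exact (mul_le_mul_of_nonneg_left h2 (by positivity)).trans_eq (by ring)
  exact (main k hk).trans (key k (by omega))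

/-- Stability: the error is bounded by the size `R` of the residuals and of the initial errors,
and the solution of the scheme is bounded independently of all discretization parameters. -/
theorem stability (hh : 0 < h) (hτ : 0 < τ) (hε : 0 < ε) (hε1 : ε ≤ 1)
    (hL : M * h ≤ K) (h1 : 1 ≤ K) (hT : 0 ≤ T) (hR : 0 ≤ R)
    (hτK : 500 * (4 * K ^ 2) ^ 9 * τ ≤ 1 / 2)
    (hRK : growth K T * R ^ 2 ≤ 1) (hn : 1 ≤ n) (hnT : n * τ ≤ T)
    (hX : IsReference M h τ ε K R n P X Φ) (hU : IsLevelSolution M h τ ε n P U V)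
    (hc : IsClose M h τ ε R X Φ U V) {i : ℕ} (hi : i ≤ n) :
    gridNorm M h (fun j => X i j - U i j) + gridSemiNorm M h (fun j => X i j - U i j)
        + gridNorm M h (fun j => Φ i j - V i j) ≤ (K ^ 2 + 2) * (2 * growth K T) * R ∧
      (∀ j ≤ M, |U i j| ≤ 4 * K ^ 2) ∧ gridNorm M h (V i) ≤ 4 * K ^ 2 := by
  choose w hw0 hwM hw' using fun i => exists_grid_solution_const (M := M) (κ := 1) hh le_rfl
    one_pos (fun j => Φ i j - V i j)
  have hw : ∀ i, ∀ j, 1 ≤ j → j < M → -deltaX2 h (w i) j = Φ i j - V i j := by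
    intro i j hj hjM
    have := hw' i j hj hjM
    linarith
  have g1 := one_le_growth h1 hT
  obtain ⟨k, hk, hki⟩ : ∃ k, k + 1 ≤ n ∧ (i = k ∨ i = k + 1) := by
    rcases Nat.eq_zero_or_pos i with rfl | h0
    · exact ⟨0, hn, Or.inl rfl⟩
    · exact ⟨i - 1, by omega, Or.inr (by omega)⟩
  have hE := energy_le hh hτ hε hε1 hL h1 hR hτK hRK hnT hX hU hc hw0 hwM hw hk
  have nA := waveEnergy_nonneg (M := M) (h := h) (τ := τ) (fun l i => X l i - U l i) k
  have nB := dualEnergy_nonneg (M := M) (h := h) (τ := τ) (ε := ε) (fun l i => Φ l i - V l i) w k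
  have nR := sq_nonneg R
  have q1 : gridSemiNorm M h (fun j => X i j - U i j) ^ 2 ≤ 2 * (growth K T * R ^ 2) := by
    rcases hki with rfl | rfl
    · exact (gridSemiNorm_sq_le (τ := τ) _ (fun l i => X l i - U l i)).trans (by linarith)
    · exact (gridSemiNorm_succ_sq_le (τ := τ) _ (fun l i => X l i - U l i)).trans (by linarith)
  have q2 : gridNorm M h (fun j => Φ i j - V i j) ^ 2 ≤ 2 * (growth K T * R ^ 2) := by
    rcases hki with rfl | rfl
    · exact (gridNorm_sq_le (τ := τ) (ε := ε) _ (fun l i => Φ l i - V l i) w).trans (by linarith)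
    · exact (gridNorm_succ_sq_le (τ := τ) (ε := ε) _ (fun l i => Φ l i - V l i) w).trans
        (by linarith)
  -- `√(2 γ) ≤ 2 γ` for `γ ≥ 1`, which avoids square roots in the final constant
  have q3 : 2 * (growth K T * R ^ 2) ≤ (2 * growth K T * R) ^ 2 := by
    have : growth K T * R ^ 2 ≤ growth K T ^ 2 * R ^ 2 := by gcongr; nlinarith
    nlinarith
  have p0 : 0 ≤ 2 * growth K T * R := by positivity
  have p1 := le_of_sq_le_sq (q1.trans q3) p0
  have p2 := le_of_sq_le_sq (q2.trans q3) p0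
  refine ⟨?_, (abs_le_of_waveEnergy_le hh hL h1 hX hU hi (by linarith)).1,
    gridNorm_le_of_sq_le hh hL h1 hX hi (by linarith)⟩
  have p3 := gridNorm_le_gridSemiNorm (M := M) (v := fun j => X i j - U i j) hh hL h1
    (by simp only [(hX.bdry i hi).1, (hU.bdry i hi).1, sub_zero])
  have p4 : K ^ 2 * gridSemiNorm M h (fun j => X i j - U i j)
      ≤ K ^ 2 * (2 * growth K T * R) := by gcongr
  linarith

/-! ### Existence of solutions of the scheme -/

/-- A solution bounded at the last level can be continued by one level: the equation for `E` is a linear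
elliptic problem for the new level of `U`, and then the equation for `F` is one for the new level
of `V`. -/
lemma exists_level_succ (hh : 0 < h) (hτ : 0 < τ) (hε : 0 < ε)
    (hL : M * h ≤ K) (h1 : 1 ≤ K) (hτK : 500 * (4 * K ^ 2) ^ 9 * τ ≤ 1 / 2)
    {k : ℕ} (hU : IsLevelSolution M h τ ε (k + 1) P U V)
    (hUb : ∀ j ≤ M, |U (k + 1) j| ≤ 4 * K ^ 2) (hVb : gridNorm M h (V (k + 1)) ≤ 4 * K ^ 2)
    (hP : ∀ j, 1 ≤ j → j < M → |P (k + 1) j| ≤ K) :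
    ∃ u v : ℕ → ℝ, IsLevelSolution M h τ ε (k + 2) P (Function.update U (k + 2) u)
      (Function.update V (k + 2) v) := by
  have K2 : K ≤ K ^ 2 := le_self_pow₀ h1 (by norm_num)
  have hL1 : 1 ≤ 4 * K ^ 2 := by linarith
  have hKL : K ≤ 4 * K ^ 2 := by linarith
  have hτ2 : 2 * (4 * K ^ 2) ^ 4 ≤ 1 / τ ^ 2 := by
    have a1 : (4 * K ^ 2) ^ 4 ≤ (4 * K ^ 2) ^ 9 := pow_le_pow_right₀ hL1 (by norm_num)
    have a0 : 1 ≤ (4 * K ^ 2) ^ 9 := one_le_pow₀ hL1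
    have a2 : (4 * K ^ 2) ^ 4 * τ ≤ (4 * K ^ 2) ^ 9 * τ := by gcongr
    have a3 : τ ≤ 1 := by
      have : 1 * τ ≤ (4 * K ^ 2) ^ 9 * τ := by gcongr
      linarith
    rw [le_div_iff₀ (by positivity)]
    have : (4 * K ^ 2) ^ 4 * τ * τ ≤ (4 * K ^ 2) ^ 4 * τ * 1 := by gcongr
    nlinarith
  obtain ⟨u, u0, uM, hu⟩ := exists_grid_solution_potential (M := M) hh (hL.trans hKL) hL1 hτ2
    (A := fun j => 1 - U (k + 1) j ^ 2 + P (k + 1) j) (V := V (k + 1))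
    (fun j hj hjM => by
      have b1 := abs_le.1 (hP j hj hjM)
      have b2 := sq_le_sq' (abs_le.1 (hUb j hjM.le)).1 (abs_le.1 (hUb j hjM.le)).2
      nlinarith) hVb
    (fun j => (2 * U (k + 1) j - U k j) / τ ^ 2 + 1 / 2 * deltaX2 h (U k) j
      + (-1 + U (k + 1) j ^ 2 - V (k + 1) j - P (k + 1) j) / 2 * U k j)
  obtain ⟨v, v0, vM, hv⟩ := exists_grid_solution_const (M := M) (h := h) (c := 1 / τ ^ 2)
    (κ := 1 / (2 * ε ^ 2)) hh (by positivity) (by positivity)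
    (fun j => (2 * V (k + 1) j - V k j) / τ ^ 2 + 1 / (2 * ε ^ 2) * deltaX2 h (V k) j
      + (u j ^ 2 - 2 * U (k + 1) j ^ 2 + U k j ^ 2) / τ ^ 2)
  have up : ∀ (Y : ℕ → ℕ → ℝ) y i, i ≤ k + 1 → Function.update Y (k + 2) y i = Y i :=
    fun Y y i hi => Function.update_of_ne (by omega) _ _
  refine ⟨u, v, ?_, ?_, ?_⟩
  · intro i hi
    rcases hi.eq_or_lt with rfl | hi
    · simp [u0, uM, v0, vM]
    · rw [up _ _ i (by omega), up _ _ i (by omega)]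
      exact hU.bdry i (by omega)
  · intro i hi j hj hjM
    rcases hi.eq_or_lt with hi | hi
    · obtain rfl : i = k := by omega
      have := hu j hj hjM
      simp only [deltaT2, deltaX2, avg, Nat.add_sub_cancel, Function.update_self,
        up _ _ i (by omega), up _ _ (i + 1) le_rfl] at this ⊢
      field_simp at this ⊢
      linarith
    · have := hU.eqn_E i (by omega) j hj hjM
      simp only [deltaT2, deltaX2, avg, Nat.add_sub_cancel, up _ _ i (by omega),
        up _ _ (i + 1) (by omega), up _ _ (i + 1 + 1) (by omega)] at this ⊢
      exact this
  · intro i hi j hj hjM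
    rcases hi.eq_or_lt with hi | hi
    · obtain rfl : i = k := by omega
      have := hv j hj hjM
      simp only [deltaT2, deltaX2, Nat.add_sub_cancel, Function.update_self,
        up _ _ i (by omega), up _ _ (i + 1) le_rfl] at this ⊢
      field_simp at this ⊢
      linarith
    · have := hU.eqn_F i (by omega) j hj hjM
      simp only [deltaT2, deltaX2, Nat.add_sub_cancel, up _ _ i (by omega),
        up _ _ (i + 1) (by omega), up _ _ (i + 1 + 1) (by omega)] at this ⊢
      exact this

/-- Existence for the scheme, level by level. The bounds of `stability` on the levels computed so far
keep the linear problem for the next level solvable. -/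
theorem exists_levelSolution (hh : 0 < h) (hτ : 0 < τ) (hε : 0 < ε) (hε1 : ε ≤ 1)
    (hL : M * h ≤ K) (h1 : 1 ≤ K) (hT : 0 ≤ T) (hR : 0 ≤ R)
    (hτK : 500 * (4 * K ^ 2) ^ 9 * τ ≤ 1 / 2)
    (hRK : growth K T * R ^ 2 ≤ 1) (hnT : n * τ ≤ T)
    (hX : IsReference M h τ ε K R n P X Φ) {u₀ u₁ v₀ v₁ : ℕ → ℝ}
    (hb : ∀ u ∈ ({u₀, u₁, v₀, v₁} : Set (ℕ → ℝ)), u 0 = 0 ∧ u M = 0)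
    (hc : ∀ U V : ℕ → ℕ → ℝ, U 0 = u₀ → U 1 = u₁ → V 0 = v₀ → V 1 = v₁ →
      IsClose M h τ ε R X Φ U V) :
    ∃ U V : ℕ → ℕ → ℝ, IsLevelSolution M h τ ε n P U V ∧
      U 0 = u₀ ∧ U 1 = u₁ ∧ V 0 = v₀ ∧ V 1 = v₁ := by
  have base : ∀ m ≤ 1, ∃ U V : ℕ → ℕ → ℝ, IsLevelSolution M h τ ε m P U V ∧
      U 0 = u₀ ∧ U 1 = u₁ ∧ V 0 = v₀ ∧ V 1 = v₁ := by
    intro m hm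
    refine ⟨fun k => if k = 0 then u₀ else u₁, fun k => if k = 0 then v₀ else v₁,
      ⟨fun k _ => ?_, fun k hk => by omega, fun k hk => by omega⟩, by simp, by simp, by simp,
      by simp⟩
    have b0 := hb u₀ (by simp)
    have b1 := hb u₁ (by simp)
    have b2 := hb v₀ (by simp)
    have b3 := hb v₁ (by simp)
    by_cases h0 : k = 0 <;> simp [h0, b0, b1, b2, b3]
  have main : ∀ m ≤ n, ∃ U V : ℕ → ℕ → ℝ, IsLevelSolution M h τ ε m P U V ∧
      U 0 = u₀ ∧ U 1 = u₁ ∧ V 0 = v₀ ∧ V 1 = v₁ := by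
    intro m
    induction m with
    | zero => exact fun _ => base 0 (by norm_num)
    | succ m ih =>
      intro hm
      rcases Nat.eq_zero_or_pos m with rfl | h0
      · exact base 1 le_rfl
      obtain ⟨k, rfl⟩ : ∃ k, m = k + 1 := ⟨m - 1, by omega⟩
      obtain ⟨U, V, hU, hu0, hu1, hv0, hv1⟩ := ih (by omega)
      have hmT : ((k + 1 : ℕ) : ℝ) * τ ≤ T := by
        refine le_trans ?_ hnT
        gcongr
        omega
      obtain ⟨-, hUb, hVb⟩ := stability hh hτ hε hε1 hL h1 hT hR hτK hRK (by omega) hmT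
        (hX.mono (by omega)) hU (hc U V hu0 hu1 hv0 hv1) (i := k + 1) le_rfl
      obtain ⟨u, v, huv⟩ := exists_level_succ hh hτ hε hL h1 hτK hU hUb hVb
        (fun j hj hjM => hX.P_le k (by omega) j hj hjM)
      refine ⟨_, _, huv, ?_, ?_, ?_, ?_⟩ <;> rw [Function.update_of_ne (by omega)] <;> assumption
  exact main n le_rfl

end Stability

/-! ### Taylor formulas and second differences -/

/-- `y₁` and `y₂` are the first two derivatives of `y` on `[c, d]`, one-sided at the end points,
and `y₂` is continuous. -/
structure HasTwoDerivs (c d : ℝ) (y y₁ y₂ : ℝ → ℝ) : Prop where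
  deriv₁ : ∀ t ∈ Icc c d, HasDerivWithinAt y (y₁ t) (Icc c d) t
  deriv₂ : ∀ t ∈ Icc c d, HasDerivWithinAt y₁ (y₂ t) (Icc c d) t
  cont : ContinuousOn y₂ (Icc c d)

section Taylor

variable {c d t σ C : ℝ} {y y₁ y₂ z z₁ z₂ : ℝ → ℝ}

lemma HasTwoDerivs.add (hy : HasTwoDerivs c d y y₁ y₂) (hz : HasTwoDerivs c d z z₁ z₂) :
    HasTwoDerivs c d (fun t => y t + z t) (fun t => y₁ t + z₁ t) (fun t => y₂ t + z₂ t) where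
  deriv₁ t ht := (hy.deriv₁ t ht).add (hz.deriv₁ t ht)
  deriv₂ t ht := (hy.deriv₂ t ht).add (hz.deriv₂ t ht)
  cont := hy.cont.add hz.cont

lemma HasTwoDerivs.const_mul (r : ℝ) (hy : HasTwoDerivs c d y y₁ y₂) :
    HasTwoDerivs c d (fun t => r * y t) (fun t => r * y₁ t) (fun t => r * y₂ t) where
  deriv₁ t ht := (hy.deriv₁ t ht).const_mul r
  deriv₂ t ht := (hy.deriv₂ t ht).const_mul r
  cont := continuousOn_const.mul hy.cont

lemma HasTwoDerivs.continuousOn (hy : HasTwoDerivs c d y y₁ y₂) : ContinuousOn y (Icc c d) :=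
  fun t ht => (hy.deriv₁ t ht).continuousWithinAt

lemma HasTwoDerivs.continuousOn₁ (hy : HasTwoDerivs c d y y₁ y₂) :
    ContinuousOn y₁ (Icc c d) := fun t ht => (hy.deriv₂ t ht).continuousWithinAt

lemma add_mul_mem_Icc (ht : t ∈ Icc c d) (hσ : t + σ ∈ Icc c d) {s : ℝ} (hs : s ∈ Icc (0 : ℝ) 1) :
    t + s * σ ∈ Icc c d := by
  have : t + s * σ = (1 - s) • t + s • (t + σ) := by simp only [smul_eq_mul]; ring
  rw [this]
  exact convex_Icc c d ht hσ (by linarith [hs.2]) hs.1 (by ring)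

lemma continuousOn_comp_add_mul {f : ℝ → ℝ} (hf : ContinuousOn f (Icc c d)) (ht : t ∈ Icc c d)
    (hσ : t + σ ∈ Icc c d) : ContinuousOn (fun s => f (t + s * σ)) (Icc 0 1) :=
  hf.comp (by fun_prop) fun _ hs => add_mul_mem_Icc ht hσ hs

lemma intervalIntegrable_weight {f : ℝ → ℝ} (hf : ContinuousOn f (Icc 0 1)) :
    IntervalIntegrable (fun s => (1 - s) * f s) volume 0 1 := by
  apply ContinuousOn.intervalIntegrable
  rw [uIcc_of_le zero_le_one]
  exact (by fun_prop : ContinuousOn (fun s : ℝ => 1 - s) (Icc 0 1)).mul hf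

/-- Taylor formula of first order with integral remainder. -/
lemma HasTwoDerivs.taylor (hy : HasTwoDerivs c d y y₁ y₂) (ht : t ∈ Icc c d)
    (hσ : t + σ ∈ Icc c d) :
    y (t + σ) - y t - σ * y₁ t = σ ^ 2 * ∫ s in (0 : ℝ)..1, (1 - s) * y₂ (t + s * σ) := by
  have hm : MapsTo (fun s : ℝ => t + s * σ) (Icc 0 1) (Icc c d) :=
    fun s hs => add_mul_mem_Icc ht hσ hs
  have hl : ∀ s : ℝ, HasDerivWithinAt (fun s : ℝ => t + s * σ) σ (Icc 0 1) s := fun s => by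
    simpa using ((hasDerivAt_id s).mul_const σ).const_add t |>.hasDerivWithinAt
  have hd : ∀ s ∈ Icc (0 : ℝ) 1, HasDerivWithinAt
      (fun s => σ * (1 - s) * y₁ (t + s * σ) + y (t + s * σ))
      (σ ^ 2 * ((1 - s) * y₂ (t + s * σ))) (Icc 0 1) s := by
    intro s hs
    have d1 := (hy.deriv₁ _ (hm hs)).comp s (hl s) hm
    have d2 := (hy.deriv₂ _ (hm hs)).comp s (hl s) hm
    have d3 : HasDerivWithinAt (fun s : ℝ => σ * (1 - s)) (-σ) (Icc 0 1) s := by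
      simpa using (((hasDerivAt_id s).const_sub 1).const_mul σ).hasDerivWithinAt
    refine ((d3.mul d2).add d1).congr_deriv ?_
    simp only [Function.comp]
    ring
  have h2 := intervalIntegral.integral_eq_sub_of_hasDerivAt_of_le zero_le_one
    (fun s hs => (hd s hs).continuousWithinAt)
    (fun s hs => (hd s (Ioo_subset_Icc_self hs)).hasDerivAt (Icc_mem_nhds hs.1 hs.2))
    ((intervalIntegrable_weight (continuousOn_comp_add_mul hy.cont ht hσ)).const_mul (σ ^ 2))
  rw [intervalIntegral.integral_const_mul] at h2
  rw [h2]
  simp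
  ring

lemma abs_integral_weight_le {f : ℝ → ℝ} (hf : ∀ s ∈ Icc (0 : ℝ) 1, |f s| ≤ C) :
    |∫ s in (0 : ℝ)..1, (1 - s) * f s| ≤ C := by
  have := intervalIntegral.norm_integral_le_of_norm_le_const (a := 0) (b := 1) (C := C)
    (f := fun s : ℝ => (1 - s) * f s) (fun s hs => by
      rw [uIoc_of_le zero_le_one] at hs
      have h1 := hf s ⟨hs.1.le, hs.2⟩
      rw [norm_mul, Real.norm_eq_abs, Real.norm_eq_abs, abs_of_nonneg (by linarith [hs.2])]
      calc (1 - s) * |f s| ≤ 1 * |f s| := by gcongr; linarith [hs.1]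
        _ ≤ C := by rwa [one_mul])
  simpa using this

lemma integral_weight_const (r : ℝ) : ∫ s in (0 : ℝ)..1, (1 - s) * r = r / 2 := by
  rw [intervalIntegral.integral_mul_const]
  have : ∫ s in (0 : ℝ)..1, (1 - s) = 1 / 2 := by
    rw [intervalIntegral.integral_sub (by simp) (by simp)]
    norm_num
  rw [this]; ring

lemma HasTwoDerivs.abs_taylor_le (hy : HasTwoDerivs c d y y₁ y₂) (ht : t ∈ Icc c d)
    (hσ : t + σ ∈ Icc c d) (hC : ∀ s ∈ Icc (0 : ℝ) 1, |y₂ (t + s * σ) - y₂ t| ≤ C) :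
    |y (t + σ) - y t - σ * y₁ t - σ ^ 2 / 2 * y₂ t| ≤ C * σ ^ 2 := by
  have h1 : y (t + σ) - y t - σ * y₁ t - σ ^ 2 / 2 * y₂ t
      = σ ^ 2 * ∫ s in (0 : ℝ)..1, (1 - s) * (y₂ (t + s * σ) - y₂ t) := by
    rw [hy.taylor ht hσ]
    have e : ∀ s, (1 - s) * (y₂ (t + s * σ) - y₂ t)
        = (1 - s) * y₂ (t + s * σ) - (1 - s) * y₂ t := fun s => by ring
    simp only [e]
    rw [intervalIntegral.integral_sub
      (intervalIntegrable_weight (continuousOn_comp_add_mul hy.cont ht hσ))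
      (intervalIntegrable_weight continuousOn_const), integral_weight_const]
    ring
  rw [h1, abs_mul, abs_of_nonneg (sq_nonneg σ), mul_comm]
  gcongr
  exact abs_integral_weight_le hC

lemma HasTwoDerivs.abs_sub_sub_le (hy : HasTwoDerivs c d y y₁ y₂) (ht : t ∈ Icc c d)
    (hσ : t + σ ∈ Icc c d) (hC : ∀ s ∈ Icc c d, |y₂ s| ≤ C) :
    |y (t + σ) - y t - σ * y₁ t| ≤ C * σ ^ 2 := by
  rw [hy.taylor ht hσ, abs_mul, abs_of_nonneg (sq_nonneg σ), mul_comm]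
  gcongr
  exact abs_integral_weight_le fun s hs => hC _ (add_mul_mem_Icc ht hσ hs)

/-- The second difference as a weighted average of the second derivative. -/
lemma HasTwoDerivs.second_diff (hy : HasTwoDerivs c d y y₁ y₂) (ht : t ∈ Icc c d)
    (hσ : t + σ ∈ Icc c d) (hσ' : t - σ ∈ Icc c d) :
    y (t + σ) - 2 * y t + y (t - σ)
      = σ ^ 2 * ∫ s in (0 : ℝ)..1, (1 - s) * (y₂ (t + s * σ) + y₂ (t - s * σ)) := by
  have h1 := hy.taylor ht hσ
  rw [sub_eq_add_neg] at hσ'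
  have h2 := hy.taylor ht hσ'
  have e : ∀ s, (1 - s) * (y₂ (t + s * σ) + y₂ (t - s * σ))
      = (1 - s) * y₂ (t + s * σ) + (1 - s) * y₂ (t + s * -σ) := fun s => by
    rw [mul_neg, ← sub_eq_add_neg]; ring
  simp only [e]
  rw [intervalIntegral.integral_add
      (intervalIntegrable_weight (continuousOn_comp_add_mul hy.cont ht hσ))
      (intervalIntegrable_weight (continuousOn_comp_add_mul hy.cont ht hσ')),
      mul_add, ← h1, ← neg_sq σ, ← h2]
  ring_nf

lemma HasTwoDerivs.abs_second_diff_le (hy : HasTwoDerivs c d y y₁ y₂) (ht : t ∈ Icc c d)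
    (hσ : t + σ ∈ Icc c d) (hσ' : t - σ ∈ Icc c d) (hC : ∀ s ∈ Icc c d, |y₂ s| ≤ C) :
    |y (t + σ) - 2 * y t + y (t - σ)| ≤ 2 * C * σ ^ 2 := by
  rw [hy.second_diff ht hσ hσ', abs_mul, abs_of_nonneg (sq_nonneg σ), mul_comm]
  gcongr
  refine abs_integral_weight_le fun s hs => ?_
  have h1 := hC _ (add_mul_mem_Icc ht hσ hs)
  rw [sub_eq_add_neg] at hσ'
  have h2 := hC _ (add_mul_mem_Icc ht hσ' hs)
  rw [mul_neg, ← sub_eq_add_neg] at h2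
  exact (abs_add_le _ _).trans (by linarith)

lemma HasTwoDerivs.abs_second_diff_sub_le (hy : HasTwoDerivs c d y y₁ y₂) (ht : t ∈ Icc c d)
    (hσ : t + σ ∈ Icc c d) (hσ' : t - σ ∈ Icc c d)
    (hC : ∀ s ∈ Icc (0 : ℝ) 1, |y₂ (t + s * σ) - 2 * y₂ t + y₂ (t - s * σ)| ≤ C) :
    |y (t + σ) - 2 * y t + y (t - σ) - σ ^ 2 * y₂ t| ≤ C * σ ^ 2 := by
  have h1 : y (t + σ) - 2 * y t + y (t - σ) - σ ^ 2 * y₂ t = σ ^ 2 *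
      ∫ s in (0 : ℝ)..1, (1 - s) * (y₂ (t + s * σ) - 2 * y₂ t + y₂ (t - s * σ)) := by
    rw [hy.second_diff ht hσ hσ']
    have e : ∀ s, (1 - s) * (y₂ (t + s * σ) - 2 * y₂ t + y₂ (t - s * σ))
        = (1 - s) * (y₂ (t + s * σ) + y₂ (t - s * σ)) - (1 - s) * (2 * y₂ t) := fun s => by ring
    simp only [e]
    rw [intervalIntegral.integral_sub _ (intervalIntegrable_weight continuousOn_const),
      integral_weight_const]
    · ring
    · apply intervalIntegrable_weight
      apply (continuousOn_comp_add_mul hy.cont ht hσ).add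
      rw [sub_eq_add_neg] at hσ'
      have := continuousOn_comp_add_mul hy.cont ht hσ'
      simpa only [mul_neg, ← sub_eq_add_neg] using this
  rw [h1, abs_mul, abs_of_nonneg (sq_nonneg σ), mul_comm]
  gcongr
  exact abs_integral_weight_le hC

lemma abs_sub_le_of_hasDerivWithinAt (hy : ∀ t ∈ Icc c d, HasDerivWithinAt y (y₁ t) (Icc c d) t)
    (hC : ∀ s ∈ Icc c d, |y₁ s| ≤ C) {r s : ℝ} (hr : r ∈ Icc c d) (hs : s ∈ Icc c d) :
    |y s - y r| ≤ C * |s - r| :=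
  (convex_Icc c d).norm_image_sub_le_of_norm_hasDerivWithin_le hy hC hr hs

end Taylor

lemma hasTwoDerivs_of_contDiff {f : ℝ → ℝ} (hf : ContDiff ℝ ∞ f) (c d : ℝ) :
    HasTwoDerivs c d f (iteratedDeriv 1 f) (iteratedDeriv 2 f) where
  deriv₁ t _ := by
    rw [iteratedDeriv_one]
    exact (hf.differentiable (by simp) t).hasDerivAt.hasDerivWithinAt
  deriv₂ t _ := by
    rw [iteratedDeriv_succ (n := 1)]
    exact (hf.differentiable_iteratedDeriv 1 (by exact_mod_cast ENat.natCast_lt_top 1)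
      t).hasDerivAt.hasDerivWithinAt
  cont := (hf.continuous_iteratedDeriv 2 ENat.LEInfty.out).continuousOn

/-! ### From weak derivatives to difference quotients -/

open Filter Topology in
/-- Derivatives of a convolution fall on the smooth factor. -/
lemma iteratedDeriv_convolution {ρ g : ℝ → ℝ} (hρ : ContDiff ℝ ∞ ρ) (hc : HasCompactSupport ρ)
    (hg : LocallyIntegrable g) (l : ℕ) :
    iteratedDeriv l (convolution ρ g (ContinuousLinearMap.lsmul ℝ ℝ) volume)
        = convolution (iteratedDeriv l ρ) g (ContinuousLinearMap.lsmul ℝ ℝ) volume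
      ∧ HasCompactSupport (iteratedDeriv l ρ) ∧ ContDiff ℝ ∞ (iteratedDeriv l ρ) := by
  induction l with
  | zero => simp only [iteratedDeriv_zero]; exact ⟨trivial, hc, hρ⟩
  | succ l ih =>
    obtain ⟨h1, h2, h3⟩ := ih
    rw [iteratedDeriv_succ, iteratedDeriv_succ, h1]
    refine ⟨?_, h2.deriv, ?_⟩
    · ext x
      exact (h2.hasDerivAt_convolution_left _ (h3.of_le ENat.LEInfty.out) hg x).deriv
    · exact (contDiff_infty_iff_deriv.1 h3).2

section Weak

variable {a b C : ℝ} {v w : ℝ → ℝ} {l : ℕ}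

/-- Away from the boundary, the derivatives of a mollified function are the mollified weak
derivatives. -/
lemma iteratedDeriv_mollify (hv : ContinuousOn v (Icc a b)) (hw : HasWeakDeriv a b l v w)
    (φ : ContDiffBump (0 : ℝ)) {x : ℝ} (hx : Metric.closedBall x φ.rOut ⊆ Ioo a b) :
    iteratedDeriv l (convolution (φ.normed volume) ((Ioo a b).indicator v)
        (ContinuousLinearMap.lsmul ℝ ℝ) volume) x
      = ∫ t in Ioo a b, w t * φ.normed volume (x - t) := by
  have hvi : Integrable ((Ioo a b).indicator v) := by
    rw [integrable_indicator_iff measurableSet_Ioo]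
    exact (hv.integrableOn_Icc).mono_set Ioo_subset_Icc_self
  rw [(iteratedDeriv_convolution φ.contDiff_normed φ.hasCompactSupport_normed
    hvi.locallyIntegrable l).1, convolution_eq_swap]
  have hψ : ContDiff ℝ ∞ (fun t => φ.normed volume (x - t)) :=
    φ.contDiff_normed.comp (contDiff_const.sub contDiff_id)
  have hsub : Function.support (fun t => φ.normed volume (x - t)) ⊆ Metric.closedBall x φ.rOut := by
    intro t ht
    have : x - t ∈ Function.support (φ.normed volume) := ht
    rw [φ.support_normed_eq, mem_ball_zero_iff, Real.norm_eq_abs] at this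
    rw [Metric.mem_closedBall, Real.dist_eq, abs_sub_comm]
    exact this.le
  have hts : tsupport (fun t => φ.normed volume (x - t)) ⊆ Metric.closedBall x φ.rOut :=
    closure_minimal hsub Metric.isClosed_closedBall
  have hcs : HasCompactSupport (fun t => φ.normed volume (x - t)) :=
    HasCompactSupport.of_support_subset_isCompact (isCompact_closedBall x φ.rOut) hsub
  have h1 := hw.2.2 _ hψ hcs (hts.trans hx)
  rw [iteratedDeriv_comp_const_sub] at h1
  have h2 : ∀ t, ((ContinuousLinearMap.lsmul ℝ ℝ) (iteratedDeriv l (φ.normed volume) (x - t)))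
      ((Ioo a b).indicator v t) = (Ioo a b).indicator
        (fun t => v t * iteratedDeriv l (φ.normed volume) (x - t)) t := by
    intro t
    by_cases ht : t ∈ Ioo a b <;> simp [ht, mul_comm]
  simp only [h2]
  rw [integral_indicator measurableSet_Ioo]
  have h3 : ∫ t in Ioo a b, v t * ((-1 : ℝ) ^ l * iteratedDeriv l (φ.normed volume) (x - t))
      = (-1) ^ l * ∫ t in Ioo a b, v t * iteratedDeriv l (φ.normed volume) (x - t) := by
    rw [← integral_const_mul]
    congr 1
    ext t
    ring
  simp only [smul_eq_mul] at h1
  rw [h3] at h1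
  exact mul_left_cancel₀ (pow_ne_zero l (by norm_num)) h1

lemma abs_iteratedDeriv_mollify_le (hv : ContinuousOn v (Icc a b)) (hw : HasWeakDeriv a b l v w)
    (hwC : ∀ᵐ x ∂volume.restrict (Ioo a b), |w x| ≤ C) (hC : 0 ≤ C)
    (φ : ContDiffBump (0 : ℝ)) {x : ℝ} (hx : Metric.closedBall x φ.rOut ⊆ Ioo a b) :
    |iteratedDeriv l (convolution (φ.normed volume) ((Ioo a b).indicator v)
        (ContinuousLinearMap.lsmul ℝ ℝ) volume) x| ≤ C := by
  rw [iteratedDeriv_mollify hv hw φ hx]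
  have hi : Integrable (fun t => C * φ.normed volume (x - t)) :=
    (φ.integrable_normed.comp_sub_left x).const_mul C
  have h1 : ‖∫ t in Ioo a b, w t * φ.normed volume (x - t)‖
      ≤ ∫ t in Ioo a b, C * φ.normed volume (x - t) := by
    refine norm_integral_le_of_norm_le hi.integrableOn ?_
    filter_upwards [hwC] with t ht
    rw [norm_mul, Real.norm_eq_abs, Real.norm_eq_abs, abs_of_nonneg (φ.nonneg_normed _)]
    exact mul_le_mul_of_nonneg_right ht (φ.nonneg_normed _)
  have h2 : ∫ t in Ioo a b, C * φ.normed volume (x - t) ≤ ∫ t, C * φ.normed volume (x - t) :=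
    setIntegral_le_integral hi (Filter.Eventually.of_forall fun t =>
      mul_nonneg hC (φ.nonneg_normed _))
  have h3 : ∫ t, C * φ.normed volume (x - t) = C := by
    rw [integral_const_mul, integral_sub_left_eq_self, φ.integral_normed, mul_one]
  rw [← Real.norm_eq_abs]
  linarith

open Filter Topology in
/-- A continuous function with a bounded weak derivative of order `l` is, on compact subintervals,
a limit of smooth functions whose derivatives of order `l` satisfy the same bound. -/
lemma exists_smooth_approx (hv : ContinuousOn v (Icc a b)) (hw : HasWeakDeriv a b l v w)
    (hwC : ∀ᵐ x ∂volume.restrict (Ioo a b), |w x| ≤ C) (hC : 0 ≤ C) {c d : ℝ}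
    (hc : a < c) (hd : d < b) :
    ∃ f : ℕ → ℝ → ℝ, (∀ n, ContDiff ℝ ∞ (f n)) ∧
      (∀ x ∈ Icc c d, Tendsto (fun n => f n x) atTop (𝓝 (v x))) ∧
      ∀ n, ∀ x ∈ Icc c d, |iteratedDeriv l (f n) x| ≤ C := by
  set δ := min (c - a) (b - d) with hδ
  have hδ0 : 0 < δ := lt_min (by linarith) (by linarith)
  have hr : ∀ n : ℕ, 0 < δ / (n + 2) := fun n => by positivity
  have hr' : ∀ n : ℕ, δ / (n + 2) < δ := fun n =>
    div_lt_self hδ0 (by have : (0 : ℝ) ≤ n := n.cast_nonneg; linarith)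
  let φ : ℕ → ContDiffBump (0 : ℝ) := fun n =>
    ⟨δ / (n + 2) / 2, δ / (n + 2), by have := hr n; positivity, half_lt_self (hr n)⟩
  have hvi : Integrable ((Ioo a b).indicator v) := by
    rw [integrable_indicator_iff measurableSet_Ioo]
    exact (hv.integrableOn_Icc).mono_set Ioo_subset_Icc_self
  have hball : ∀ n, ∀ x ∈ Icc c d, Metric.closedBall x (φ n).rOut ⊆ Ioo a b := by
    intro n x hx t ht
    rw [Metric.mem_closedBall, Real.dist_eq] at ht
    have h1 : |t - x| < δ := ht.trans_lt (hr' n)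
    have h2 := abs_lt.1 h1
    have h3 : δ ≤ c - a := min_le_left _ _
    have h4 : δ ≤ b - d := min_le_right _ _
    constructor <;> linarith [hx.1, hx.2]
  refine ⟨fun n => convolution ((φ n).normed volume) ((Ioo a b).indicator v)
    (ContinuousLinearMap.lsmul ℝ ℝ) volume, fun n => ?_, fun x hx => ?_, fun n x hx => ?_⟩
  · exact (φ n).hasCompactSupport_normed.contDiff_convolution_left _ (φ n).contDiff_normed
      hvi.locallyIntegrable
  · have hxm : x ∈ Ioo a b := ⟨by linarith [hx.1], by linarith [hx.2]⟩
    have hcont : ContinuousAt v x := hv.continuousAt (Icc_mem_nhds hxm.1 hxm.2)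
    have hr0 : Tendsto (fun n : ℕ => (φ n).rOut) atTop (𝓝 0) := by
      have : Tendsto (fun n : ℕ => ((n + 2 : ℕ) : ℝ)) atTop atTop :=
        tendsto_natCast_atTop_atTop.comp (tendsto_add_atTop_nat 2)
      have := this.const_div_atTop δ
      refine this.congr fun n => ?_
      change _ = δ / ((n : ℝ) + 2)
      push_cast
      rfl
    rw [Metric.tendsto_atTop]
    intro η hη
    obtain ⟨r, hr0', hrv⟩ := Metric.continuousAt_iff.1 hcont (η / 2) (half_pos hη)
    obtain ⟨N, hN⟩ := Metric.tendsto_atTop.1 hr0 r hr0'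
    refine ⟨N, fun n hn => ?_⟩
    have h1 := ContDiffBump.dist_normed_convolution_le (φ := φ n) (x₀ := x) (ε := η / 2)
      (g := (Ioo a b).indicator v) hvi.aestronglyMeasurable (fun t ht => by
        have ht' := hball n x hx (Metric.ball_subset_closedBall ht)
        rw [indicator_of_mem ht', indicator_of_mem hxm]
        refine (hrv ?_).le
        have h2 := hN n hn
        rw [Real.dist_eq, sub_zero, abs_of_pos (φ n).rOut_pos] at h2
        exact (Metric.mem_ball.1 ht).trans h2)
    rw [indicator_of_mem hxm] at h1
    exact h1.trans_lt (half_lt_self hη)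
  · exact abs_iteratedDeriv_mollify_le hv hw hwC hC (φ n) (hball n x hx)

open Filter Topology in
/-- A pointwise bound on the open interval extends to the closed interval. -/
lemma abs_le_on_Icc (hab : a < b) (hv : ContinuousOn v (Icc a b))
    (h : ∀ x ∈ Ioo a b, |v x| ≤ C) : ∀ x ∈ Icc a b, |v x| ≤ C := by
  intro x hx
  have h1 : x ∈ closure (Ioo a b) := by rwa [closure_Ioo hab.ne]
  have : ContinuousWithinAt (fun y => |v y|) (Ioo a b) x :=
    ((hv x hx).mono Ioo_subset_Icc_self).abs
  have hne : (𝓝[Ioo a b] x).NeBot := mem_closure_iff_nhdsWithin_neBot.1 h1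
  exact le_of_tendsto this (eventually_nhdsWithin_of_forall h)

lemma abs_le_of_hasWeakDeriv (hab : a < b) (hv : ContinuousOn v (Icc a b))
    (hw : HasWeakDeriv a b 0 v w)
    (hwC : ∀ᵐ x ∂volume.restrict (Ioo a b), |w x| ≤ C) (hC : 0 ≤ C) :
    ∀ x ∈ Icc a b, |v x| ≤ C := by
  refine abs_le_on_Icc hab hv fun x hx => ?_
  obtain ⟨f, -, h2, h3⟩ := exists_smooth_approx hv hw hwC hC hx.1 hx.2
  have hx' : x ∈ Icc x x := ⟨le_rfl, le_rfl⟩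
  refine le_of_tendsto (h2 x hx').abs (Filter.Eventually.of_forall fun n => ?_)
  simpa using h3 n x hx'

lemma abs_sub_le_of_hasWeakDeriv (hab : a < b) (hv : ContinuousOn v (Icc a b))
    (hw : HasWeakDeriv a b 1 v w)
    (hwC : ∀ᵐ x ∂volume.restrict (Ioo a b), |w x| ≤ C) (hC : 0 ≤ C) :
    ∀ x ∈ Icc a b, ∀ y ∈ Icc a b, |v y - v x| ≤ C * |y - x| := by
  have h1 : LipschitzOnWith (Real.toNNReal C) v (Ioo a b) := by
    refine LipschitzOnWith.of_dist_le_mul fun x hx y hy => ?_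
    rw [Real.dist_eq, Real.dist_eq, Real.coe_toNNReal _ hC]
    obtain ⟨f, h1, h2, h3⟩ := exists_smooth_approx hv hw hwC hC (lt_min hx.1 hy.1)
      (max_lt hx.2 hy.2)
    have hx' : x ∈ Icc (min x y) (max x y) := ⟨min_le_left _ _, le_max_left _ _⟩
    have hy' : y ∈ Icc (min x y) (max x y) := ⟨min_le_right _ _, le_max_right _ _⟩
    refine le_of_tendsto ((h2 x hx').sub (h2 y hy')).abs (Filter.Eventually.of_forall fun n => ?_)
    exact abs_sub_le_of_hasDerivWithinAt (hasTwoDerivs_of_contDiff (h1 n) _ _).deriv₁ (h3 n)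
      hy' hx'
  have h2 : LipschitzOnWith (Real.toNNReal C) v (Icc a b) := by
    rw [← closure_Ioo hab.ne]
    refine h1.closure ?_
    rwa [closure_Ioo hab.ne]
  intro x hx y hy
  have := h2.dist_le_mul y hy x hx
  rwa [Real.dist_eq, Real.dist_eq, Real.coe_toNNReal _ hC] at this

open Filter Topology in
/-- Reduction of a statement about second differences with centre `x` to steps that stay in the
open interval. -/
lemma second_diff_limit {x h : ℝ} (hx : x ∈ Ioo a b) (hh : 0 < h) (hp : x + h ∈ Icc a b)
    (hm : x - h ∈ Icc a b) (hv : ContinuousOn v (Icc a b)) {B : ℝ → ℝ} (hB : Continuous B)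
    (H : ∀ s, 0 < s → s < h → |v (x + s) - 2 * v x + v (x - s)| ≤ B s) :
    |v (x + h) - 2 * v x + v (x - h)| ≤ B h := by
  have hne : (𝓝[Ioo 0 h] h).NeBot := by
    apply mem_closure_iff_nhdsWithin_neBot.1
    rw [closure_Ioo hh.ne]
    exact ⟨hh.le, le_rfl⟩
  have m1 : MapsTo (fun s => x + s) (Ioo 0 h) (Icc a b) := fun s hs =>
    ⟨by linarith [hs.1, hx.1], by linarith [hs.2, hp.2]⟩
  have m2 : MapsTo (fun s => x - s) (Ioo 0 h) (Icc a b) := fun s hs =>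
    ⟨by linarith [hs.2, hm.1], by linarith [hs.1, hx.2]⟩
  have c1 : ContinuousWithinAt (fun s => v (x + s)) (Ioo 0 h) h :=
    ContinuousWithinAt.comp (t := Icc a b) (hv _ hp)
      (by fun_prop : Continuous fun s : ℝ => x + s).continuousWithinAt m1
  have c2 : ContinuousWithinAt (fun s => v (x - s)) (Ioo 0 h) h :=
    ContinuousWithinAt.comp (t := Icc a b) (hv _ hm)
      (by fun_prop : Continuous fun s : ℝ => x - s).continuousWithinAt m2
  have c3 : ContinuousWithinAt (fun s => |v (x + s) - 2 * v x + v (x - s)|) (Ioo 0 h) h :=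
    ((c1.sub continuousWithinAt_const).add c2).abs
  exact le_of_tendsto_of_tendsto c3 hB.continuousWithinAt
    (eventually_nhdsWithin_of_forall fun s hs => H s hs.1 hs.2)

lemma abs_second_diff_le_of_hasWeakDeriv (hv : ContinuousOn v (Icc a b))
    (hw : HasWeakDeriv a b 2 v w)
    (hwC : ∀ᵐ x ∂volume.restrict (Ioo a b), |w x| ≤ C) (hC : 0 ≤ C) {x h : ℝ}
    (hx : x ∈ Ioo a b) (hh : 0 < h) (hp : x + h ∈ Icc a b) (hm : x - h ∈ Icc a b) :
    |v (x + h) - 2 * v x + v (x - h)| ≤ 2 * C * h ^ 2 := by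
  refine second_diff_limit (B := fun s => 2 * C * s ^ 2) hx hh hp hm hv (by fun_prop)
    fun s hs hsh => ?_
  obtain ⟨f, h1, h2, h3⟩ := exists_smooth_approx hv hw hwC hC (c := x - s) (d := x + s)
    (by linarith [hm.1]) (by linarith [hp.2])
  have e0 : x ∈ Icc (x - s) (x + s) := ⟨by linarith, by linarith⟩
  have e1 : x + s ∈ Icc (x - s) (x + s) := ⟨by linarith, by linarith⟩
  have e2 : x - s ∈ Icc (x - s) (x + s) := ⟨by linarith, by linarith⟩
  refine le_of_tendsto (((h2 _ e1).sub ((h2 x e0).const_mul 2)).add (h2 _ e2)).abs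
    (Filter.Eventually.of_forall fun n => ?_)
  exact (hasTwoDerivs_of_contDiff (h1 n) _ _).abs_second_diff_le e0 e1 e2 (h3 n)

lemma abs_second_diff_sub_le_of_contDiff {f : ℝ → ℝ} (hf : ContDiff ℝ ∞ f) {x h : ℝ}
    (hh : 0 ≤ h) (hC : ∀ y ∈ Icc (x - h) (x + h), |iteratedDeriv 4 f y| ≤ C) :
    |f (x + h) - 2 * f x + f (x - h) - h ^ 2 * iteratedDeriv 2 f x| ≤ 2 * C * h ^ 4 := by
  have e0 : x ∈ Icc (x - h) (x + h) := ⟨by linarith, by linarith⟩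
  have e1 : x + h ∈ Icc (x - h) (x + h) := ⟨by linarith, by linarith⟩
  have e2 : x - h ∈ Icc (x - h) (x + h) := ⟨by linarith, by linarith⟩
  have hC0 : 0 ≤ C := (abs_nonneg _).trans (hC x e0)
  have h2 : HasTwoDerivs (x - h) (x + h) (iteratedDeriv 2 f) (iteratedDeriv 3 f)
      (iteratedDeriv 4 f) := by
    have hf2 : ContDiff ℝ ∞ (iteratedDeriv 2 f) := by
      rw [iteratedDeriv_eq_iterate]
      exact hf.iterate_deriv 2
    have := hasTwoDerivs_of_contDiff hf2 (x - h) (x + h)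
    simpa only [iteratedDeriv_eq_iterate, ← Function.iterate_add_apply] using this
  have h3 := (hasTwoDerivs_of_contDiff hf (x - h) (x + h)).abs_second_diff_sub_le e0 e1 e2
    (C := 2 * C * h ^ 2) fun s hs => by
      have s1 : s * h ≤ h := by nlinarith [hs.2]
      have s0 : 0 ≤ s * h := mul_nonneg hs.1 hh
      refine (h2.abs_second_diff_le e0 ⟨by linarith, by linarith⟩ ⟨by linarith, by linarith⟩
        hC).trans ?_
      gcongr
  exact h3.trans_eq (by ring)

open Filter Topology in
/-- Consistency of the second difference quotient under a bound on the weak derivative of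
order `4`. -/
lemma abs_second_diff_sub_le_of_hasWeakDeriv {v₁ v₂ : ℝ → ℝ} (hv : HasTwoDerivs a b v v₁ v₂)
    (hw : HasWeakDeriv a b 4 v w)
    (hwC : ∀ᵐ x ∂volume.restrict (Ioo a b), |w x| ≤ C) (hC : 0 ≤ C) {x h : ℝ}
    (hx : x ∈ Ioo a b) (hh : 0 < h) (hp : x + h ∈ Icc a b) (hm : x - h ∈ Icc a b) :
    |(v (x + h) - 2 * v x + v (x - h)) / h ^ 2 - v₂ x| ≤ 2 * C * h ^ 2 := by
  have hxI := Ioo_subset_Icc_self hx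
  -- comparison of the difference quotients with steps `s` and `η`
  have key : ∀ s η, 0 < η → η ≤ s → s < h →
      |(v (x + s) - 2 * v x + v (x - s)) / s ^ 2 - (v (x + η) - 2 * v x + v (x - η)) / η ^ 2|
        ≤ 2 * C * s ^ 2 + 2 * C * η ^ 2 := by
    intro s η hη hηs hsh
    have hs : 0 < s := hη.trans_le hηs
    obtain ⟨f, h1, h2, h3⟩ := exists_smooth_approx hv.continuousOn hw hwC hC (c := x - s)
      (d := x + s) (by linarith [hm.1]) (by linarith [hp.2])
    have lim : ∀ r, 0 < r → r ≤ s → Tendsto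
        (fun n => (f n (x + r) - 2 * f n x + f n (x - r)) / r ^ 2) atTop
        (𝓝 ((v (x + r) - 2 * v x + v (x - r)) / r ^ 2)) := by
      intro r hr hrs
      exact (((h2 _ ⟨by linarith, by linarith⟩).sub
        ((h2 x ⟨by linarith, by linarith⟩).const_mul 2)).add
          (h2 _ ⟨by linarith, by linarith⟩)).div_const _
    refine le_of_tendsto ((lim s hs le_rfl).sub (lim η hη hηs)).abs
      (Eventually.of_forall fun n => ?_)
    have bd : ∀ r, 0 < r → r ≤ s → |(f n (x + r) - 2 * f n x + f n (x - r)) / r ^ 2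
        - iteratedDeriv 2 (f n) x| ≤ 2 * C * r ^ 2 := by
      intro r hr hrs
      have := abs_second_diff_sub_le_of_contDiff (C := C) (h1 n) hr.le (x := x)
        fun y hy => h3 n y ⟨by linarith [hy.1], by linarith [hy.2]⟩
      rw [div_sub' (by positivity), abs_div, abs_of_pos (by positivity : 0 < r ^ 2),
        div_le_iff₀ (by positivity)]
      exact this.trans_eq (by ring)
    have b1 := abs_le.1 (bd s hs le_rfl)
    have b2 := abs_le.1 (bd η hη hηs)
    rw [abs_le]
    constructor <;> linarith
  -- the difference quotients converge to the second derivative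
  have lim : Tendsto (fun η => (v (x + η) - 2 * v x + v (x - η)) / η ^ 2) (𝓝[>] 0)
      (𝓝 (v₂ x)) := by
    rw [Metric.tendsto_nhdsWithin_nhds]
    intro κ hκ
    have hc : ContinuousAt v₂ x := hv.cont.continuousAt (Icc_mem_nhds hx.1 hx.2)
    obtain ⟨δ, hδ, hδ'⟩ := Metric.continuousAt_iff.1 hc (κ / 4) (by positivity)
    refine ⟨min δ h, lt_min hδ hh, fun η hη hη' => ?_⟩
    have hη0 : 0 < η := hη
    rw [Real.dist_eq, sub_zero, abs_of_pos hη0, lt_min_iff] at hη'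
    have b1 := hv.abs_second_diff_sub_le hxI (σ := η) ⟨by linarith [hx.1], by linarith [hp.2]⟩
      ⟨by linarith [hm.1], by linarith [hx.2]⟩ (C := κ / 2) fun s hs => by
        have s1 : |s * η| < δ := by
          rw [abs_of_nonneg (mul_nonneg hs.1 hη0.le)]
          nlinarith [hs.2]
        have d1 := hδ' (x := x + s * η) (by rw [Real.dist_eq]; simpa using s1)
        have d2 := hδ' (x := x - s * η) (by
          rw [Real.dist_eq, sub_sub_cancel_left, abs_neg]; exact s1)
        rw [Real.dist_eq] at d1 d2
        have d1 := abs_lt.1 d1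
        have d2 := abs_lt.1 d2
        rw [abs_le]
        constructor <;> linarith
    rw [Real.dist_eq, div_sub' (by positivity), abs_div, abs_of_pos (by positivity : 0 < η ^ 2),
      div_lt_iff₀ (by positivity)]
    refine b1.trans_lt ?_
    gcongr
    linarith
  have step : ∀ s, 0 < s → s < h →
      |(v (x + s) - 2 * v x + v (x - s)) / s ^ 2 - v₂ x| ≤ 2 * C * s ^ 2 := by
    intro s hs hsh
    have t1 : Tendsto (fun η => |(v (x + s) - 2 * v x + v (x - s)) / s ^ 2
        - (v (x + η) - 2 * v x + v (x - η)) / η ^ 2|) (𝓝[>] 0)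
        (𝓝 |(v (x + s) - 2 * v x + v (x - s)) / s ^ 2 - v₂ x|) :=
      (tendsto_const_nhds.sub lim).abs
    have t2 : Tendsto (fun η : ℝ => 2 * C * s ^ 2 + 2 * C * η ^ 2) (𝓝[>] 0)
        (𝓝 (2 * C * s ^ 2 + 2 * C * 0 ^ 2)) :=
      (by fun_prop : Continuous fun η : ℝ => 2 * C * s ^ 2 + 2 * C * η ^ 2).continuousWithinAt
    have := le_of_tendsto_of_tendsto t1 t2 (by
      filter_upwards [Ioc_mem_nhdsGT hs] with η hη
      exact key s η hη.1 hη.2 hsh)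
    simpa using this
  -- the bound for steps `s < h` passes to `s = h`, where `x ± h` may be end points; subtracting the
  -- parabola turns it into a bound on second differences alone
  have hv' : ContinuousOn (fun y => v y - (y - x) ^ 2 / 2 * v₂ x) (Icc a b) :=
    hv.continuousOn.sub (by fun_prop)
  have fin := second_diff_limit (B := fun s => 2 * C * s ^ 2 * s ^ 2) hx hh hp hm hv'
    (by fun_prop) fun s hs hsh => by
      have := step s hs hsh
      rw [div_sub' (by positivity), abs_div, abs_of_pos (by positivity : 0 < s ^ 2),
        div_le_iff₀ (by positivity)] at this
      refine le_trans (le_of_eq ?_) this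
      congr 1
      ring
  rw [div_sub' (by positivity), abs_div, abs_of_pos (by positivity : 0 < h ^ 2),
    div_le_iff₀ (by positivity)]
  refine le_trans (le_of_eq ?_) fin
  congr 1
  ring

end Weak

/-- Extraction of a.e. bounds for weak derivatives from a bound on the Sobolev norm. -/
lemma exists_weakDeriv_of_sobolevNorm_le {a b C : ℝ} {n : ℕ} {v : ℝ → ℝ} (hC : 0 < C)
    (h : sobolevNorm a b n v < ENNReal.ofReal C) {l : ℕ} (hl : l ≤ n) :
    ∃ w, HasWeakDeriv a b l v w ∧ ∀ᵐ x ∂volume.restrict (Ioo a b), |w x| ≤ C := by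
  unfold sobolevNorm at h
  simp only [iInf_lt_iff] at h
  obtain ⟨w, hw, hs⟩ := h
  refine ⟨w l, hw l hl, ?_⟩
  have h1 : linftyNorm a b (w l) ≤ ENNReal.ofReal C :=
    (Finset.single_le_sum (f := fun l => linftyNorm a b (w l)) (fun _ _ => bot_le)
      (Finset.mem_range.2 (by omega))).trans hs.le
  unfold linftyNorm at h1
  rw [eLpNorm_exponent_top] at h1
  filter_upwards [ae_le_eLpNormEssSup (f := w l) (μ := volume.restrict (Ioo a b))] with x hx
  have h2 := hx.trans h1
  rw [← ofReal_norm, ENNReal.ofReal_le_ofReal_iff hC.le] at h2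
  exact h2

/-! ### Partial derivatives on a closed rectangle -/

section Partial

variable {a b c d T : ℝ} {u : ℝ → ℝ → ℝ}

lemma uniqueDiffOn_rectangle (hab : a < b) (hcd : c < d) :
    UniqueDiffOn ℝ (Icc a b ×ˢ Icc c d) :=
  (uniqueDiffOn_Icc hab).prod (uniqueDiffOn_Icc hcd)

lemma hasDerivWithinAt_snd {f : ℝ × ℝ → ℝ} {f' : ℝ × ℝ →L[ℝ] ℝ} {x t : ℝ}
    (hx : x ∈ Icc a b)
    (hf : HasFDerivWithinAt f f' (Icc a b ×ˢ Icc c d) (x, t)) :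
    HasDerivWithinAt (fun s => f (x, s)) (f' (0, 1)) (Icc c d) t := by
  have h1 : HasDerivWithinAt (fun s : ℝ => (x, s)) (0, 1) (Icc c d) t :=
    (hasDerivWithinAt_const t _ x).prodMk (hasDerivWithinAt_id t _)
  exact hf.comp_hasDerivWithinAt t h1 fun s hs => ⟨hx, hs⟩

/-- The partial derivative in the second variable of a `C^{n+1}` function is of class `C^n`. -/
lemma contDiffOn_derivWithin_snd (hab : a < b) (hcd : c < d) {n : WithTop ℕ∞}
    (hu : ContDiffOn ℝ (n + 1) (Function.uncurry u) (Icc a b ×ˢ Icc c d)) :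
    ContDiffOn ℝ n (Function.uncurry fun x t => derivWithin (fun s => u x s) (Icc c d) t)
        (Icc a b ×ˢ Icc c d) ∧
      ∀ x ∈ Icc a b, ∀ t ∈ Icc c d,
        HasDerivWithinAt (fun s => u x s) (derivWithin (fun s => u x s) (Icc c d) t)
          (Icc c d) t := by
  have hS := uniqueDiffOn_rectangle hab hcd
  have h1 : ∀ x ∈ Icc a b, ∀ t ∈ Icc c d, HasDerivWithinAt (fun s => u x s)
      (fderivWithin ℝ (Function.uncurry u) (Icc a b ×ˢ Icc c d) (x, t) (0, 1)) (Icc c d) t := by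
    intro x hx t ht
    exact hasDerivWithinAt_snd hx
      ((hu.differentiableOn (by simp)) (x, t) ⟨hx, ht⟩).hasFDerivWithinAt
  refine ⟨?_, fun x hx t ht => (h1 x hx t ht).differentiableWithinAt.hasDerivWithinAt⟩
  have h2 : ContDiffOn ℝ n (fun p => fderivWithin ℝ (Function.uncurry u)
      (Icc a b ×ˢ Icc c d) p (0, 1)) (Icc a b ×ˢ Icc c d) :=
    (hu.fderivWithin hS le_rfl).clm_apply contDiffOn_const
  refine h2.congr fun p hp => ?_
  exact (h1 p.1 hp.1 p.2 hp.2).derivWithin (uniqueDiffOn_Icc hcd p.2 hp.2)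

lemma IsC2.continuousOn (hu : IsC2 a b T u) :
    ContinuousOn (Function.uncurry u) (Icc a b ×ˢ Icc 0 T) := ContDiffOn.continuousOn hu

lemma IsC2.contDiffOn_dt_one (hab : a < b) (hT : 0 < T) (hu : IsC2 a b T u) :
    ContDiffOn ℝ 1 (Function.uncurry (dt T 1 u)) (Icc a b ×ˢ Icc 0 T) := by
  have h1 := (contDiffOn_derivWithin_snd (n := 1) hab hT
    (hu.of_le (by norm_num [one_add_one_eq_two]))).1
  refine h1.congr fun p _ => ?_
  simp only [Function.uncurry, dt, iteratedDerivWithin_one]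

lemma dt_succ (m : ℕ) (x t : ℝ) :
    dt T (m + 1) u x t = derivWithin (fun s => dt T m u x s) (Icc 0 T) t := by
  unfold dt
  rw [iteratedDerivWithin_succ]

lemma dx_succ (m : ℕ) (x t : ℝ) :
    dx a b (m + 1) u x t = derivWithin (fun y => dx a b m u y t) (Icc a b) x := by
  unfold dx
  rw [iteratedDerivWithin_succ]

lemma IsC2.continuousOn_dt_two (hab : a < b) (hT : 0 < T) (hu : IsC2 a b T u) :
    ContinuousOn (Function.uncurry (dt T 2 u)) (Icc a b ×ˢ Icc 0 T) := by
  have h1 := (contDiffOn_derivWithin_snd (n := 0) hab hT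
    (by simpa using hu.contDiffOn_dt_one hab hT)).1
  refine h1.continuousOn.congr fun p _ => ?_
  simp only [Function.uncurry, ← dt_succ]

lemma IsC2.hasTwoDerivs_time (hab : a < b) (hT : 0 < T) (hu : IsC2 a b T u) {x : ℝ}
    (hx : x ∈ Icc a b) : HasTwoDerivs 0 T (u x) (dt T 1 u x) (dt T 2 u x) where
  deriv₁ t ht := by
    have h1 := (contDiffOn_derivWithin_snd (n := 1) hab hT
      (hu.of_le (by norm_num [one_add_one_eq_two]))).2 x hx t ht
    unfold dt
    rw [iteratedDerivWithin_one]
    exact h1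
  deriv₂ t ht := by
    have h1 := (contDiffOn_derivWithin_snd (n := 0) hab hT
      (by simpa using hu.contDiffOn_dt_one hab hT)).2 x hx t ht
    rw [dt_succ 1]
    exact h1
  cont := (hu.continuousOn_dt_two hab hT).comp (f := fun t => (x, t)) (by fun_prop)
    fun t ht => ⟨hx, ht⟩

/-- Exchange of the roles of space and time. -/
lemma IsC2.swap (hu : IsC2 a b T u) :
    ContDiffOn ℝ 2 (Function.uncurry fun t x => u x t) (Icc 0 T ×ˢ Icc a b) :=
  ContDiffOn.comp (g := Function.uncurry u) (f := fun p : ℝ × ℝ => (p.2, p.1)) hu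
    (contDiff_snd.prodMk contDiff_fst).contDiffOn fun _ hp => ⟨hp.2, hp.1⟩

lemma IsC2.contDiffOn_dx_one_swap (hab : a < b) (hT : 0 < T) (hu : IsC2 a b T u) :
    ContDiffOn ℝ 1 (Function.uncurry fun t x => dx a b 1 u x t) (Icc 0 T ×ˢ Icc a b) := by
  have h1 := (contDiffOn_derivWithin_snd (n := 1) hT hab
    (hu.swap.of_le (by norm_num [one_add_one_eq_two]))).1
  refine h1.congr fun p _ => ?_
  simp only [Function.uncurry, dx, iteratedDerivWithin_one]

lemma IsC2.contDiffOn_dx_one (hab : a < b) (hT : 0 < T) (hu : IsC2 a b T u) :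
    ContDiffOn ℝ 1 (Function.uncurry (dx a b 1 u)) (Icc a b ×ˢ Icc 0 T) :=
  ContDiffOn.comp (g := Function.uncurry fun t x => dx a b 1 u x t)
    (f := fun p : ℝ × ℝ => (p.2, p.1)) (hu.contDiffOn_dx_one_swap hab hT)
    (contDiff_snd.prodMk contDiff_fst).contDiffOn fun _ hp => ⟨hp.2, hp.1⟩

lemma IsC2.continuousOn_dx_two (hab : a < b) (hT : 0 < T) (hu : IsC2 a b T u) :
    ContinuousOn (Function.uncurry (dx a b 2 u)) (Icc a b ×ˢ Icc 0 T) := by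
  have h1 := (contDiffOn_derivWithin_snd (n := 0) hT hab
    (by simpa using hu.contDiffOn_dx_one_swap hab hT)).1.continuousOn
  have h2 : ContinuousOn (Function.uncurry fun t x => dx a b 2 u x t) (Icc 0 T ×ˢ Icc a b) := by
    refine h1.congr fun p _ => ?_
    simp only [Function.uncurry, ← dx_succ]
  exact ContinuousOn.comp (g := Function.uncurry fun t x => dx a b 2 u x t)
    (f := fun p : ℝ × ℝ => (p.2, p.1)) h2 (by fun_prop) fun _ hp => ⟨hp.2, hp.1⟩

lemma IsC2.hasTwoDerivs_space (hab : a < b) (hT : 0 < T) (hu : IsC2 a b T u) {t : ℝ}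
    (ht : t ∈ Icc 0 T) : HasTwoDerivs a b (fun x => u x t) (fun x => dx a b 1 u x t)
      (fun x => dx a b 2 u x t) where
  deriv₁ x hx := by
    have h1 := (contDiffOn_derivWithin_snd (n := 1) hT hab
      (hu.swap.of_le (by norm_num [one_add_one_eq_two]))).2 t ht x hx
    unfold dx
    rw [iteratedDerivWithin_one]
    exact h1
  deriv₂ x hx := by
    have h1 := (contDiffOn_derivWithin_snd (n := 0) hT hab
      (by simpa using hu.contDiffOn_dx_one_swap hab hT)).2 t ht x hx
    rw [dx_succ 1]
    exact h1
  cont := (hu.continuousOn_dx_two hab hT).comp (f := fun x => (x, t)) (by fun_prop)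
    fun x hx => ⟨hx, ht⟩

lemma continuousOn_space {f : ℝ → ℝ → ℝ}
    (hf : ContinuousOn (Function.uncurry f) (Icc a b ×ˢ Icc 0 T)) {t : ℝ} (ht : t ∈ Icc 0 T) :
    ContinuousOn (fun x => f x t) (Icc a b) :=
  hf.comp (f := fun x => (x, t)) (by fun_prop) fun _ hx => ⟨hx, ht⟩

lemma continuousOn_time {f : ℝ → ℝ → ℝ}
    (hf : ContinuousOn (Function.uncurry f) (Icc a b ×ˢ Icc 0 T)) {x : ℝ} (hx : x ∈ Icc a b) :
    ContinuousOn (fun t => f x t) (Icc 0 T) :=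
  hf.comp (f := fun t => (x, t)) (by fun_prop) fun _ ht => ⟨hx, ht⟩

lemma IsRegular.hasDerivWithinAt_dt_two (hT : 0 < T) (hu : IsRegular a b T u) {x : ℝ}
    (hx : x ∈ Icc a b) {t : ℝ} (ht : t ∈ Icc 0 T) :
    HasDerivWithinAt (dt T 2 u x) (dt T 3 u x t) (Icc 0 T) t := by
  have h1 := (hu.contDiffOn_time x hx).differentiableOn_iteratedDerivWithin (m := 2)
    (by norm_cast) (uniqueDiffOn_Icc hT)
  rw [dt_succ 2]
  exact (h1 t ht).hasDerivWithinAt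

end Partial

/-! ### Sup-norm bounds for the wave equation -/

section Wave

variable {a b T v : ℝ} {u : ℝ → ℝ → ℝ}

/-- The quantity `∂_t u + v ∂_x u`, which is transported with velocity `-v` if
`∂_tt u = v² ∂_xx u`. -/
noncomputable def riemannInvariant (a b T v : ℝ) (u : ℝ → ℝ → ℝ) (x t : ℝ) : ℝ :=
  dt T 1 u x t + v * dx a b 1 u x t

lemma continuousOn_riemannInvariant (hab : a < b) (hT : 0 < T) (hu : IsC2 a b T u) (v : ℝ) :
    ContinuousOn (Function.uncurry (riemannInvariant a b T v u)) (Icc a b ×ˢ Icc 0 T) :=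
  (hu.contDiffOn_dt_one hab hT).continuousOn.add
    (continuousOn_const.mul (hu.contDiffOn_dx_one hab hT).continuousOn)

lemma IsC2.contDiffAt (hu : IsC2 a b T u) {x t : ℝ} (hx : x ∈ Ioo a b) (ht : t ∈ Ioo 0 T) :
    ContDiffAt ℝ 2 (Function.uncurry u) (x, t) :=
  ContDiffOn.contDiffAt hu (prod_mem_nhds (Icc_mem_nhds hx.1 hx.2) (Icc_mem_nhds ht.1 ht.2))

lemma hasDerivAt_line {E : Type*} [NormedAddCommGroup E] [NormedSpace ℝ E] {f : ℝ × ℝ → E}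
    {f' : ℝ × ℝ →L[ℝ] E} {p : ℝ → ℝ × ℝ} {w : ℝ × ℝ} {s : ℝ} (hf : HasFDerivAt f f' (p s))
    (hp : HasDerivAt p w s) : HasDerivAt (fun r => f (p r)) (f' w) s :=
  hf.comp_hasDerivAt s hp

lemma IsC2.dt_one_eq (hab : a < b) (hT : 0 < T) (hu : IsC2 a b T u) {x t : ℝ}
    (hx : x ∈ Ioo a b) (ht : t ∈ Ioo 0 T) :
    dt T 1 u x t = fderiv ℝ (Function.uncurry u) (x, t) (0, 1) := by
  have h1 := ((hu.hasTwoDerivs_time hab hT (Ioo_subset_Icc_self hx)).deriv₁ t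
    (Ioo_subset_Icc_self ht)).hasDerivAt (Icc_mem_nhds ht.1 ht.2)
  have h2 := hasDerivAt_line (p := fun s => (x, s)) (s := t)
    ((hu.contDiffAt hx ht).differentiableAt (by simp)).hasFDerivAt
    ((hasDerivAt_const t x).prodMk (hasDerivAt_id t))
  exact h1.unique h2

lemma IsC2.dx_one_eq (hab : a < b) (hT : 0 < T) (hu : IsC2 a b T u) {x t : ℝ}
    (hx : x ∈ Ioo a b) (ht : t ∈ Ioo 0 T) :
    dx a b 1 u x t = fderiv ℝ (Function.uncurry u) (x, t) (1, 0) := by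
  have h1 := ((hu.hasTwoDerivs_space hab hT (Ioo_subset_Icc_self ht)).deriv₁ x
    (Ioo_subset_Icc_self hx)).hasDerivAt (Icc_mem_nhds hx.1 hx.2)
  have h2 := hasDerivAt_line (p := fun y => (y, t)) (s := x)
    ((hu.contDiffAt hx ht).differentiableAt (by simp)).hasFDerivAt
    ((hasDerivAt_id x).prodMk (hasDerivAt_const x t))
  exact h1.unique h2

lemma IsC2.hasFDerivAt_fderiv (hu : IsC2 a b T u) {x t : ℝ}
    (hx : x ∈ Ioo a b) (ht : t ∈ Ioo 0 T) :
    HasFDerivAt (fderiv ℝ (Function.uncurry u))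
      (fderiv ℝ (fderiv ℝ (Function.uncurry u)) (x, t)) (x, t) :=
  (((hu.contDiffAt hx ht).fderiv_right (m := 1)
    (by norm_num [one_add_one_eq_two])).differentiableAt (by simp)).hasFDerivAt

open Filter Topology in
lemma IsC2.dt_two_eq (hab : a < b) (hT : 0 < T) (hu : IsC2 a b T u) {x t : ℝ}
    (hx : x ∈ Ioo a b) (ht : t ∈ Ioo 0 T) :
    dt T 2 u x t = fderiv ℝ (fderiv ℝ (Function.uncurry u)) (x, t) (0, 1) (0, 1) := by
  have h1 := ((hu.hasTwoDerivs_time hab hT (Ioo_subset_Icc_self hx)).deriv₂ t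
    (Ioo_subset_Icc_self ht)).hasDerivAt (Icc_mem_nhds ht.1 ht.2)
  have h2 := (hasDerivAt_line (p := fun s => (x, s)) (s := t) (hu.hasFDerivAt_fderiv hx ht)
    ((hasDerivAt_const t x).prodMk (hasDerivAt_id t))).clm_apply (hasDerivAt_const t (0, 1))
  simp only [map_zero, add_zero] at h2
  refine (h1.congr_of_eventuallyEq ?_).unique h2
  filter_upwards [Ioo_mem_nhds ht.1 ht.2] with s hs
  exact (hu.dt_one_eq hab hT hx hs).symm

open Filter Topology in
lemma IsC2.dx_two_eq (hab : a < b) (hT : 0 < T) (hu : IsC2 a b T u) {x t : ℝ}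
    (hx : x ∈ Ioo a b) (ht : t ∈ Ioo 0 T) :
    dx a b 2 u x t = fderiv ℝ (fderiv ℝ (Function.uncurry u)) (x, t) (1, 0) (1, 0) := by
  have h1 := ((hu.hasTwoDerivs_space hab hT (Ioo_subset_Icc_self ht)).deriv₂ x
    (Ioo_subset_Icc_self hx)).hasDerivAt (Icc_mem_nhds hx.1 hx.2)
  have h2 := (hasDerivAt_line (p := fun y => (y, t)) (s := x) (hu.hasFDerivAt_fderiv hx ht)
    ((hasDerivAt_id x).prodMk (hasDerivAt_const x t))).clm_apply (hasDerivAt_const x (1, 0))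
  simp only [map_zero, add_zero] at h2
  refine (h1.congr_of_eventuallyEq ?_).unique h2
  filter_upwards [Ioo_mem_nhds hx.1 hx.2] with y hy
  exact (hu.dx_one_eq hab hT hy ht).symm

open Filter Topology in
/-- The Riemann invariants are constant along characteristics. -/
lemma riemannInvariant_eq (hab : a < b) (hT : 0 < T) (hv : v ≠ 0) (hu : IsC2 a b T u)
    (heq : ∀ x ∈ Ioo a b, ∀ t ∈ Ioo 0 T, dt T 2 u x t - v ^ 2 * dx a b 2 u x t = 0)
    {x₀ x₁ t₀ t₁ : ℝ} (hx₀ : x₀ ∈ Icc a b) (hx₁ : x₁ ∈ Icc a b) (ht₀ : 0 ≤ t₀) (ht : t₀ ≤ t₁)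
    (ht₁ : t₁ ≤ T) (hx : x₀ = x₁ + v * (t₁ - t₀)) :
    riemannInvariant a b T v u x₁ t₁ = riemannInvariant a b T v u x₀ t₀ := by
  rcases ht.eq_or_lt with rfl | ht
  · simp only [sub_self, mul_zero, add_zero] at hx; rw [hx]
  set γ : ℝ → ℝ × ℝ := fun s => (x₁ + v * (t₁ - s), s) with hγ
  have hγd : ∀ s, HasDerivAt γ (-v, 1) s := by
    intro s
    refine HasDerivAt.prodMk ?_ (hasDerivAt_id s)
    simpa using (((hasDerivAt_id s).const_sub t₁).const_mul v).const_add x₁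
  -- the characteristic joins two points of the rectangle and is interior in between
  have hconv : ∀ s ∈ Icc t₀ t₁, (γ s).1 = (t₁ - s) / (t₁ - t₀) * x₀ + (s - t₀) / (t₁ - t₀) * x₁ := by
    intro s _
    have : t₁ - t₀ ≠ 0 := by linarith [ht]
    simp only [hγ, hx]
    field_simp
    ring
  have hIcc : ∀ s ∈ Icc t₀ t₁, γ s ∈ Icc a b ×ˢ Icc 0 T := by
    intro s hs
    refine ⟨?_, by simp only [hγ]; linarith [hs.1], by simp only [hγ]; linarith [hs.2]⟩
    rw [hconv s hs]
    have h0 : 0 < t₁ - t₀ := by linarith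
    exact convex_Icc a b hx₀ hx₁ (div_nonneg (by linarith [hs.2]) h0.le)
      (div_nonneg (by linarith [hs.1]) h0.le) (by field_simp; ring)
  have hIoo : ∀ s ∈ Ioo t₀ t₁, (γ s).1 ∈ Ioo a b := by
    intro s hs
    have e1 : (γ s).1 = x₁ + v * (t₁ - s) := rfl
    rw [e1]
    have p1 : 0 < t₁ - s := by linarith [hs.2]
    have p2 : 0 < s - t₀ := by linarith [hs.1]
    rcases lt_or_gt_of_ne hv with hneg | hpos
    · have q1 := mul_neg_of_neg_of_pos hneg p1
      have q2 := mul_neg_of_neg_of_pos hneg p2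
      constructor <;> nlinarith [hx₀.1, hx₀.2, hx₁.1, hx₁.2]
    · have q1 := mul_pos hpos p1
      have q2 := mul_pos hpos p2
      constructor <;> nlinarith [hx₀.1, hx₀.2, hx₁.1, hx₁.2]
  have hcont : ContinuousOn (fun s => riemannInvariant a b T v u (γ s).1 (γ s).2) (Icc t₀ t₁) :=
    (continuousOn_riemannInvariant hab hT hu v).comp (f := γ)
      (fun s _ => (hγd s).continuousAt.continuousWithinAt) hIcc
  have hder : ∀ s ∈ Ioo t₀ t₁,
      HasDerivAt (fun s => riemannInvariant a b T v u (γ s).1 (γ s).2) 0 s := by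
    intro s hs
    have hsT : s ∈ Ioo 0 T := ⟨by linarith [hs.1], by linarith [hs.2]⟩
    have hxs := hIoo s hs
    have h1 := (hasDerivAt_line (p := γ) (hu.hasFDerivAt_fderiv hxs hsT) (hγd s)).clm_apply
      (hasDerivAt_const s ((v, 1) : ℝ × ℝ))
    have hsymm : IsSymmSndFDerivAt ℝ (Function.uncurry u) (γ s) :=
      (hu.contDiffAt hxs hsT).isSymmSndFDerivAt (by simp)
    set H := fderiv ℝ (fderiv ℝ (Function.uncurry u)) (γ s) with hH
    have e0 : H (-v, 1) (v, 1) = 0 := by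
      have w1 : ((-v, 1) : ℝ × ℝ) = -v • (1, 0) + (0, 1) := by simp
      have w2 : ((v, 1) : ℝ × ℝ) = v • (1, 0) + (0, 1) := by simp
      have s1 : H (1, 0) (0, 1) = H (0, 1) (1, 0) := hsymm _ _
      have s2 := heq _ hxs s hsT
      rw [hu.dt_two_eq hab hT hxs hsT, hu.dx_two_eq hab hT hxs hsT] at s2
      change H (0, 1) (0, 1) - v ^ 2 * H (1, 0) (1, 0) = 0 at s2
      rw [w1, w2]
      simp only [map_add, map_smul, add_apply, smul_apply, smul_eq_mul, s1]
      linarith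
    have h2 : HasDerivAt (fun r => fderiv ℝ (Function.uncurry u) (γ r) (v, 1)) 0 s := by
      refine h1.congr_deriv ?_
      rw [map_zero, add_zero]
      exact e0
    refine h2.congr_of_eventuallyEq ?_
    filter_upwards [Ioo_mem_nhds hs.1 hs.2] with r hr
    have hrT : r ∈ Ioo 0 T := ⟨by linarith [hr.1], by linarith [hr.2]⟩
    have w2 : ((v, 1) : ℝ × ℝ) = v • (1, 0) + (0, 1) := by simp
    rw [w2, map_add, map_smul]
    unfold riemannInvariant
    rw [hu.dt_one_eq hab hT (hIoo r hr) hrT, hu.dx_one_eq hab hT (hIoo r hr) hrT, smul_eq_mul,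
      add_comm]
  obtain ⟨c, -, hc⟩ := exists_hasDerivAt_eq_slope _ (fun _ => 0) ht hcont hder
  have h0 : t₁ - t₀ ≠ 0 := by linarith
  rw [eq_div_iff h0, zero_mul] at hc
  have g1 : γ t₁ = (x₁, t₁) := by simp [hγ]
  have g0 : γ t₀ = (x₀, t₀) := by simp [hγ, hx]
  rw [g1, g0] at hc
  linarith

lemma dt_one_eq_zero_of_forall {x : ℝ} (h : ∀ t ∈ Icc 0 T, u x t = 0) {t : ℝ}
    (ht : t ∈ Icc 0 T) : dt T 1 u x t = 0 := by
  unfold dt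
  rw [iteratedDerivWithin_one, derivWithin_congr (f := fun _ => (0 : ℝ)) h (h t ht)]
  simp

/-- The sup norms of the Riemann invariants do not grow: a characteristic that meets the boundary
is continued by one of the other family, since `∂_t u = 0` there makes the two invariants opposite.
The time interval is so short that this happens at most once. -/
lemma abs_riemannInvariant_le_step (hab : a < b) (hT : 0 < T) (hv : 0 < v) (hu : IsC2 a b T u)
    (heq : ∀ x ∈ Ioo a b, ∀ t ∈ Ioo 0 T, dt T 2 u x t - v ^ 2 * dx a b 2 u x t = 0)
    (hbd : Dirichlet a b T u) {m t₀ t₁ : ℝ} (ht₀ : 0 ≤ t₀) (ht : t₀ ≤ t₁)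
    (ht₁ : t₁ ≤ T) (hst : v * (t₁ - t₀) ≤ b - a)
    (hm : ∀ x ∈ Icc a b, |riemannInvariant a b T v u x t₀| ≤ m ∧
      |riemannInvariant a b T (-v) u x t₀| ≤ m) :
    ∀ x ∈ Icc a b, |riemannInvariant a b T v u x t₁| ≤ m ∧
      |riemannInvariant a b T (-v) u x t₁| ≤ m := by
  intro x hx
  have heq' : ∀ x ∈ Ioo a b, ∀ t ∈ Ioo 0 T, dt T 2 u x t - (-v) ^ 2 * dx a b 2 u x t = 0 := by
    simpa using heq
  have hv' : -v ≠ 0 := neg_ne_zero.2 hv.ne'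
  have ha : a ∈ Icc a b := ⟨le_rfl, hab.le⟩
  have hb : b ∈ Icc a b := ⟨hab.le, le_rfl⟩
  have refl : ∀ y, (∀ t ∈ Icc 0 T, u y t = 0) → ∀ t ∈ Icc 0 T,
      riemannInvariant a b T (-v) u y t = -riemannInvariant a b T v u y t := by
    intro y hy t ht
    unfold riemannInvariant
    rw [dt_one_eq_zero_of_forall hy ht]
    ring
  constructor
  · rcases le_or_gt (x + v * (t₁ - t₀)) b with h1 | h1
    · have hmem : x + v * (t₁ - t₀) ∈ Icc a b :=
        ⟨by have := mul_nonneg hv.le (sub_nonneg.2 ht); linarith [hx.1], h1⟩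
      rw [riemannInvariant_eq hab hT hv.ne' hu heq hmem hx ht₀ ht ht₁ rfl]
      exact (hm _ hmem).1
    · set s := t₁ - (b - x) / v with hs
      have e1 : v * (t₁ - s) = b - x := by rw [hs]; field_simp; ring
      have s1 : s ≤ t₁ := by
        rw [hs]; have := div_nonneg (sub_nonneg.2 hx.2) hv.le; linarith
      have s0 : t₀ ≤ s := by
        by_contra hcon
        push Not at hcon
        nlinarith
      have hsT : s ∈ Icc 0 T := ⟨by linarith, by linarith⟩
      have hmem : b - v * (s - t₀) ∈ Icc a b :=
        ⟨by nlinarith, by have := mul_nonneg hv.le (sub_nonneg.2 s0); linarith⟩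
      rw [riemannInvariant_eq hab hT hv.ne' hu heq hb hx hsT.1 s1 ht₁ (by linarith),
        ← abs_neg, ← refl b (fun t ht => (hbd t ht).2) s hsT,
        riemannInvariant_eq hab hT hv' hu heq' hmem hb ht₀ s0 hsT.2 (by ring)]
      exact (hm _ hmem).2
  · rcases le_or_gt a (x - v * (t₁ - t₀)) with h1 | h1
    · have hmem : x - v * (t₁ - t₀) ∈ Icc a b :=
        ⟨h1, by have := mul_nonneg hv.le (sub_nonneg.2 ht); linarith [hx.2]⟩
      rw [riemannInvariant_eq hab hT hv' hu heq' hmem hx ht₀ ht ht₁ (by ring)]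
      exact (hm _ hmem).2
    · set s := t₁ - (x - a) / v with hs
      have e1 : v * (t₁ - s) = x - a := by rw [hs]; field_simp; ring
      have s1 : s ≤ t₁ := by
        rw [hs]; have := div_nonneg (sub_nonneg.2 hx.1) hv.le; linarith
      have s0 : t₀ ≤ s := by
        by_contra hcon
        push Not at hcon
        nlinarith
      have hsT : s ∈ Icc 0 T := ⟨by linarith, by linarith⟩
      have hmem : a + v * (s - t₀) ∈ Icc a b :=
        ⟨by have := mul_nonneg hv.le (sub_nonneg.2 s0); linarith, by nlinarith⟩
      rw [riemannInvariant_eq hab hT hv' hu heq' ha hx hsT.1 s1 ht₁ (by linarith),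
        refl a (fun t ht => (hbd t ht).1) s hsT, abs_neg,
        riemannInvariant_eq hab hT hv.ne' hu heq hmem ha ht₀ s0 hsT.2 rfl]
      exact (hm _ hmem).1

/-- Iteration over time intervals of length at most `(b - a) / v`. -/
lemma abs_riemannInvariant_le (hab : a < b) (hT : 0 < T) (hv : 0 < v) (hu : IsC2 a b T u)
    (heq : ∀ x ∈ Ioo a b, ∀ t ∈ Ioo 0 T, dt T 2 u x t - v ^ 2 * dx a b 2 u x t = 0)
    (hbd : Dirichlet a b T u) {m : ℝ}
    (hm : ∀ x ∈ Icc a b, |riemannInvariant a b T v u x 0| ≤ m ∧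
      |riemannInvariant a b T (-v) u x 0| ≤ m) :
    ∀ t ∈ Icc 0 T, ∀ x ∈ Icc a b, |riemannInvariant a b T v u x t| ≤ m ∧
      |riemannInvariant a b T (-v) u x t| ≤ m := by
  set δ := (b - a) / v with hδ
  have hδ0 : 0 < δ := div_pos (sub_pos.2 hab) hv
  have hvδ : v * δ = b - a := by rw [hδ]; field_simp
  have main : ∀ n : ℕ, ∀ t ∈ Icc 0 T, t ≤ n * δ → ∀ x ∈ Icc a b,
      |riemannInvariant a b T v u x t| ≤ m ∧ |riemannInvariant a b T (-v) u x t| ≤ m := by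
    intro n
    induction n with
    | zero =>
      intro t ht htn
      have : t = 0 := le_antisymm (by simpa using htn) ht.1
      rw [this]; exact hm
    | succ n ih =>
      intro t ht htn
      push_cast at htn
      have h1 : max 0 (t - δ) ≤ t := max_le ht.1 (by linarith)
      refine abs_riemannInvariant_le_step hab hT hv hu heq hbd (le_max_left 0 (t - δ)) h1 ht.2 ?_
        (ih _ ⟨le_max_left _ _, h1.trans ht.2⟩ (max_le (by positivity) (by linarith)))
      rw [← hvδ]
      gcongr
      linarith [le_max_right 0 (t - δ)]
  intro t ht
  obtain ⟨n, hn⟩ := exists_nat_ge (t / δ)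
  exact main n t ht ((div_le_iff₀ hδ0).1 hn)

/-- The solution of the fast wave equation is of size `ε^{α*}`, its time derivative of size
`ε^{α* - 1}`. The Riemann invariants at time zero are `ε^β ω₁ ± ε^{α - 1} ω₀'`, hence of size
`ε^{α* - 1}`; their difference gives `∂_x G = O(ε^{α*})`, which is integrated from the boundary. -/
theorem exists_wave_bound {α β : ℝ} (hab : a < b) (hT : 0 < T) {ω₀ ω₁ : ℝ → ℝ}
    {G : ℝ → ℝ → ℝ → ℝ}
    (hG : ∀ ε ∈ Ioc (0 : ℝ) 1, IsWaveSolution a b T α β ε ω₀ ω₁ (G ε)) :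
    ∃ K : ℝ, 0 ≤ K ∧ ∀ ε ∈ Ioc (0 : ℝ) 1, ∀ x ∈ Icc a b, ∀ t ∈ Icc 0 T,
      |dt T 1 (G ε) x t| ≤ K * ε ^ (alphaStar α β - 1) ∧
        |G ε x t| ≤ K * ε ^ alphaStar α β := by
  have h0T : (0 : ℝ) ∈ Icc 0 T := ⟨le_rfl, hT.le⟩
  have hdx : ∀ ε ∈ Ioc (0 : ℝ) 1, ∀ x ∈ Icc a b,
      dx a b 1 (G ε) x 0 = ε ^ α * derivWithin ω₀ (Icc a b) x := by
    intro ε hε x hx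
    unfold dx
    rw [iteratedDerivWithin_one, derivWithin_congr (fun y hy => ((hG ε hε).init y hy).1)
      ((hG ε hε).init x hx).1, derivWithin_const_mul_field]
  -- for `ε = 1` the initial data are `ω₀`, `ω₁`, so these inherit the regularity of `G`
  have h1 := hG 1 ⟨one_pos, le_rfl⟩
  obtain ⟨K₁, hK₁⟩ := isCompact_Icc.exists_bound_of_continuousOn
    (continuousOn_space (h1.regular.contDiffOn_dt_one hab hT).continuousOn h0T)
  obtain ⟨K₂, hK₂⟩ := isCompact_Icc.exists_bound_of_continuousOn
    (continuousOn_space (h1.regular.contDiffOn_dx_one hab hT).continuousOn h0T)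
  have hω₁ : ∀ x ∈ Icc a b, |ω₁ x| ≤ K₁ := by
    intro x hx
    have := hK₁ x hx
    rw [(h1.init x hx).2, Real.one_rpow] at this
    simpa using this
  have hω₀ : ∀ x ∈ Icc a b, |derivWithin ω₀ (Icc a b) x| ≤ K₂ := by
    intro x hx
    have := hK₂ x hx
    rwa [hdx 1 ⟨one_pos, le_rfl⟩ x hx, Real.one_rpow, one_mul, Real.norm_eq_abs] at this
  have ha : a ∈ Icc a b := ⟨le_rfl, hab.le⟩
  have K₁0 : 0 ≤ K₁ := (abs_nonneg _).trans (hω₁ a ha)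
  have K₂0 : 0 ≤ K₂ := (abs_nonneg _).trans (hω₀ a ha)
  have hba : 0 ≤ b - a := by linarith
  refine ⟨(K₁ + K₂) * (1 + (b - a)), by positivity, fun ε hε => ?_⟩
  have hε0 := hε.1
  set m := (K₁ + K₂) * ε ^ (alphaStar α β - 1) with hm
  have hs := hG ε hε
  have hv : 0 < 1 / ε := by positivity
  have p1 : ε ^ β ≤ ε ^ (alphaStar α β - 1) :=
    Real.rpow_le_rpow_of_exponent_ge hε.1 hε.2 (by
      have := min_le_right α (1 + β); unfold alphaStar; linarith)
  have p2 : 1 / ε * ε ^ α ≤ ε ^ (alphaStar α β - 1) := by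
    have e1 : 1 / ε * ε ^ α = ε ^ (α - 1) := by
      rw [Real.rpow_sub_one hε0.ne']; ring
    rw [e1]
    exact Real.rpow_le_rpow_of_exponent_ge hε.1 hε.2 (by
      have := min_le_left α (1 + β); unfold alphaStar; linarith)
  have init : ∀ x ∈ Icc a b, ∀ σ : ℝ, |σ| = 1 / ε →
      |riemannInvariant a b T σ (G ε) x 0| ≤ m := by
    intro x hx σ hσ
    unfold riemannInvariant
    rw [(hs.init x hx).2, hdx ε hε x hx]
    refine (abs_add_le _ _).trans ?_
    have r1 : 0 ≤ ε ^ β := (Real.rpow_pos_of_pos hε0 _).le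
    have r2 : 0 ≤ ε ^ α := (Real.rpow_pos_of_pos hε0 _).le
    rw [abs_mul, abs_mul, abs_mul, hσ, abs_of_nonneg r1, abs_of_nonneg r2, ← mul_assoc, hm,
      add_mul, mul_comm K₁, mul_comm K₂]
    exact add_le_add (mul_le_mul p1 (hω₁ x hx) (abs_nonneg _) (r1.trans p1))
      (mul_le_mul p2 (hω₀ x hx) (abs_nonneg _) (by positivity))
  have heq : ∀ x ∈ Ioo a b, ∀ t ∈ Ioo 0 T,
      dt T 2 (G ε) x t - (1 / ε) ^ 2 * dx a b 2 (G ε) x t = 0 := by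
    intro x hx t ht
    rw [div_pow, one_pow]
    exact hs.eqn x hx t ht
  have main := abs_riemannInvariant_le hab hT hv hs.regular heq hs.bdry (m := m) fun x hx =>
    ⟨init x hx _ (abs_of_pos hv), init x hx _ (by rw [abs_neg, abs_of_pos hv])⟩
  have m0 : 0 ≤ m := by positivity
  have bt : ∀ x ∈ Icc a b, ∀ t ∈ Icc 0 T, |dt T 1 (G ε) x t| ≤ m := by
    intro x hx t ht
    obtain ⟨q1, q2⟩ := main t ht x hx
    unfold riemannInvariant at q1 q2
    rw [abs_le] at q1 q2 ⊢
    constructor <;> linarith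
  have bx : ∀ t ∈ Icc 0 T, ∀ x ∈ Icc a b, |dx a b 1 (G ε) x t| ≤ ε * m := by
    intro t ht x hx
    obtain ⟨q1, q2⟩ := main t ht x hx
    unfold riemannInvariant at q1 q2
    have q3 : |1 / ε * dx a b 1 (G ε) x t| ≤ m := by
      rw [abs_le] at q1 q2 ⊢
      constructor <;> linarith
    rw [abs_mul, abs_of_pos hv, one_div, inv_mul_le_iff₀ hε0] at q3
    exact q3
  have em : ε * m = (K₁ + K₂) * ε ^ alphaStar α β := by
    rw [hm, Real.rpow_sub_one hε0.ne']; field_simp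
  intro x hx t ht
  constructor
  · refine (bt x hx t ht).trans ?_
    rw [hm, mul_right_comm]
    exact le_mul_of_one_le_right (by positivity) (by linarith)
  · have q := abs_sub_le_of_hasDerivWithinAt
      (hs.regular.hasTwoDerivs_space hab hT ht).deriv₁ (bx t ht) ha hx
    rw [(hs.bdry t ht).1, sub_zero, abs_of_nonneg (sub_nonneg.2 hx.1)] at q
    have r : 0 ≤ ε ^ alphaStar α β := (Real.rpow_pos_of_pos hε0 _).le
    calc _ ≤ ε * m * (x - a) := q
      _ ≤ ε * m * (1 + (b - a)) := by gcongr; linarith [hx.2]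
      _ = _ := by rw [em]; ring

end Wave

/-! ### Uniform bounds on the exact solution -/

/-- Pointwise consequences of the bounds on the exact solution, in terms of difference quotients
in space and derivatives in time. -/
structure UniformBounds (a b T ε K : ℝ) (E F : ℝ → ℝ → ℝ) : Prop where
  E_le : ∀ t ∈ Icc 0 T, ∀ x ∈ Icc a b, |E x t| ≤ K
  E_lip : ∀ t ∈ Icc 0 T, ∀ x ∈ Icc a b, ∀ y ∈ Icc a b, |E y t - E x t| ≤ K * |y - x|
  E_dt_le : ∀ t ∈ Icc 0 T, ∀ x ∈ Icc a b, |dt T 1 E x t| ≤ K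
  E_dtt_le : ∀ t ∈ Icc 0 T, ∀ x ∈ Icc a b, |dt T 2 E x t| ≤ K
  E_dttt_le : ∀ t ∈ Icc 0 T, ∀ x ∈ Icc a b, |dt T 3 E x t| ≤ K / ε
  E_dtt_lip : ∀ t ∈ Icc 0 T, ∀ x ∈ Icc a b, ∀ y ∈ Icc a b,
    |dt T 2 E y t - dt T 2 E x t| ≤ K * |y - x|
  E_dttt_lip : ∀ t ∈ Icc 0 T, ∀ x ∈ Icc a b, ∀ y ∈ Icc a b,
    |dt T 3 E y t - dt T 3 E x t| ≤ K / ε * |y - x|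
  E_dxx : ∀ t ∈ Icc 0 T, ∀ x ∈ Ioo a b, ∀ h, 0 < h → x + h ∈ Icc a b → x - h ∈ Icc a b →
    |(E (x + h) t - 2 * E x t + E (x - h) t) / h ^ 2 - dx a b 2 E x t| ≤ K * h ^ 2
  E_dt_dxx : ∀ t ∈ Icc 0 T, ∀ x ∈ Ioo a b, ∀ h, 0 < h → x + h ∈ Icc a b → x - h ∈ Icc a b →
    |dt T 1 E (x + h) t - 2 * dt T 1 E x t + dt T 1 E (x - h) t| ≤ K * h ^ 2
  E_dtt_dxx : ∀ t ∈ Icc 0 T, ∀ x ∈ Ioo a b, ∀ h, 0 < h → x + h ∈ Icc a b → x - h ∈ Icc a b →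
    |dt T 2 E (x + h) t - 2 * dt T 2 E x t + dt T 2 E (x - h) t| ≤ K * h ^ 2
  F_le : ∀ t ∈ Icc 0 T, ∀ x ∈ Icc a b, |F x t| ≤ K * ε
  F_dt_le : ∀ t ∈ Icc 0 T, ∀ x ∈ Icc a b, |dt T 1 F x t| ≤ K
  F_dtt_le : ∀ t ∈ Icc 0 T, ∀ x ∈ Icc a b, |dt T 2 F x t| ≤ K
  F_dttt_le : ∀ t ∈ Icc 0 T, ∀ x ∈ Icc a b, |dt T 3 F x t| ≤ K / ε
  F_dxx : ∀ t ∈ Icc 0 T, ∀ x ∈ Ioo a b, ∀ h, 0 < h → x + h ∈ Icc a b → x - h ∈ Icc a b →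
    |(F (x + h) t - 2 * F x t + F (x - h) t) / h ^ 2 - dx a b 2 F x t| ≤ K * ε * h ^ 2
  F_dtt_dxx : ∀ t ∈ Icc 0 T, ∀ x ∈ Ioo a b, ∀ h, 0 < h → x + h ∈ Icc a b → x - h ∈ Icc a b →
    |dt T 2 F (x + h) t - 2 * dt T 2 F x t + dt T 2 F (x - h) t| ≤ K * h ^ 2

section Bounds

variable {a b T ε C : ℝ} {n : ℕ} {v : ℝ → ℝ}

lemma abs_le_of_sobolevNorm (hab : a < b) (hC : 0 < C) (hv : ContinuousOn v (Icc a b))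
    (h : sobolevNorm a b n v < ENNReal.ofReal C) : ∀ x ∈ Icc a b, |v x| ≤ C := by
  obtain ⟨w, hw, hwC⟩ := exists_weakDeriv_of_sobolevNorm_le hC h (Nat.zero_le n)
  exact abs_le_of_hasWeakDeriv hab hv hw hwC hC.le

lemma abs_sub_le_of_sobolevNorm (hab : a < b) (hC : 0 < C) (hv : ContinuousOn v (Icc a b))
    (hn : 1 ≤ n) (h : sobolevNorm a b n v < ENNReal.ofReal C) :
    ∀ x ∈ Icc a b, ∀ y ∈ Icc a b, |v y - v x| ≤ C * |y - x| := by
  obtain ⟨w, hw, hwC⟩ := exists_weakDeriv_of_sobolevNorm_le hC h hn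
  exact abs_sub_le_of_hasWeakDeriv hab hv hw hwC hC.le

lemma abs_second_diff_le_of_sobolevNorm (hC : 0 < C)
    (hv : ContinuousOn v (Icc a b)) (hn : 2 ≤ n) (h : sobolevNorm a b n v < ENNReal.ofReal C) :
    ∀ x ∈ Ioo a b, ∀ h, 0 < h → x + h ∈ Icc a b → x - h ∈ Icc a b →
      |v (x + h) - 2 * v x + v (x - h)| ≤ 2 * C * h ^ 2 := by
  obtain ⟨w, hw, hwC⟩ := exists_weakDeriv_of_sobolevNorm_le hC h hn
  intro x hx h hh hp hm
  exact abs_second_diff_le_of_hasWeakDeriv hv hw hwC hC.le hx hh hp hm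

lemma abs_second_diff_sub_le_of_sobolevNorm {v₁ v₂ : ℝ → ℝ} (hC : 0 < C)
    (hv : HasTwoDerivs a b v v₁ v₂) (hn : 4 ≤ n)
    (h : sobolevNorm a b n v < ENNReal.ofReal C) :
    ∀ x ∈ Ioo a b, ∀ h, 0 < h → x + h ∈ Icc a b → x - h ∈ Icc a b →
      |(v (x + h) - 2 * v x + v (x - h)) / h ^ 2 - v₂ x| ≤ 2 * C * h ^ 2 := by
  obtain ⟨w, hw, hwC⟩ := exists_weakDeriv_of_sobolevNorm_le hC h hn
  intro x hx h hh hp hm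
  exact abs_second_diff_sub_le_of_hasWeakDeriv hv hw hwC hC.le hx hh hp hm

lemma lt_ofReal_div_of_mul_le (hε : 0 < ε) {s : ℝ≥0∞}
    (h : ENNReal.ofReal ε * s < ENNReal.ofReal C) : s < ENNReal.ofReal (C / ε) := by
  have e : ENNReal.ofReal C = ENNReal.ofReal ε * ENNReal.ofReal (C / ε) := by
    rw [← ENNReal.ofReal_mul hε.le]; congr 1; field_simp
  rw [e] at h
  exact lt_of_mul_lt_mul_left' h

/-- Conversion of the bounds on weak derivatives. Sobolev norms are infima, so the constant is enlarged
to have strict inequalities, for which the infimum provides representatives. -/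
theorem exists_uniformBounds {α β : ℝ} (hab : a < b) (hT : 0 < T) {E₀ E₁ : ℝ → ℝ}
    {G E F Et : ℝ → ℝ → ℝ → ℝ}
    (hEF : ∀ ε ∈ Ioc (0 : ℝ) 1, IsKGZSolution a b T ε E₀ E₁ (G ε) (E ε) (F ε))
    (hA : AssumptionA a b T α β E F Et) :
    ∃ K : ℝ, 0 ≤ K ∧ ∀ ε ∈ Ioc (0 : ℝ) 1, UniformBounds a b T ε K (E ε) (F ε) := by
  obtain ⟨C₀, hC₀⟩ := hA
  set C := |C₀| + 1 with hCdef
  have hC : 0 < C := by positivity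
  have hlt : C₀ < C := (le_abs_self _).trans_lt (lt_add_one _)
  refine ⟨2 * C, by positivity, fun ε hε => ?_⟩
  have hε0 := hε.1
  have hCε : 0 < C / ε := by positivity
  have hCε' : 0 < C * ε := by positivity
  have rE := (hEF ε hε).regular_E
  have rF := (hEF ε hε).regular_F
  have o1 : ENNReal.ofReal C₀ < ENNReal.ofReal C := (ENNReal.ofReal_lt_ofReal_iff hC).2 hlt
  have E4 : ∀ t ∈ Icc 0 T, sobolevNorm a b 4 (fun x => E ε x t) < ENNReal.ofReal C :=
    fun t ht => ((le_self_add.trans (le_self_add.trans le_self_add)).trans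
      (hC₀ ε hε t ht).1).trans_lt o1
  have E1 : ∀ t ∈ Icc 0 T, sobolevNorm a b 2 (fun x => dt T 1 (E ε) x t) < ENNReal.ofReal C :=
    fun t ht => ((le_add_self.trans (le_self_add.trans le_self_add)).trans
      (hC₀ ε hε t ht).1).trans_lt o1
  have E2 : ∀ t ∈ Icc 0 T, sobolevNorm a b 2 (fun x => dt T 2 (E ε) x t) < ENNReal.ofReal C :=
    fun t ht => ((le_add_self.trans le_self_add).trans (hC₀ ε hε t ht).1).trans_lt o1
  have E3 : ∀ t ∈ Icc 0 T,
      sobolevNorm a b 2 (fun x => dt T 3 (E ε) x t) < ENNReal.ofReal (C / ε) :=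
    fun t ht => lt_ofReal_div_of_mul_le hε0 ((le_add_self.trans (hC₀ ε hε t ht).1).trans_lt o1)
  have F4 : ∀ t ∈ Icc 0 T, sobolevNorm a b 4 (fun x => F ε x t) < ENNReal.ofReal (C * ε) :=
    fun t ht => (hC₀ ε hε t ht).2.2.2.1.trans_lt
      ((ENNReal.ofReal_lt_ofReal_iff hCε').2 (by gcongr))
  have F1 : ∀ t ∈ Icc 0 T, sobolevNorm a b 4 (fun x => dt T 1 (F ε) x t) < ENNReal.ofReal C :=
    fun t ht => ((le_self_add.trans le_self_add).trans (hC₀ ε hε t ht).2.2.2.2).trans_lt o1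
  have F2 : ∀ t ∈ Icc 0 T, sobolevNorm a b 2 (fun x => dt T 2 (F ε) x t) < ENNReal.ofReal C :=
    fun t ht => ((le_add_self.trans le_self_add).trans (hC₀ ε hε t ht).2.2.2.2).trans_lt o1
  have F3 : ∀ t ∈ Icc 0 T,
      sobolevNorm a b 2 (fun x => dt T 3 (F ε) x t) < ENNReal.ofReal (C / ε) :=
    fun t ht => lt_ofReal_div_of_mul_le hε0
      ((le_add_self.trans (hC₀ ε hε t ht).2.2.2.2).trans_lt o1)
  have cE : ∀ t ∈ Icc 0 T, ContinuousOn (fun x => E ε x t) (Icc a b) :=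
    fun t ht => continuousOn_space rE.isC2.continuousOn ht
  have cE1 : ∀ t ∈ Icc 0 T, ContinuousOn (fun x => dt T 1 (E ε) x t) (Icc a b) :=
    fun t ht => continuousOn_space (rE.isC2.contDiffOn_dt_one hab hT).continuousOn ht
  have cE2 : ∀ t ∈ Icc 0 T, ContinuousOn (fun x => dt T 2 (E ε) x t) (Icc a b) :=
    fun t ht => continuousOn_space (rE.isC2.continuousOn_dt_two hab hT) ht
  have cE3 : ∀ t ∈ Icc 0 T, ContinuousOn (fun x => dt T 3 (E ε) x t) (Icc a b) :=
    fun t ht => continuousOn_space rE.continuousOn_dt3 ht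
  have cF : ∀ t ∈ Icc 0 T, ContinuousOn (fun x => F ε x t) (Icc a b) :=
    fun t ht => continuousOn_space rF.isC2.continuousOn ht
  have cF1 : ∀ t ∈ Icc 0 T, ContinuousOn (fun x => dt T 1 (F ε) x t) (Icc a b) :=
    fun t ht => continuousOn_space (rF.isC2.contDiffOn_dt_one hab hT).continuousOn ht
  have cF2 : ∀ t ∈ Icc 0 T, ContinuousOn (fun x => dt T 2 (F ε) x t) (Icc a b) :=
    fun t ht => continuousOn_space (rF.isC2.continuousOn_dt_two hab hT) ht
  have cF3 : ∀ t ∈ Icc 0 T, ContinuousOn (fun x => dt T 3 (F ε) x t) (Icc a b) :=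
    fun t ht => continuousOn_space rF.continuousOn_dt3 ht
  have d1 : C ≤ 2 * C := by linarith
  have d2 : C / ε ≤ 2 * C / ε := by gcongr
  have d3 : C * ε ≤ 2 * C * ε := by gcongr
  exact
  { E_le := fun t ht x hx => (abs_le_of_sobolevNorm hab hC (cE t ht) (E4 t ht) x hx).trans d1
    E_lip := fun t ht x hx y hy =>
      (abs_sub_le_of_sobolevNorm hab hC (cE t ht) (by norm_num) (E4 t ht) x hx y hy).trans
        (by gcongr)
    E_dt_le := fun t ht x hx => (abs_le_of_sobolevNorm hab hC (cE1 t ht) (E1 t ht) x hx).trans d1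
    E_dtt_le := fun t ht x hx => (abs_le_of_sobolevNorm hab hC (cE2 t ht) (E2 t ht) x hx).trans d1
    E_dttt_le := fun t ht x hx =>
      (abs_le_of_sobolevNorm hab hCε (cE3 t ht) (E3 t ht) x hx).trans d2
    E_dtt_lip := fun t ht x hx y hy =>
      (abs_sub_le_of_sobolevNorm hab hC (cE2 t ht) (by norm_num) (E2 t ht) x hx y hy).trans
        (by gcongr)
    E_dttt_lip := fun t ht x hx y hy =>
      (abs_sub_le_of_sobolevNorm hab hCε (cE3 t ht) (by norm_num) (E3 t ht) x hx y hy).trans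
        (by gcongr)
    E_dxx := fun t ht => abs_second_diff_sub_le_of_sobolevNorm hC
      (rE.isC2.hasTwoDerivs_space hab hT ht) le_rfl (E4 t ht)
    E_dt_dxx := fun t ht => abs_second_diff_le_of_sobolevNorm hC (cE1 t ht) le_rfl (E1 t ht)
    E_dtt_dxx := fun t ht => abs_second_diff_le_of_sobolevNorm hC (cE2 t ht) le_rfl (E2 t ht)
    F_le := fun t ht x hx => (abs_le_of_sobolevNorm hab hCε' (cF t ht) (F4 t ht) x hx).trans d3
    F_dt_le := fun t ht x hx => (abs_le_of_sobolevNorm hab hC (cF1 t ht) (F1 t ht) x hx).trans d1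
    F_dtt_le := fun t ht x hx => (abs_le_of_sobolevNorm hab hC (cF2 t ht) (F2 t ht) x hx).trans d1
    F_dttt_le := fun t ht x hx =>
      (abs_le_of_sobolevNorm hab hCε (cF3 t ht) (F3 t ht) x hx).trans d2
    F_dxx := fun t ht x hx h hh hp hm =>
      (abs_second_diff_sub_le_of_sobolevNorm hCε' (rF.isC2.hasTwoDerivs_space hab hT ht) le_rfl
        (F4 t ht) x hx h hh hp hm).trans_eq (by ring)
    F_dtt_dxx := fun t ht => abs_second_diff_le_of_sobolevNorm hC (cF2 t ht) le_rfl (F2 t ht) }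

lemma UniformBounds.mono {K K' : ℝ} {E F : ℝ → ℝ → ℝ} (hε : 0 < ε) (hK : K ≤ K')
    (h : UniformBounds a b T ε K E F) : UniformBounds a b T ε K' E F where
  E_le t ht x hx := (h.E_le t ht x hx).trans hK
  E_lip t ht x hx y hy := (h.E_lip t ht x hx y hy).trans (by gcongr)
  E_dt_le t ht x hx := (h.E_dt_le t ht x hx).trans hK
  E_dtt_le t ht x hx := (h.E_dtt_le t ht x hx).trans hK
  E_dttt_le t ht x hx := (h.E_dttt_le t ht x hx).trans (by gcongr)
  E_dtt_lip t ht x hx y hy := (h.E_dtt_lip t ht x hx y hy).trans (by gcongr)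
  E_dttt_lip t ht x hx y hy := (h.E_dttt_lip t ht x hx y hy).trans (by gcongr)
  E_dxx t ht x hx k hk hp hm := (h.E_dxx t ht x hx k hk hp hm).trans (by gcongr)
  E_dt_dxx t ht x hx k hk hp hm := (h.E_dt_dxx t ht x hx k hk hp hm).trans (by gcongr)
  E_dtt_dxx t ht x hx k hk hp hm := (h.E_dtt_dxx t ht x hx k hk hp hm).trans (by gcongr)
  F_le t ht x hx := (h.F_le t ht x hx).trans (by gcongr)
  F_dt_le t ht x hx := (h.F_dt_le t ht x hx).trans hK
  F_dtt_le t ht x hx := (h.F_dtt_le t ht x hx).trans hK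
  F_dttt_le t ht x hx := (h.F_dttt_le t ht x hx).trans (by gcongr)
  F_dxx t ht x hx k hk hp hm := (h.F_dxx t ht x hx k hk hp hm).trans (by gcongr)
  F_dtt_dxx t ht x hx k hk hp hm := (h.F_dtt_dxx t ht x hx k hk hp hm).trans (by gcongr)

end Bounds

/-! ### Local truncation errors -/

section Truncation

/-- The weight `1 - |s|` is even, which pairs times symmetric about the centre. -/
lemma integral_weight_symm {f : ℝ → ℝ} (hf : ContinuousOn f (Icc (-1) 1)) :
    ∫ s in (-1 : ℝ)..1, (1 - |s|) * f s = ∫ s in (0 : ℝ)..1, (1 - s) * (f s + f (-s)) := by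
  have hi : ContinuousOn (fun s => (1 - |s|) * f s) (Icc (-1) 1) :=
    (by fun_prop : Continuous fun s : ℝ => 1 - |s|).continuousOn.mul hf
  have i1 : IntervalIntegrable (fun s => (1 - |s|) * f s) volume (-1) 0 := by
    apply (hi.mono _).intervalIntegrable
    rw [uIcc_of_le (by norm_num)]
    exact Icc_subset_Icc le_rfl zero_le_one
  have i2 : IntervalIntegrable (fun s => (1 - |s|) * f s) volume 0 1 := by
    apply (hi.mono _).intervalIntegrable
    rw [uIcc_of_le (by norm_num)]
    exact Icc_subset_Icc (by norm_num) le_rfl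
  have e1 : ∫ s in (-1 : ℝ)..0, (1 - |s|) * f s = ∫ s in (0 : ℝ)..1, (1 - s) * f (-s) := by
    have := intervalIntegral.integral_comp_neg (a := 0) (b := 1) (fun s => (1 - |s|) * f s)
    rw [neg_zero] at this
    rw [← this]
    refine intervalIntegral.integral_congr fun s hs => ?_
    rw [uIcc_of_le zero_le_one] at hs
    simp only [abs_neg, abs_of_nonneg hs.1]
  have e2 : ∫ s in (0 : ℝ)..1, (1 - |s|) * f s = ∫ s in (0 : ℝ)..1, (1 - s) * f s := by
    refine intervalIntegral.integral_congr fun s hs => ?_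
    rw [uIcc_of_le zero_le_one] at hs
    simp only [abs_of_nonneg hs.1]
  have c1 : ContinuousOn f (Icc 0 1) := hf.mono (Icc_subset_Icc (by norm_num) le_rfl)
  have c2 : ContinuousOn (fun s => f (-s)) (Icc 0 1) :=
    hf.comp (by fun_prop) fun s hs => ⟨by linarith [hs.2], by linarith [hs.1]⟩
  rw [← intervalIntegral.integral_add_adjacent_intervals i1 i2, e1, e2,
    ← intervalIntegral.integral_add (intervalIntegrable_weight c2) (intervalIntegrable_weight c1)]
  refine intervalIntegral.integral_congr fun s _ => ?_
  ring

lemma abs_mul_le {x y A B : ℝ} (hx : |x| ≤ A) (hy : |y| ≤ B) : |x * y| ≤ A * B := by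
  rw [abs_mul]
  exact mul_le_mul hx hy (abs_nonneg _) ((abs_nonneg _).trans hx)

/-- Expansion of the right-hand side of the Klein-Gordon equation at two times symmetric about a
time level: all terms of first order in `τ` cancel, except for the product of the time derivative
of `E` with the increment of the potential. -/
lemma abs_symmetric_sum_le {K h τ γ yp ym y₀ ya y₁ r Fp Fm F₀ Gp Gm zp zm za xp xm : ℝ}
    (hK : 1 ≤ K) (hτ : 0 ≤ τ) (hτ1 : τ ≤ 1) (hγ : 0 ≤ γ)
    (hxp : |xp - zp| ≤ K * h ^ 2) (hxm : |xm - zm| ≤ K * h ^ 2)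
    (hz : |zp + zm - 2 * za| ≤ 4 * K * τ ^ 2)
    (hyp : |yp - y₀| ≤ K * τ) (hym : |ym - y₀| ≤ K * τ)
    (hy2 : |yp - 2 * y₀ + ym| ≤ 2 * K * τ ^ 2) (hya : |ya - y₀| ≤ K * τ ^ 2) (hy₀ : |y₀| ≤ K)
    (hFp : |Fp - F₀| ≤ K * τ) (hFm : |Fm - F₀| ≤ K * τ)
    (hF2 : |Fp - 2 * F₀ + Fm| ≤ 2 * K * τ ^ 2) (hF₀ : |F₀| ≤ K)
    (hy₁ : |y₁| ≤ K) (hr : |r| ≤ τ)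
    (hyp' : |yp - y₀ - r * y₁| ≤ K * τ ^ 2) (hym' : |ym - y₀ + r * y₁| ≤ K * τ ^ 2)
    (hGp : |Gp| ≤ K) (hGm : |Gm| ≤ K) (hG : |Gp - Gm| ≤ γ) :
    |(xp - (1 - yp ^ 2 + Fp + Gp) * yp) + (xm - (1 - ym ^ 2 + Fm + Gm) * ym)
      + (Gp + Gm) * ya - 2 * (za + (-1 + y₀ ^ 2 - F₀) * ya)|
        ≤ 40 * K ^ 3 * (h ^ 2 + τ ^ 2 + τ * γ) := by
  have hK0 : 0 ≤ K := by linarith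
  have K2 : K ≤ K ^ 3 := le_self_pow₀ hK (by norm_num)
  have K3 : K ^ 2 ≤ K ^ 3 := pow_le_pow_right₀ hK (by norm_num)
  have hKτ : 0 ≤ K * τ := by positivity
  -- the cubic term
  have c1 : |3 * y₀ ^ 2 * (yp - 2 * y₀ + ym)| ≤ 3 * K ^ 2 * (2 * K * τ ^ 2) := by
    refine abs_mul_le ?_ hy2
    rw [abs_mul, abs_pow, abs_of_pos (by norm_num : (0 : ℝ) < 3)]
    gcongr
  have c2 : |3 * y₀ * ((yp - y₀) ^ 2 + (ym - y₀) ^ 2)| ≤ 3 * K * ((K * τ) ^ 2 + (K * τ) ^ 2) := by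
    refine abs_mul_le ?_ ?_
    · rw [abs_mul, abs_of_pos (by norm_num : (0 : ℝ) < 3)]; gcongr
    · refine (abs_add_le _ _).trans ?_
      rw [abs_pow, abs_pow]; gcongr
  have c3 : |(yp - y₀) ^ 3 + (ym - y₀) ^ 3| ≤ (K * τ) ^ 3 + (K * τ) ^ 3 := by
    refine (abs_add_le _ _).trans ?_
    rw [abs_pow, abs_pow]; gcongr
  have c4 : |2 * y₀ ^ 2 * (ya - y₀)| ≤ 2 * K ^ 2 * (K * τ ^ 2) := by
    refine abs_mul_le ?_ hya
    rw [abs_mul, abs_pow, abs_of_pos (by norm_num : (0 : ℝ) < 2)]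
    gcongr
  have c3' : (K * τ) ^ 3 ≤ K ^ 3 * τ ^ 2 := by
    rw [mul_pow]; gcongr ?_ * ?_
    exact pow_le_pow_of_le_one hτ hτ1 (by norm_num)
  -- the product of the density and the field
  have f1 : |F₀ * (yp - 2 * y₀ + ym)| ≤ K * (2 * K * τ ^ 2) := abs_mul_le hF₀ hy2
  have f2 : |y₀ * (Fp - 2 * F₀ + Fm)| ≤ K * (2 * K * τ ^ 2) := abs_mul_le hy₀ hF2
  have f3 : |(Fp - F₀) * (yp - y₀)| ≤ K * τ * (K * τ) := abs_mul_le hFp hyp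
  have f4 : |(Fm - F₀) * (ym - y₀)| ≤ K * τ * (K * τ) := abs_mul_le hFm hym
  have f5 : |F₀ * (ya - y₀)| ≤ K * (K * τ ^ 2) := abs_mul_le hF₀ hya
  -- the potential
  have g1 : |r * y₁ * (Gp - Gm)| ≤ τ * K * γ := abs_mul_le (abs_mul_le hr hy₁) hG
  have g2 : |Gp * (yp - y₀ - r * y₁)| ≤ K * (K * τ ^ 2) := abs_mul_le hGp hyp'
  have g3 : |Gm * (ym - y₀ + r * y₁)| ≤ K * (K * τ ^ 2) := abs_mul_le hGm hym'
  have g4 : |Gp * (ya - y₀)| ≤ K * (K * τ ^ 2) := abs_mul_le hGp hya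
  have g5 : |Gm * (ya - y₀)| ≤ K * (K * τ ^ 2) := abs_mul_le hGm hya
  have e : (xp - (1 - yp ^ 2 + Fp + Gp) * yp) + (xm - (1 - ym ^ 2 + Fm + Gm) * ym)
      + (Gp + Gm) * ya - 2 * (za + (-1 + y₀ ^ 2 - F₀) * ya)
      = (xp - zp) + (xm - zm) + (zp + zm - 2 * za) - (yp - 2 * y₀ + ym) + 2 * (ya - y₀)
        + 3 * y₀ ^ 2 * (yp - 2 * y₀ + ym) + 3 * y₀ * ((yp - y₀) ^ 2 + (ym - y₀) ^ 2)
        + ((yp - y₀) ^ 3 + (ym - y₀) ^ 3) - 2 * y₀ ^ 2 * (ya - y₀)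
        - F₀ * (yp - 2 * y₀ + ym) - y₀ * (Fp - 2 * F₀ + Fm) - (Fp - F₀) * (yp - y₀)
        - (Fm - F₀) * (ym - y₀) + 2 * (F₀ * (ya - y₀))
        - r * y₁ * (Gp - Gm) - Gp * (yp - y₀ - r * y₁) - Gm * (ym - y₀ + r * y₁)
        + Gp * (ya - y₀) + Gm * (ya - y₀) := by ring
  have q1 : K * h ^ 2 ≤ K ^ 3 * h ^ 2 := by gcongr
  have q2 : K * τ ^ 2 ≤ K ^ 3 * τ ^ 2 := by gcongr
  have q3 : K ^ 2 * τ ^ 2 ≤ K ^ 3 * τ ^ 2 := by gcongr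
  have q4 : K * (τ * γ) ≤ K ^ 3 * (τ * γ) := by gcongr
  have q5 : 0 ≤ K ^ 3 * h ^ 2 := by positivity
  have q6 : 0 ≤ K ^ 3 * (τ * γ) := by positivity
  rw [e]
  generalize 3 * y₀ ^ 2 * (yp - 2 * y₀ + ym) = p1 at *
  generalize 3 * y₀ * ((yp - y₀) ^ 2 + (ym - y₀) ^ 2) = p2 at *
  generalize (yp - y₀) ^ 3 + (ym - y₀) ^ 3 = p3 at *
  generalize 2 * y₀ ^ 2 * (ya - y₀) = p4 at *
  generalize F₀ * (yp - 2 * y₀ + ym) = p5 at *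
  generalize y₀ * (Fp - 2 * F₀ + Fm) = p6 at *
  generalize (Fp - F₀) * (yp - y₀) = p7 at *
  generalize (Fm - F₀) * (ym - y₀) = p8 at *
  generalize F₀ * (ya - y₀) = p9 at *
  generalize r * y₁ * (Gp - Gm) = p10 at *
  generalize Gp * (yp - y₀ - r * y₁) = p11 at *
  generalize Gm * (ym - y₀ + r * y₁) = p12 at *
  generalize Gp * (ya - y₀) = p13 at *
  generalize Gm * (ya - y₀) = p14 at *
  generalize yp - 2 * y₀ + ym = p15 at *
  generalize ya - y₀ = p16 at *
  generalize xp - zp = p17 at *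
  generalize xm - zm = p18 at *
  generalize zp + zm - 2 * za = p19 at *
  rw [abs_le] at hxp hxm hz hy2 hya c1 c2 c3 c4 f1 f2 f3 f4 f5 g1 g2 g3 g4 g5 ⊢
  constructor <;> linarith only [hxp, hxm, hz, hy2, hya, c1, c2, c3, c4, f1, f2, f3, f4, f5, g1, g2,
    g3, g4, g5, c3', q1, q2, q3, q4, q5, q6]

variable {a b T ε K h τ t x γ : ℝ} {E₀ E₁ : ℝ → ℝ} {G E F u : ℝ → ℝ → ℝ}

/-- The second difference quotient in space commutes with the time derivatives. -/
lemma IsC2.hasTwoDerivs_second_diff (hab : a < b) (hT : 0 < T) (hu : IsC2 a b T u)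
    (hx : x ∈ Ioo a b) (hp : x + h ∈ Icc a b) (hm : x - h ∈ Icc a b) :
    HasTwoDerivs 0 T (fun s => (u (x + h) s - 2 * u x s + u (x - h) s) / h ^ 2)
      (fun s => (dt T 1 u (x + h) s - 2 * dt T 1 u x s + dt T 1 u (x - h) s) / h ^ 2)
      (fun s => (dt T 2 u (x + h) s - 2 * dt T 2 u x s + dt T 2 u (x - h) s) / h ^ 2) := by
  have := (((hu.hasTwoDerivs_time hab hT hp).add
    ((hu.hasTwoDerivs_time hab hT (Ioo_subset_Icc_self hx)).const_mul (-2))).add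
      (hu.hasTwoDerivs_time hab hT hm)).const_mul (1 / h ^ 2)
  convert this using 2 <;> ring

/-- By continuity the equation holds up to the initial and the final time. -/
lemma IsKGZSolution.eqn_E_Icc (hab : a < b) (hT : 0 < T)
    (hs : IsKGZSolution a b T ε E₀ E₁ G E F) (hG : IsC2 a b T G) (hx : x ∈ Ioo a b)
    (ht : t ∈ Icc 0 T) :
    dt T 2 E x t = dx a b 2 E x t - (1 - E x t ^ 2 + F x t + G x t) * E x t := by
  have hxI := Ioo_subset_Icc_self hx
  have cE := continuousOn_time hs.regular_E.isC2.continuousOn hxI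
  have cF := continuousOn_time hs.regular_F.isC2.continuousOn hxI
  have cG := continuousOn_time hG.continuousOn hxI
  have h1 : EqOn (fun t => dt T 2 E x t)
      (fun t => dx a b 2 E x t - (1 - E x t ^ 2 + F x t + G x t) * E x t) (Icc 0 T) := by
    refine EqOn.of_subset_closure (s := Ioo 0 T) (fun s hs' => ?_)
      (continuousOn_time (hs.regular_E.isC2.continuousOn_dt_two hab hT) hxI)
      ((continuousOn_time (hs.regular_E.isC2.continuousOn_dx_two hab hT) hxI).sub
        ((((continuousOn_const.sub (cE.pow 2)).add cF).add cG).mul cE)) Ioo_subset_Icc_self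
      (by rw [closure_Ioo hT.ne])
    have := hs.eqn_E x hx s hs'
    linarith
  exact h1 ht

lemma HasTwoDerivs.iteratedDerivWithin_two {c d : ℝ} {y y₁ y₂ : ℝ → ℝ} (hcd : c < d)
    (hy : HasTwoDerivs c d y y₁ y₂) (ht : t ∈ Icc c d) :
    iteratedDerivWithin 2 y (Icc c d) t = y₂ t := by
  have hU := uniqueDiffOn_Icc hcd
  rw [iteratedDerivWithin_succ (n := 1)]
  have h1 : EqOn (iteratedDerivWithin 1 y (Icc c d)) y₁ (Icc c d) := fun s hs => by
    rw [iteratedDerivWithin_one]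
    exact (hy.deriv₁ s hs).derivWithin (hU s hs)
  rw [derivWithin_congr h1 (h1 ht)]
  exact (hy.deriv₂ t ht).derivWithin (hU t ht)

lemma HasTwoDerivs.sq {c d : ℝ} {y y₁ y₂ : ℝ → ℝ} (hy : HasTwoDerivs c d y y₁ y₂) :
    HasTwoDerivs c d (fun s => y s ^ 2) (fun s => 2 * y s * y₁ s)
      (fun s => 2 * y₁ s ^ 2 + 2 * y s * y₂ s) where
  deriv₁ t ht := by
    refine ((hy.deriv₁ t ht).pow 2).congr_deriv ?_
    simp
  deriv₂ t ht := by
    refine (((hy.deriv₁ t ht).const_mul 2).mul (hy.deriv₂ t ht)).congr_deriv ?_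
    ring
  cont := ((hy.continuousOn₁.pow 2).const_mul 2 |>.congr fun _ _ => rfl).add
    ((hy.continuousOn.const_mul 2).mul hy.cont)

lemma IsRegular.hasTwoDerivs_sq (hab : a < b) (hT : 0 < T) (hu : IsRegular a b T u)
    (hx : x ∈ Icc a b) :
    HasTwoDerivs 0 T (fun s => u x s ^ 2) (fun s => 2 * u x s * dt T 1 u x s)
      (fun s => 2 * dt T 1 u x s ^ 2 + 2 * u x s * dt T 2 u x s) :=
  (hu.isC2.hasTwoDerivs_time hab hT hx).sq

lemma dt_two_sq (hab : a < b) (hT : 0 < T) (hu : IsRegular a b T u)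
    (hx : x ∈ Icc a b) (ht : t ∈ Icc 0 T) :
    dt T 2 (fun y s => |u y s| ^ 2) x t = 2 * dt T 1 u x t ^ 2 + 2 * u x t * dt T 2 u x t := by
  unfold dt
  simp only [sq_abs]
  exact (hu.hasTwoDerivs_sq hab hT hx).iteratedDerivWithin_two hT ht

/-- By continuity the equation holds up to the initial and the final time. -/
lemma IsKGZSolution.eqn_F_Icc (hab : a < b) (hT : 0 < T)
    (hs : IsKGZSolution a b T ε E₀ E₁ G E F) (hx : x ∈ Ioo a b) (ht : t ∈ Icc 0 T) :
    dt T 2 F x t = 1 / ε ^ 2 * dx a b 2 F x t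
      + (2 * dt T 1 E x t ^ 2 + 2 * E x t * dt T 2 E x t) := by
  have hxI := Ioo_subset_Icc_self hx
  have h1 : EqOn (fun t => dt T 2 F x t) (fun t => 1 / ε ^ 2 * dx a b 2 F x t
      + (2 * dt T 1 E x t ^ 2 + 2 * E x t * dt T 2 E x t)) (Icc 0 T) := by
    refine EqOn.of_subset_closure (s := Ioo 0 T) (fun s hs' => ?_)
      (continuousOn_time (hs.regular_F.isC2.continuousOn_dt_two hab hT) hxI)
      (((continuousOn_time (hs.regular_F.isC2.continuousOn_dx_two hab hT) hxI).const_mul _).add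
        (hs.regular_E.hasTwoDerivs_sq hab hT hxI).cont) Ioo_subset_Icc_self
      (by rw [closure_Ioo hT.ne])
    have := hs.eqn_F x hx s hs'
    rw [dt_two_sq hab hT hs.regular_E hxI (Ioo_subset_Icc_self hs')] at this
    linarith
  exact h1 ht

lemma mem_Icc_of_symm (hτ : 0 ≤ τ) (hp : t + τ ≤ T) (hm : 0 ≤ t - τ) :
    t ∈ Icc 0 T ∧ t + τ ∈ Icc 0 T ∧ t - τ ∈ Icc 0 T ∧
      ∀ s ∈ Icc (0 : ℝ) 1, t + s * τ ∈ Icc 0 T ∧ t - s * τ ∈ Icc 0 T ∧ 0 ≤ s * τ ∧ s * τ ≤ τ := by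
  refine ⟨⟨by linarith, by linarith⟩, ⟨by linarith, hp⟩, ⟨hm, by linarith⟩, fun s hs => ?_⟩
  have h1 : 0 ≤ s * τ := mul_nonneg hs.1 hτ
  have h2 : s * τ ≤ τ := mul_le_of_le_one_left hτ hs.2
  exact ⟨⟨by linarith, by linarith⟩, ⟨by linarith, by linarith⟩, h1, h2⟩

lemma continuousOn_symm {f : ℝ → ℝ} (hf : ContinuousOn f (Icc 0 T)) (hτ : 0 ≤ τ)
    (hp : t + τ ≤ T) (hm : 0 ≤ t - τ) :
    ContinuousOn (fun s => f (t + s * τ) + f (t - s * τ)) (Icc 0 1) := by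
  obtain ⟨-, -, -, h4⟩ := mem_Icc_of_symm hτ hp hm
  exact (hf.comp (by fun_prop) fun s hs => (h4 s hs).1).add
    (hf.comp (by fun_prop) fun s hs => (h4 s hs).2.1)

/-- For a function with bounded second derivative, the sum of the values at `t ± s τ` agrees with
the sum of the values at `t ± τ` up to `O(τ²)`. -/
lemma HasTwoDerivs.abs_symm_sub_avg_le {y y₁ y₂ : ℝ → ℝ} (hy : HasTwoDerivs 0 T y y₁ y₂)
    (hτ : 0 ≤ τ) (hp : t + τ ≤ T) (hm : 0 ≤ t - τ) (hK : ∀ s ∈ Icc 0 T, |y₂ s| ≤ K) {s : ℝ}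
    (hs : s ∈ Icc (0 : ℝ) 1) :
    |y (t + s * τ) + y (t - s * τ) - 2 * ((y (t + τ) + y (t - τ)) / 2)| ≤ 4 * K * τ ^ 2 := by
  obtain ⟨h1, h2, h3, h4⟩ := mem_Icc_of_symm hτ hp hm
  obtain ⟨s1, s2, s3, s4⟩ := h4 s hs
  have hK0 : 0 ≤ K := (abs_nonneg _).trans (hK t h1)
  have d1 := hy.abs_second_diff_le h1 h2 h3 hK
  have d2 := hy.abs_second_diff_le h1 s1 s2 hK
  have d3 : 2 * K * (s * τ) ^ 2 ≤ 2 * K * τ ^ 2 := by gcongr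
  rw [abs_le] at *
  constructor <;> linarith

/-- Truncation error of the equation for `E`. Both `δ_t² E` and the averaged potential are integrals
with the weight `1 - s` over times symmetric about `t`, so the residual is the weighted integral of
the quantity bounded in `abs_symmetric_sum_le`, after insertion of the equation for `∂_tt E`. -/
lemma abs_residual_E_le (hab : a < b) (hT : 0 < T) (hK : 1 ≤ K) (hε1 : ε ≤ 1)
    (hs : IsKGZSolution a b T ε E₀ E₁ G E F) (hG : IsC2 a b T G)
    (hb : UniformBounds a b T ε K E F) (hx : x ∈ Ioo a b) (hh : 0 < h)
    (hp : x + h ∈ Icc a b) (hm : x - h ∈ Icc a b) (hτ : 0 < τ) (hτ1 : τ ≤ 1)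
    (htp : t + τ ≤ T) (htm : 0 ≤ t - τ) (hGK : ∀ s ∈ Icc 0 T, |G x s| ≤ K) (hγ : 0 ≤ γ)
    (hGγ : ∀ s ∈ Icc (0 : ℝ) 1, |G x (t + s * τ) - G x (t - s * τ)| ≤ γ) :
    |(E x (t + τ) - 2 * E x t + E x (t - τ)) / τ ^ 2
      - (((E (x + h) (t + τ) - 2 * E x (t + τ) + E (x - h) (t + τ)) / h ^ 2
          + (E (x + h) (t - τ) - 2 * E x (t - τ) + E (x - h) (t - τ)) / h ^ 2) / 2
        + (-1 + E x t ^ 2 - F x t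
            - ∫ s in (0 : ℝ)..1, (1 - s) * (G x (t + s * τ) + G x (t - s * τ)))
          * ((E x (t + τ) + E x (t - τ)) / 2))|
      ≤ 40 * K ^ 3 * (h ^ 2 + τ ^ 2 + τ * γ) := by
  have hxI := Ioo_subset_Icc_self hx
  obtain ⟨h1, h2, h3, h4⟩ := mem_Icc_of_symm hτ.le htp htm
  have yE := hs.regular_E.isC2.hasTwoDerivs_time hab hT hxI
  have yF := hs.regular_F.isC2.hasTwoDerivs_time hab hT hxI
  have yz := hs.regular_E.isC2.hasTwoDerivs_second_diff hab hT hx hp hm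
  have hz2 : ∀ s ∈ Icc 0 T,
      |(dt T 2 E (x + h) s - 2 * dt T 2 E x s + dt T 2 E (x - h) s) / h ^ 2| ≤ K := by
    intro s hs'
    rw [abs_div, abs_of_pos (by positivity : 0 < h ^ 2), div_le_iff₀ (by positivity)]
    exact hb.E_dtt_dxx s hs' x hx h hh hp hm
  have cG := continuousOn_time hG.continuousOn hxI
  set ya := (E x (t + τ) + E x (t - τ)) / 2 with hya
  set za := ((E (x + h) (t + τ) - 2 * E x (t + τ) + E (x - h) (t + τ)) / h ^ 2
          + (E (x + h) (t - τ) - 2 * E x (t - τ) + E (x - h) (t - τ)) / h ^ 2) / 2 with hza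
  set c := 2 * (za + (-1 + E x t ^ 2 - F x t) * ya) with hc
  have e1 : (E x (t + τ) - 2 * E x t + E x (t - τ)) / τ ^ 2
      = ∫ s in (0 : ℝ)..1, (1 - s) * (dt T 2 E x (t + s * τ) + dt T 2 E x (t - s * τ)) := by
    rw [yE.second_diff h1 h2 h3, mul_div_cancel_left₀ _ (by positivity : τ ^ 2 ≠ 0)]
  have i1 := intervalIntegrable_weight (continuousOn_symm yE.cont hτ.le htp htm)
  have i2 := intervalIntegrable_weight (continuousOn_symm cG hτ.le htp htm)
  have e2 : (E x (t + τ) - 2 * E x t + E x (t - τ)) / τ ^ 2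
      - (za + (-1 + E x t ^ 2 - F x t
            - ∫ s in (0 : ℝ)..1, (1 - s) * (G x (t + s * τ) + G x (t - s * τ))) * ya)
      = ∫ s in (0 : ℝ)..1, (1 - s) * (dt T 2 E x (t + s * τ) + dt T 2 E x (t - s * τ)
          + (G x (t + s * τ) + G x (t - s * τ)) * ya - c) := by
    have e3 : ∀ s, (1 - s) * (dt T 2 E x (t + s * τ) + dt T 2 E x (t - s * τ)
          + (G x (t + s * τ) + G x (t - s * τ)) * ya - c)
        = (1 - s) * (dt T 2 E x (t + s * τ) + dt T 2 E x (t - s * τ))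
          + ya * ((1 - s) * (G x (t + s * τ) + G x (t - s * τ))) - (1 - s) * c :=
      fun s => by ring
    simp only [e3]
    rw [intervalIntegral.integral_sub (i1.add (i2.const_mul ya))
      (intervalIntegrable_weight continuousOn_const),
      intervalIntegral.integral_add i1 (i2.const_mul ya), intervalIntegral.integral_const_mul,
      integral_weight_const, e1, hc]
    ring
  rw [e2]
  refine abs_integral_weight_le fun s hs' => ?_
  obtain ⟨s1, s2, s3, s4⟩ := h4 s hs'
  rw [hs.eqn_E_Icc hab hT hG hx s1, hs.eqn_E_Icc hab hT hG hx s2]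
  have sq : (s * τ) ^ 2 ≤ τ ^ 2 := by gcongr
  have sm : t + -(s * τ) ∈ Icc 0 T := by rw [← sub_eq_add_neg]; exact s2
  have hK0 : 0 ≤ K := by linarith
  have lipE : ∀ r ∈ Icc 0 T, |r - t| ≤ τ → |E x r - E x t| ≤ K * τ := fun r hr hrt =>
    (abs_sub_le_of_hasDerivWithinAt yE.deriv₁ (fun q hq => hb.E_dt_le q hq x hxI) h1 hr).trans
      (by gcongr)
  have lipF : ∀ r ∈ Icc 0 T, |r - t| ≤ τ → |F x r - F x t| ≤ K * τ := fun r hr hrt =>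
    (abs_sub_le_of_hasDerivWithinAt yF.deriv₁ (fun q hq => hb.F_dt_le q hq x hxI) h1 hr).trans
      (by gcongr)
  have ap : |t + s * τ - t| ≤ τ := by rw [add_sub_cancel_left, abs_of_nonneg s3]; exact s4
  have am : |t - s * τ - t| ≤ τ := by
    rw [sub_sub_cancel_left, abs_neg, abs_of_nonneg s3]; exact s4
  have bE2 := fun q hq => hb.E_dtt_le q hq x hxI
  have bF2 := fun q hq => hb.F_dtt_le q hq x hxI
  refine abs_symmetric_sum_le (y₁ := dt T 1 E x t) (r := s * τ) hK hτ.le hτ1 hγ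
    ?_ ?_ (yz.abs_symm_sub_avg_le hτ.le htp htm hz2 hs') (lipE _ s1 ap) (lipE _ s2 am)
    ((yE.abs_second_diff_le h1 s1 s2 bE2).trans (by gcongr)) ?_ (hb.E_le t h1 x hxI)
    (lipF _ s1 ap) (lipF _ s2 am) ((yF.abs_second_diff_le h1 s1 s2 bF2).trans (by gcongr))
    ((hb.F_le t h1 x hxI).trans (mul_le_of_le_one_right hK0 hε1)) (hb.E_dt_le t h1 x hxI)
    (by rw [abs_of_nonneg s3]; exact s4)
    ((yE.abs_sub_sub_le h1 s1 bE2).trans (by gcongr)) ?_ (hGK _ s1) (hGK _ s2) (hGγ s hs')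
  · rw [abs_sub_comm]; exact hb.E_dxx _ s1 x hx h hh hp hm
  · rw [abs_sub_comm]; exact hb.E_dxx _ s2 x hx h hh hp hm
  · have := yE.abs_second_diff_le h1 h2 h3 bE2
    rw [hya]
    rw [abs_le] at *
    constructor <;> linarith
  · have := yE.abs_sub_sub_le h1 sm bE2
    rw [neg_sq, ← sub_eq_add_neg, neg_mul, sub_neg_eq_add] at this
    exact this.trans (by gcongr)

/-- Truncation error of the equation for `F`. After insertion of the equation for `∂_tt F` the terms
with `E²` cancel and only `ε⁻²` times the difference between `∂_xx F` and the averaged difference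
quotient `δ_x² F` remains. It is of size `ε h² + τ²`, the first part because all derivatives of `F` in
space are of size `ε`. -/
lemma abs_residual_F_le (hab : a < b) (hT : 0 < T) (hε : 0 < ε) (hK : 0 ≤ K)
    (hs : IsKGZSolution a b T ε E₀ E₁ G E F)
    (hb : UniformBounds a b T ε K E F) (hx : x ∈ Ioo a b) (hh : 0 < h)
    (hp : x + h ∈ Icc a b) (hm : x - h ∈ Icc a b) (hτ : 0 < τ)
    (htp : t + τ ≤ T) (htm : 0 ≤ t - τ) :
    ε * |(F x (t + τ) - 2 * F x t + F x (t - τ)) / τ ^ 2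
      - (1 / (2 * ε ^ 2) * ((F (x + h) (t + τ) - 2 * F x (t + τ) + F (x - h) (t + τ)) / h ^ 2
          + (F (x + h) (t - τ) - 2 * F x (t - τ) + F (x - h) (t - τ)) / h ^ 2)
        + (E x (t + τ) ^ 2 - 2 * E x t ^ 2 + E x (t - τ) ^ 2) / τ ^ 2)|
      ≤ 4 * K * (h ^ 2 + τ ^ 2 / ε) := by
  have hxI := Ioo_subset_Icc_self hx
  obtain ⟨h1, h2, h3, h4⟩ := mem_Icc_of_symm hτ.le htp htm
  have yF := hs.regular_F.isC2.hasTwoDerivs_time hab hT hxI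
  have ysq := hs.regular_E.hasTwoDerivs_sq hab hT hxI
  have yz := hs.regular_F.isC2.hasTwoDerivs_second_diff hab hT hx hp hm
  have hz2 : ∀ s ∈ Icc 0 T,
      |(dt T 2 F (x + h) s - 2 * dt T 2 F x s + dt T 2 F (x - h) s) / h ^ 2| ≤ K := by
    intro s hs'
    rw [abs_div, abs_of_pos (by positivity : 0 < h ^ 2), div_le_iff₀ (by positivity)]
    exact hb.F_dtt_dxx s hs' x hx h hh hp hm
  set za := ((F (x + h) (t + τ) - 2 * F x (t + τ) + F (x - h) (t + τ)) / h ^ 2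
          + (F (x + h) (t - τ) - 2 * F x (t - τ) + F (x - h) (t - τ)) / h ^ 2) / 2 with hza
  have cx := continuousOn_time (hs.regular_F.isC2.continuousOn_dx_two hab hT) hxI
  have i1 := intervalIntegrable_weight (continuousOn_symm yF.cont hτ.le htp htm)
  have i2 := intervalIntegrable_weight (continuousOn_symm ysq.cont hτ.le htp htm)
  have i3 := intervalIntegrable_weight (continuousOn_symm cx hτ.le htp htm)
  have e1 : (F x (t + τ) - 2 * F x t + F x (t - τ)) / τ ^ 2
      = ∫ s in (0 : ℝ)..1, (1 - s) * (dt T 2 F x (t + s * τ) + dt T 2 F x (t - s * τ)) := by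
    rw [yF.second_diff h1 h2 h3, mul_div_cancel_left₀ _ (by positivity : τ ^ 2 ≠ 0)]
  have e2 : (E x (t + τ) ^ 2 - 2 * E x t ^ 2 + E x (t - τ) ^ 2) / τ ^ 2
      = ∫ s in (0 : ℝ)..1, (1 - s) *
        ((2 * dt T 1 E x (t + s * τ) ^ 2 + 2 * E x (t + s * τ) * dt T 2 E x (t + s * τ))
        + (2 * dt T 1 E x (t - s * τ) ^ 2 + 2 * E x (t - s * τ) * dt T 2 E x (t - s * τ))) := by
    rw [ysq.second_diff h1 h2 h3, mul_div_cancel_left₀ _ (by positivity : τ ^ 2 ≠ 0)]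
  have e3 : (F x (t + τ) - 2 * F x t + F x (t - τ)) / τ ^ 2
      - (1 / (2 * ε ^ 2) * ((F (x + h) (t + τ) - 2 * F x (t + τ) + F (x - h) (t + τ)) / h ^ 2
          + (F (x + h) (t - τ) - 2 * F x (t - τ) + F (x - h) (t - τ)) / h ^ 2)
        + (E x (t + τ) ^ 2 - 2 * E x t ^ 2 + E x (t - τ) ^ 2) / τ ^ 2)
      = 1 / ε ^ 2 * ∫ s in (0 : ℝ)..1, (1 - s) *
          (dx a b 2 F x (t + s * τ) + dx a b 2 F x (t - s * τ) - 2 * za) := by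
    have e4 : ∫ s in (0 : ℝ)..1, (1 - s) *
          (dx a b 2 F x (t + s * τ) + dx a b 2 F x (t - s * τ) - 2 * za)
        = (∫ s in (0 : ℝ)..1, (1 - s) *
          (dx a b 2 F x (t + s * τ) + dx a b 2 F x (t - s * τ))) - za := by
      have : ∀ s, (1 - s) * (dx a b 2 F x (t + s * τ) + dx a b 2 F x (t - s * τ) - 2 * za)
          = (1 - s) * (dx a b 2 F x (t + s * τ) + dx a b 2 F x (t - s * τ))
            - (1 - s) * (2 * za) := fun s => by ring
      simp only [this]
      rw [intervalIntegral.integral_sub i3 (intervalIntegrable_weight continuousOn_const),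
        integral_weight_const]
      ring
    have e5 : (∫ s in (0 : ℝ)..1, (1 - s) * (dt T 2 F x (t + s * τ) + dt T 2 F x (t - s * τ)))
        - (∫ s in (0 : ℝ)..1, (1 - s) *
        ((2 * dt T 1 E x (t + s * τ) ^ 2 + 2 * E x (t + s * τ) * dt T 2 E x (t + s * τ))
        + (2 * dt T 1 E x (t - s * τ) ^ 2 + 2 * E x (t - s * τ) * dt T 2 E x (t - s * τ))))
        = 1 / ε ^ 2 * ∫ s in (0 : ℝ)..1, (1 - s) *
          (dx a b 2 F x (t + s * τ) + dx a b 2 F x (t - s * τ)) := by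
      rw [← intervalIntegral.integral_sub i1 i2, ← intervalIntegral.integral_const_mul]
      refine intervalIntegral.integral_congr fun s hs' => ?_
      rw [uIcc_of_le zero_le_one] at hs'
      obtain ⟨s1, s2, -, -⟩ := h4 s hs'
      rw [hs.eqn_F_Icc hab hT hx s1, hs.eqn_F_Icc hab hT hx s2]
      ring
    rw [e4, mul_sub, ← e5, ← e1, ← e2, hza]
    field_simp
    ring
  have e6 : |∫ s in (0 : ℝ)..1, (1 - s) *
      (dx a b 2 F x (t + s * τ) + dx a b 2 F x (t - s * τ) - 2 * za)|
        ≤ 2 * K * ε * h ^ 2 + 4 * K * τ ^ 2 := by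
    refine abs_integral_weight_le fun s hs' => ?_
    obtain ⟨s1, s2, s3, s4⟩ := h4 s hs'
    have b1 := hb.F_dxx _ s1 x hx h hh hp hm
    have b2 := hb.F_dxx _ s2 x hx h hh hp hm
    have b3 := yz.abs_symm_sub_avg_le hτ.le htp htm hz2 hs'
    rw [← hza] at b3
    rw [abs_le] at *
    constructor <;> linarith
  rw [e3, abs_mul, abs_of_pos (by positivity : 0 < 1 / ε ^ 2)]
  calc _ ≤ ε * (1 / ε ^ 2 * (2 * K * ε * h ^ 2 + 4 * K * τ ^ 2)) := by gcongr
    _ = 2 * K * h ^ 2 + 4 * K * (τ ^ 2 / ε) := by field_simp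
    _ ≤ _ := by
      have : 0 ≤ K * h ^ 2 := by positivity
      linarith

end Truncation

/-! ### The first time step -/

section FirstStep

variable {a b T ε K h τ x g : ℝ} {E₀ E₁ : ℝ → ℝ} {G E F u : ℝ → ℝ → ℝ}

/-- The remainder of the Taylor polynomial of order two of `u (x, ·)` at `t = 0`. -/
noncomputable def taylorRemainder (T : ℝ) (u : ℝ → ℝ → ℝ) (τ x : ℝ) : ℝ :=
  u x τ - (u x 0 + τ * dt T 1 u x 0 + τ ^ 2 / 2 * dt T 2 u x 0)

lemma zero_mem_Icc (hT : 0 < T) : (0 : ℝ) ∈ Icc 0 T := ⟨le_rfl, hT.le⟩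

lemma mul_mem_Icc (hτ : 0 ≤ τ) (hτT : τ ≤ T) {s : ℝ} (hs : s ∈ Icc (0 : ℝ) 1) :
    s * τ ∈ Icc 0 T ∧ |s * τ - 0| ≤ τ := by
  have h1 : 0 ≤ s * τ := mul_nonneg hs.1 hτ
  have h2 : s * τ ≤ τ := mul_le_of_le_one_left hτ hs.2
  exact ⟨⟨h1, h2.trans hτT⟩, by rwa [sub_zero, abs_of_nonneg h1]⟩

lemma HasTwoDerivs.abs_taylor_zero_le {y y₁ y₂ : ℝ → ℝ} {C : ℝ} (hT : 0 < T)
    (hy : HasTwoDerivs 0 T y y₁ y₂) (hτ : 0 ≤ τ) (hτT : τ ≤ T)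
    (hC : ∀ s ∈ Icc (0 : ℝ) 1, |y₂ (s * τ) - y₂ 0| ≤ C) :
    |y τ - (y 0 + τ * y₁ 0 + τ ^ 2 / 2 * y₂ 0)| ≤ C * τ ^ 2 := by
  have := hy.abs_taylor_le (t := 0) (σ := τ) (C := C) (zero_mem_Icc hT)
    (by rw [zero_add]; exact ⟨hτ, hτT⟩) (fun s hs => by rw [zero_add]; exact hC s hs)
  rw [zero_add] at this
  convert this using 2
  ring

lemma IsRegular.abs_taylorRemainder_le (hab : a < b) (hT : 0 < T) (hu : IsRegular a b T u)
    (hK : 0 ≤ K) (hτ : 0 ≤ τ) (hτT : τ ≤ T) (hx : x ∈ Icc a b)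
    (h3 : ∀ s ∈ Icc 0 T, |dt T 3 u x s| ≤ K) : |taylorRemainder T u τ x| ≤ K * τ * τ ^ 2 := by
  refine (hu.isC2.hasTwoDerivs_time hab hT hx).abs_taylor_zero_le hT hτ hτT fun s hs => ?_
  obtain ⟨s1, s2⟩ := mul_mem_Icc hτ hτT hs
  exact (abs_sub_le_of_hasDerivWithinAt (fun t ht => hu.hasDerivWithinAt_dt_two hT hx ht) h3
    (zero_mem_Icc hT) s1).trans (by gcongr)

lemma taylorRemainder_eq_zero (hT : 0 < T) (h : ∀ t ∈ Icc 0 T, u x t = 0) (hτ : 0 ≤ τ) (hτT : τ ≤ T) :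
    taylorRemainder T u τ x = 0 := by
  have h1 : ∀ t ∈ Icc 0 T, dt T 1 u x t = 0 := fun t ht => dt_one_eq_zero_of_forall h ht
  have h2 : dt T 2 u x 0 = 0 := by
    rw [dt_succ, derivWithin_congr (f := fun _ => (0 : ℝ)) h1 (h1 0 (zero_mem_Icc hT))]
    simp
  unfold taylorRemainder
  rw [h τ ⟨hτ, hτT⟩, h 0 (zero_mem_Icc hT), h1 0 (zero_mem_Icc hT), h2]
  ring

/-- Increments in space of the Taylor remainder, from bounds on the increments of the second time
derivative. -/
lemma IsC2.abs_taylorRemainder_sub_le (hab : a < b) (hT : 0 < T) (hu : IsC2 a b T u)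
    (hτ : 0 ≤ τ) (hτT : τ ≤ T) {y C : ℝ} (hx : x ∈ Icc a b) (hy : y ∈ Icc a b)
    (hC : ∀ s ∈ Icc (0 : ℝ) 1,
      |(dt T 2 u y (s * τ) - dt T 2 u x (s * τ)) - (dt T 2 u y 0 - dt T 2 u x 0)| ≤ C) :
    |taylorRemainder T u τ y - taylorRemainder T u τ x| ≤ C * τ ^ 2 := by
  have h1 := (hu.hasTwoDerivs_time hab hT hy).add ((hu.hasTwoDerivs_time hab hT hx).const_mul (-1))
  have h2 := h1.abs_taylor_zero_le (C := C) hT hτ hτT fun s hs => by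
    have := hC s hs
    convert this using 2
    ring
  convert h2 using 2
  unfold taylorRemainder
  ring

lemma IsRegular.abs_taylorRemainder_sub_le (hab : a < b) (hT : 0 < T) (hu : IsRegular a b T u)
    (hτ : 0 ≤ τ) (hτT : τ ≤ T) {y C : ℝ} (hC0 : 0 ≤ C) (hx : x ∈ Icc a b) (hy : y ∈ Icc a b)
    (hC : ∀ s ∈ Icc 0 T, |dt T 3 u y s - dt T 3 u x s| ≤ C) :
    |taylorRemainder T u τ y - taylorRemainder T u τ x| ≤ C * τ * τ ^ 2 := by
  refine hu.isC2.abs_taylorRemainder_sub_le hab hT hτ hτT hx hy fun s hs => ?_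
  obtain ⟨s1, s2⟩ := mul_mem_Icc hτ hτT hs
  exact (abs_sub_le_of_hasDerivWithinAt (y := fun t => dt T 2 u y t - dt T 2 u x t)
    (fun t ht => (hu.hasDerivWithinAt_dt_two hT hy ht).sub (hu.hasDerivWithinAt_dt_two hT hx ht))
    hC (zero_mem_Icc hT) s1).trans (by gcongr)

/-- The third time derivative of `E` is only known to be of size `1 / ε`. A bound on the Taylor
remainder that is uniform in `ε` comes from the equation, in which `F` and the potential are small;
the increment of `∂_xx E` in time is estimated through its difference quotient in space. -/
lemma abs_taylorRemainder_uniform_le (hab : a < b) (hT : 0 < T) (hK : 1 ≤ K) (hε : 0 < ε)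
    (hs : IsKGZSolution a b T ε E₀ E₁ G E F) (hG : IsC2 a b T G)
    (hb : UniformBounds a b T ε K E F) (hx : x ∈ Ioo a b) (hh : 0 < h)
    (hp : x + h ∈ Icc a b) (hm : x - h ∈ Icc a b) (hτ : 0 ≤ τ) (hτT : τ ≤ T)
    (hg : 0 ≤ g) (hGg : ∀ s ∈ Icc 0 T, |G x s| ≤ K * g) :
    |taylorRemainder T E τ x| ≤ 5 * K ^ 3 * (h ^ 2 + τ + ε + g) * τ ^ 2 := by
  have hxI := Ioo_subset_Icc_self hx
  have h0 := zero_mem_Icc hT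
  have yE := hs.regular_E.isC2.hasTwoDerivs_time hab hT hxI
  have yz := hs.regular_E.isC2.hasTwoDerivs_second_diff hab hT hx hp hm
  refine yE.abs_taylor_zero_le hT hτ hτT fun s hs' => ?_
  obtain ⟨s1, s2⟩ := mul_mem_Icc hτ hτT hs'
  have hK0 : 0 ≤ K := by linarith
  have K2 : K ≤ K ^ 3 := le_self_pow₀ hK (by norm_num)
  have K3 : K ^ 2 ≤ K ^ 3 := pow_le_pow_right₀ hK (by norm_num)
  have z : |(E (x + h) (s * τ) - 2 * E x (s * τ) + E (x - h) (s * τ)) / h ^ 2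
      - (E (x + h) 0 - 2 * E x 0 + E (x - h) 0) / h ^ 2| ≤ K * τ := by
    refine (abs_sub_le_of_hasDerivWithinAt yz.deriv₁ (C := K) (fun q hq => ?_) h0 s1).trans
      (by gcongr)
    rw [abs_div, abs_of_pos (by positivity : 0 < h ^ 2), div_le_iff₀ (by positivity)]
    exact hb.E_dt_dxx q hq x hx h hh hp hm
  have d1 := hb.E_dxx _ s1 x hx h hh hp hm
  have d2 := hb.E_dxx _ h0 x hx h hh hp hm
  have lipE : |E x (s * τ) - E x 0| ≤ K * τ :=
    (abs_sub_le_of_hasDerivWithinAt yE.deriv₁ (fun q hq => hb.E_dt_le q hq x hxI) h0 s1).trans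
      (by gcongr)
  have e1 := hb.E_le _ s1 x hxI
  have e2 := hb.E_le _ h0 x hxI
  have c1 : |(E x (s * τ) ^ 2 + E x (s * τ) * E x 0 + E x 0 ^ 2) * (E x (s * τ) - E x 0)|
      ≤ (K ^ 2 + K * K + K ^ 2) * (K * τ) := by
    refine abs_mul_le ?_ lipE
    refine (abs_add_three _ _ _).trans ?_
    rw [abs_pow, abs_pow]
    gcongr
    exact abs_mul_le e1 e2
  have f1 : |F x (s * τ) * E x (s * τ)| ≤ K * ε * K := abs_mul_le (hb.F_le _ s1 x hxI) e1
  have f2 : |F x 0 * E x 0| ≤ K * ε * K := abs_mul_le (hb.F_le _ h0 x hxI) e2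
  have g1 : |G x (s * τ) * E x (s * τ)| ≤ K * g * K := abs_mul_le (hGg _ s1) e1
  have g2 : |G x 0 * E x 0| ≤ K * g * K := abs_mul_le (hGg _ h0) e2
  rw [hs.eqn_E_Icc hab hT hG hx s1, hs.eqn_E_Icc hab hT hG hx h0]
  have q1 : K * h ^ 2 ≤ K ^ 3 * h ^ 2 := by gcongr
  have q2 : K * τ ≤ K ^ 3 * τ := by gcongr
  have q3 : K ^ 2 * ε ≤ K ^ 3 * ε := by gcongr
  have q4 : K ^ 2 * g ≤ K ^ 3 * g := by gcongr
  have q5 : 0 ≤ K ^ 3 * h ^ 2 := by positivity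
  have q6 : 0 ≤ K ^ 3 * ε := by positivity
  have q7 : 0 ≤ K ^ 3 * g := by positivity
  have e : dx a b 2 E x (s * τ) - (1 - E x (s * τ) ^ 2 + F x (s * τ) + G x (s * τ)) * E x (s * τ)
      - (dx a b 2 E x 0 - (1 - E x 0 ^ 2 + F x 0 + G x 0) * E x 0)
      = dx a b 2 E x (s * τ) - dx a b 2 E x 0 - (E x (s * τ) - E x 0)
        + (E x (s * τ) ^ 2 + E x (s * τ) * E x 0 + E x 0 ^ 2) * (E x (s * τ) - E x 0)
        - F x (s * τ) * E x (s * τ) + F x 0 * E x 0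
        - G x (s * τ) * E x (s * τ) + G x 0 * E x 0 := by ring
  rw [e]
  rw [abs_le] at z d1 d2 lipE c1 f1 f2 g1 g2 ⊢
  constructor <;> linarith only [z, d1, d2, lipE, c1, f1, f2, g1, g2, q1, q2, q3, q4, q5, q6, q7]

/-- The quadratic Taylor coefficients used in the first step of the scheme are those of the exact
solution. -/
lemma IsKGZSolution.dt_two_zero {α : ℝ} {ω₀ : ℝ → ℝ} (hab : a < b) (hT : 0 < T)
    (hs : IsKGZSolution a b T ε E₀ E₁ G E F) (hG : IsC2 a b T G)
    (hG0 : ∀ x ∈ Icc a b, G x 0 = ε ^ α * ω₀ x) (hx : x ∈ Ioo a b) :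
    dt T 2 E x 0 = ett0 a b α ε E₀ ω₀ x ∧ dt T 2 F x 0 = ftt0 a b α ε E₀ E₁ ω₀ x := by
  have hxI := Ioo_subset_Icc_self hx
  have h0 := zero_mem_Icc hT
  have i1 : dx a b 2 E x 0 = iteratedDerivWithin 2 E₀ (Icc a b) x :=
    iteratedDerivWithin_congr (fun y hy => (hs.init_E y hy).1) hxI
  have i2 : dx a b 2 F x 0 = 0 := by
    unfold dx
    rw [iteratedDerivWithin_congr (g := fun _ => (0 : ℝ)) (fun y hy => (hs.init_F y hy).1) hxI]
    simp
  have h1 : dt T 2 E x 0 = ett0 a b α ε E₀ ω₀ x := by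
    rw [hs.eqn_E_Icc hab hT hG hx h0, i1, (hs.init_E x hxI).1, (hs.init_F x hxI).1, hG0 x hxI]
    unfold ett0
    ring
  refine ⟨h1, ?_⟩
  rw [hs.eqn_F_Icc hab hT hx h0, i2, h1, (hs.init_E x hxI).1, (hs.init_E x hxI).2]
  unfold ftt0
  ring

end FirstStep

/-! ### The exact solution on the grid -/

section Grid

variable {a b T ε K h τ g α : ℝ} {M j k n : ℕ} {E₀ E₁ ω₀ : ℝ → ℝ} {G E F u : ℝ → ℝ → ℝ}
  {U V Φ : ℕ → ℕ → ℝ}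

/-- The values of `u` at the grid points and time levels. -/
noncomputable def sample (a b : ℝ) (M : ℕ) (τ : ℝ) (u : ℝ → ℝ → ℝ) (k j : ℕ) : ℝ :=
  u (node a b M j) (k * τ)

lemma mesh_pos (hab : a < b) (hM : 0 < M) : 0 < mesh a b M :=
  div_pos (by linarith) (by exact_mod_cast hM)

lemma natCast_mul_mesh (hM : 0 < M) : M * mesh a b M = b - a := by
  have : (M : ℝ) ≠ 0 := by exact_mod_cast hM.ne'
  unfold mesh
  field_simp

lemma node_zero : node a b M 0 = a := by simp [node]

lemma node_last (hM : 0 < M) : node a b M M = b := by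
  rw [node, natCast_mul_mesh hM]; ring

lemma node_succ (j : ℕ) : node a b M (j + 1) = node a b M j + mesh a b M := by
  unfold node; push_cast; ring

lemma node_pred (hj : 1 ≤ j) : node a b M (j - 1) = node a b M j - mesh a b M := by
  obtain ⟨i, rfl⟩ := Nat.exists_eq_add_of_le' hj
  rw [Nat.add_sub_cancel, node_succ]; ring

lemma node_mem_Icc (hab : a < b) (hM : 0 < M) (hj : j ≤ M) : node a b M j ∈ Icc a b := by
  have h1 := mesh_pos hab hM
  have h2 : (j : ℝ) * mesh a b M ≤ M * mesh a b M := by gcongr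
  rw [natCast_mul_mesh hM] at h2
  have h3 : 0 ≤ (j : ℝ) * mesh a b M := by positivity
  exact ⟨by unfold node; linarith, by unfold node; linarith⟩

lemma node_mem_Ioo (hab : a < b) (hj : 1 ≤ j) (hjM : j < M) : node a b M j ∈ Ioo a b := by
  have hM : 0 < M := by omega
  have h1 := mesh_pos hab hM
  have h2 := (node_mem_Icc hab hM (j := j - 1) (by omega)).1
  have h3 := (node_mem_Icc hab hM (j := j + 1) (by omega)).2
  rw [node_pred hj] at h2
  rw [node_succ] at h3
  exact ⟨by linarith, by linarith⟩

lemma time_mem_Icc (hτ : 0 ≤ τ) (hnT : n * τ ≤ T) (hk : k ≤ n) : (k : ℝ) * τ ∈ Icc 0 T := by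
  refine ⟨by positivity, le_trans ?_ hnT⟩
  gcongr

/-- The interior grid points together with the two neighbouring time levels. -/
lemma stencil_mem (hab : a < b) (hτ : 0 ≤ τ) (hnT : n * τ ≤ T) (hk : k + 2 ≤ n) (hj : 1 ≤ j)
    (hjM : j < M) :
    node a b M j ∈ Ioo a b ∧ node a b M j + mesh a b M ∈ Icc a b ∧
      node a b M j - mesh a b M ∈ Icc a b ∧
      ((k + 1 : ℕ) : ℝ) * τ + τ ≤ T ∧ 0 ≤ ((k + 1 : ℕ) : ℝ) * τ - τ := by
  have hM : 0 < M := by omega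
  refine ⟨node_mem_Ioo hab hj hjM, ?_, ?_, ?_, ?_⟩
  · rw [← node_succ]; exact node_mem_Icc hab hM (by omega)
  · rw [← node_pred hj]; exact node_mem_Icc hab hM (by omega)
  · have := (time_mem_Icc hτ hnT hk).2
    push_cast at this ⊢
    linarith
  · have : (0 : ℝ) ≤ k * τ := by positivity
    push_cast
    linarith

lemma sample_next (k j : ℕ) : sample a b M τ u (k + 2) j
    = u (node a b M j) (((k + 1 : ℕ) : ℝ) * τ + τ) := by
  unfold sample; congr 1; push_cast; ring

lemma sample_prev (k j : ℕ) : sample a b M τ u k j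
    = u (node a b M j) (((k + 1 : ℕ) : ℝ) * τ - τ) := by
  unfold sample; congr 1; push_cast; ring

lemma deltaT2_sample (k j : ℕ) : deltaT2 τ (sample a b M τ u) (k + 1) j
    = (u (node a b M j) (((k + 1 : ℕ) : ℝ) * τ + τ)
        - 2 * u (node a b M j) (((k + 1 : ℕ) : ℝ) * τ)
        + u (node a b M j) (((k + 1 : ℕ) : ℝ) * τ - τ)) / τ ^ 2 := by
  rw [← sample_next (u := u), ← sample_prev (u := u)]
  rfl

lemma deltaX2_sample (hj : 1 ≤ j) (k : ℕ) : deltaX2 (mesh a b M)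
      (fun i => sample a b M τ u (k + 2) i + sample a b M τ u k i) j
    = (u (node a b M j + mesh a b M) (((k + 1 : ℕ) : ℝ) * τ + τ)
          - 2 * u (node a b M j) (((k + 1 : ℕ) : ℝ) * τ + τ)
          + u (node a b M j - mesh a b M) (((k + 1 : ℕ) : ℝ) * τ + τ)) / mesh a b M ^ 2
        + (u (node a b M j + mesh a b M) (((k + 1 : ℕ) : ℝ) * τ - τ)
          - 2 * u (node a b M j) (((k + 1 : ℕ) : ℝ) * τ - τ)
          + u (node a b M j - mesh a b M) (((k + 1 : ℕ) : ℝ) * τ - τ)) / mesh a b M ^ 2 := by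
  simp only [deltaX2, sample_next, sample_prev k, node_succ, node_pred hj]
  ring

lemma deltaX2_avg (U : ℕ → ℕ → ℝ) (k j : ℕ) :
    deltaX2 h (avg U (k + 1)) j = deltaX2 h (fun i => U (k + 2) i + U k i) j / 2 := by
  simp only [deltaX2, avg, Nat.add_sub_cancel]
  ring

/-- The averaged potential as an integral over times symmetric about `t_k`. -/
lemma potential_eq (hτ : 0 ≤ τ) (hG : IsC2 a b T G) (hx : node a b M j ∈ Icc a b)
    (hp : (k : ℝ) * τ + τ ≤ T) (hm : 0 ≤ (k : ℝ) * τ - τ) :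
    potential a b M τ G k j = ∫ s in (0 : ℝ)..1, (1 - s) *
      (G (node a b M j) (k * τ + s * τ) + G (node a b M j) (k * τ - s * τ)) := by
  have hc : ContinuousOn (fun s => G (node a b M j) (k * τ + s * τ)) (Icc (-1) 1) := by
    refine (continuousOn_time hG.continuousOn hx).comp (by fun_prop) fun s hs => ?_
    have h1 : s * τ ≤ τ := mul_le_of_le_one_left hτ hs.2
    have h2 : -1 * τ ≤ s * τ := mul_le_mul_of_nonneg_right hs.1 hτ
    exact ⟨by linarith, by linarith⟩
  rw [potential, integral_weight_symm hc]
  simp only [neg_mul, ← sub_eq_add_neg]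

/-- Bounds on the potential `G`, with `g = ε^{α^*}`. -/
structure PotentialBounds (a b T ε K g : ℝ) (G : ℝ → ℝ → ℝ) : Prop where
  isC2 : IsC2 a b T G
  le : ∀ x ∈ Icc a b, ∀ t ∈ Icc 0 T, |G x t| ≤ K * g
  dt_le : ∀ x ∈ Icc a b, ∀ t ∈ Icc 0 T, |dt T 1 G x t| ≤ K * g / ε

/-- The grid values of the exact solution `E`, together with grid functions `Φ` close to `F`, form
a reference solution of the scheme. -/
lemma isReference_of_residual {R : ℝ} (hab : a < b) (hT : 0 < T) (hM : 0 < M) (hτ : 0 < τ)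
    (hK : 0 ≤ K) (hg : g ≤ 1) (hnT : n * τ ≤ T)
    (hs : IsKGZSolution a b T ε E₀ E₁ G E F) (hb : UniformBounds a b T ε K E F)
    (hG : PotentialBounds a b T ε K g G)
    (hΦ0 : ∀ k ≤ n, Φ k 0 = 0 ∧ Φ k M = 0)
    (hΦ : ∀ k ≤ n, ∀ j, 1 ≤ j → j < M → |Φ k j| ≤ 2 * K)
    (hE : ∀ k, k + 2 ≤ n → ∀ j, 1 ≤ j → j < M →
      |deltaT2 τ (sample a b M τ E) (k + 1) j
        - (deltaX2 (mesh a b M) (avg (sample a b M τ E) (k + 1)) j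
      + (-1 + sample a b M τ E (k + 1) j ^ 2 - Φ (k + 1) j - potential a b M τ G (k + 1) j)
        * avg (sample a b M τ E) (k + 1) j)| ≤ R)
    (hF : ∀ k, k + 2 ≤ n → ∀ j, 1 ≤ j → j < M →
    ε * |deltaT2 τ Φ (k + 1) j
      - (1 / (2 * ε ^ 2) * deltaX2 (mesh a b M) (fun i => Φ (k + 2) i + Φ k i) j
        + deltaT2 τ (fun l i => sample a b M τ E l i ^ 2) (k + 1) j)| ≤ R) :
    IsReference M (mesh a b M) τ ε (2 * K) R n (potential a b M τ G) (sample a b M τ E) Φ where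
  bdry k hk := by
    have h1 := hs.bdry_E _ (time_mem_Icc hτ.le hnT hk)
    refine ⟨?_, ?_, hΦ0 k hk⟩
    · rw [sample, node_zero]; exact h1.1
    · rw [sample, node_last hM]; exact h1.2
  X_le k hk j hj :=
    (hb.E_le _ (time_mem_Icc hτ.le hnT hk) _ (node_mem_Icc hab hM hj)).trans (by linarith)
  X_dx k hk j hj := by
    have hh := mesh_pos hab hM
    have h1 := hb.E_lip _ (time_mem_Icc hτ.le hnT hk) _ (node_mem_Icc hab hM hj.le) _
      (node_mem_Icc hab hM (j := j + 1) hj)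
    have h2 : |node a b M (j + 1) - node a b M j| = mesh a b M := by
      rw [node_succ, add_sub_cancel_left, abs_of_pos hh]
    rw [deltaX, abs_div, abs_of_pos hh, div_le_iff₀ hh]
    rw [h2] at h1
    exact h1.trans (by gcongr; linarith)
  X_dt k hk j hj hjM := by
    have hx := node_mem_Icc hab hM hjM.le
    have t1 := time_mem_Icc hτ.le hnT hk
    have t0 := time_mem_Icc hτ.le hnT (Nat.le_of_succ_le hk)
    have h1 := abs_sub_le_of_hasDerivWithinAt
      (hs.regular_E.isC2.hasTwoDerivs_time hab hT hx).deriv₁ (fun s hs' => hb.E_dt_le s hs' _ hx)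
      t0 t1
    have h2 : |((k + 1 : ℕ) : ℝ) * τ - k * τ| = τ := by
      rw [← abs_of_pos hτ]; push_cast; congr 1
      rw [abs_of_pos hτ]; ring
    rw [h2] at h1
    rw [deltaT, abs_div, abs_of_pos hτ, div_le_iff₀ hτ]
    exact h1.trans (by gcongr; linarith)
  X_dtt k hk j hj hjM := by
    obtain ⟨hx, -, -, htp, htm⟩ := stencil_mem hab hτ.le hnT hk hj hjM
    have hxI := Ioo_subset_Icc_self hx
    obtain ⟨h1, h2, h3, -⟩ := mem_Icc_of_symm hτ.le htp htm
    rw [deltaT2_sample, abs_div, abs_of_pos (by positivity : 0 < τ ^ 2),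
      div_le_iff₀ (by positivity)]
    exact (hs.regular_E.isC2.hasTwoDerivs_time hab hT hxI).abs_second_diff_le h1 h2 h3
      fun s hs' => hb.E_dtt_le s hs' _ hxI
  Φ_le := hΦ
  P_le k hk j hj hjM := by
    obtain ⟨hx, -, -, htp, htm⟩ := stencil_mem hab hτ.le hnT hk hj hjM
    have hxI := Ioo_subset_Icc_self hx
    obtain ⟨-, -, -, h4⟩ := mem_Icc_of_symm hτ.le htp htm
    rw [potential_eq hτ.le hG.isC2 hxI htp htm]
    refine abs_integral_weight_le fun s hs' => (abs_add_le _ _).trans ?_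
    obtain ⟨s1, s2, -, -⟩ := h4 s hs'
    have h1 := hG.le _ hxI _ s1
    have h2 := hG.le _ hxI _ s2
    have h3 : K * g ≤ K := mul_le_of_le_one_right hK hg
    linarith
  res_E := hE
  res_F := hF

/-- Truncation error of the first equation on the grid. -/
lemma abs_residual_E_sample_le {γ : ℝ} (hab : a < b) (hT : 0 < T) (hM : 0 < M) (hτ : 0 < τ)
    (hτ1 : τ ≤ 1) (hε1 : ε ≤ 1) (hK : 1 ≤ K) (hg : g ≤ 1) (hnT : n * τ ≤ T)
    (hs : IsKGZSolution a b T ε E₀ E₁ G E F) (hb : UniformBounds a b T ε K E F)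
    (hG : PotentialBounds a b T ε K g G) (hγ : 0 ≤ γ)
    (hGγ : ∀ x ∈ Icc a b, ∀ s ∈ Icc 0 T, ∀ t ∈ Icc 0 T, |t - s| ≤ 2 * τ → |G x t - G x s| ≤ γ) :
    ∀ k, k + 2 ≤ n → ∀ j, 1 ≤ j → j < M →
      |deltaT2 τ (sample a b M τ E) (k + 1) j
        - (deltaX2 (mesh a b M) (avg (sample a b M τ E) (k + 1)) j
      + (-1 + sample a b M τ E (k + 1) j ^ 2 - sample a b M τ F (k + 1) j
          - potential a b M τ G (k + 1) j) * avg (sample a b M τ E) (k + 1) j)|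
        ≤ 40 * K ^ 3 * (mesh a b M ^ 2 + τ ^ 2 + τ * γ) := by
  intro k hk j hj hjM
  obtain ⟨hx, hp, hm, htp, htm⟩ := stencil_mem hab hτ.le hnT hk hj hjM
  have hxI := Ioo_subset_Icc_self hx
  obtain ⟨-, -, -, h4⟩ := mem_Icc_of_symm hτ.le htp htm
  have := abs_residual_E_le hab hT hK hε1 hs hG.isC2 hb hx (mesh_pos hab hM) hp hm hτ hτ1 htp htm
    (fun s hs' => (hG.le _ hxI s hs').trans (mul_le_of_le_one_right (by linarith) hg)) hγ
    (fun s hs' => by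
      obtain ⟨s1, s2, s3, s4⟩ := h4 s hs'
      refine hGγ _ hxI _ s2 _ s1 ?_
      rw [abs_le]; constructor <;> linarith)
  rw [← potential_eq hτ.le hG.isC2 hxI htp htm, ← deltaX2_sample hj, ← deltaX2_avg,
    ← deltaT2_sample] at this
  have e : avg (sample a b M τ E) (k + 1) j
      = (E (node a b M j) (((k + 1 : ℕ) : ℝ) * τ + τ)
          + E (node a b M j) (((k + 1 : ℕ) : ℝ) * τ - τ)) / 2 := by
    rw [← sample_next (u := E), ← sample_prev (u := E)]; rfl
  rw [e]
  exact this

/-- The exact solution is a reference solution, with a residual that is small for `τ` below `ε`. The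
increments of `G` are estimated through `∂_t G = O(1 / ε)`. -/
lemma isReference_sample (hab : a < b) (hT : 0 < T) (hM : 0 < M) (hτ : 0 < τ)
    (hτ1 : τ ≤ 1) (hε : 0 < ε) (hε1 : ε ≤ 1) (hK : 1 ≤ K) (hg : g ≤ 1)
    (hnT : n * τ ≤ T)
    (hs : IsKGZSolution a b T ε E₀ E₁ G E F) (hb : UniformBounds a b T ε K E F)
    (hG : PotentialBounds a b T ε K g G) :
    IsReference M (mesh a b M) τ ε (2 * K) (120 * K ^ 4 * (mesh a b M ^ 2 + τ ^ 2 / ε)) n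
      (potential a b M τ G) (sample a b M τ E) (sample a b M τ F) := by
  have hK0 : 0 ≤ K := by linarith
  have K1 : 1 ≤ K ^ 3 := one_le_pow₀ hK
  have h1 : τ ^ 2 ≤ τ ^ 2 / ε := le_div_self (sq_nonneg τ) hε hε1
  have h2 : 0 ≤ τ ^ 2 / ε := by positivity
  refine isReference_of_residual hab hT hM hτ hK0 hg hnT hs hb hG (fun k hk => ?_)
    (fun k hk j hj hjM => ?_) (fun k hk j hj hjM => ?_) (fun k hk j hj hjM => ?_)
  · have h1 := hs.bdry_F _ (time_mem_Icc hτ.le hnT hk)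
    exact ⟨by rw [sample, node_zero]; exact h1.1, by rw [sample, node_last hM]; exact h1.2⟩
  · refine (hb.F_le _ (time_mem_Icc hτ.le hnT hk) _ (node_mem_Icc hab hM hjM.le)).trans ?_
    have : K * ε ≤ K := mul_le_of_le_one_right hK0 hε1
    linarith
  · refine (abs_residual_E_sample_le (γ := K / ε * (2 * τ)) hab hT hM hτ hτ1 hε1 hK hg hnT hs hb hG
      (by positivity) (fun x hx s hs' t ht hst => ?_) k hk j hj hjM).trans ?_
    · refine (abs_sub_le_of_hasDerivWithinAt (hG.isC2.hasTwoDerivs_time hab hT hx).deriv₁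
        (C := K / ε) (fun r hr => (hG.dt_le x hx r hr).trans ?_) hs' ht).trans (by gcongr)
      gcongr
      exact mul_le_of_le_one_right hK0 hg
    · have e : τ * (K / ε * (2 * τ)) = 2 * K * (τ ^ 2 / ε) := by field_simp
      rw [e]
      have h3 : mesh a b M ^ 2 ≤ K * mesh a b M ^ 2 := le_mul_of_one_le_left (sq_nonneg _) hK
      have h4 : τ ^ 2 / ε ≤ K * (τ ^ 2 / ε) := le_mul_of_one_le_left h2 hK
      have h5 : 0 ≤ K * mesh a b M ^ 2 := by positivity
      calc 40 * K ^ 3 * (mesh a b M ^ 2 + τ ^ 2 + 2 * K * (τ ^ 2 / ε))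
          ≤ 40 * K ^ 3 * (3 * (K * mesh a b M ^ 2) + 3 * (K * (τ ^ 2 / ε))) :=
            mul_le_mul_of_nonneg_left (by linarith) (by positivity)
        _ = _ := by ring
  · obtain ⟨hx, hp, hm, htp, htm⟩ := stencil_mem hab hτ.le hnT hk hj hjM
    have := abs_residual_F_le hab hT hε hK0 hs hb hx (mesh_pos hab hM) hp hm hτ htp htm
    rw [← deltaX2_sample hj, ← deltaT2_sample] at this
    have e : deltaT2 τ (fun l i => sample a b M τ E l i ^ 2) (k + 1) j
        = (E (node a b M j) (((k + 1 : ℕ) : ℝ) * τ + τ) ^ 2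
          - 2 * E (node a b M j) (((k + 1 : ℕ) : ℝ) * τ) ^ 2
          + E (node a b M j) (((k + 1 : ℕ) : ℝ) * τ - τ) ^ 2) / τ ^ 2 := by
      exact deltaT2_sample (u := fun x t => E x t ^ 2) k j
    rw [e]
    refine this.trans (mul_le_mul_of_nonneg_right ?_ (by positivity))
    calc 4 * K = 4 * K * 1 := by ring
      _ ≤ 120 * K * K ^ 3 := by gcongr; norm_num
      _ = 120 * K ^ 4 := by ring

/-- For time steps above `ε`, the density `F = O(ε)` is replaced by zero. The source
`δ_t² E² = O(1)` then is the residual of the second equation, which has the weight `ε`. The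
increments of `G` are estimated through `G = O(g)`. -/
lemma isReference_sample_zero (hab : a < b) (hT : 0 < T) (hM : 0 < M) (hτ : 0 < τ)
    (hτ1 : τ ≤ 1) (hε : 0 < ε) (hε1 : ε ≤ 1) (hK : 1 ≤ K) (hg0 : 0 ≤ g) (hg : g ≤ 1)
    (hnT : n * τ ≤ T)
    (hs : IsKGZSolution a b T ε E₀ E₁ G E F) (hb : UniformBounds a b T ε K E F)
    (hG : PotentialBounds a b T ε K g G) :
    IsReference M (mesh a b M) τ ε (2 * K)
      (120 * K ^ 4 * (mesh a b M ^ 2 + τ ^ 2 + τ * g + ε)) n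
      (potential a b M τ G) (sample a b M τ E) (fun _ _ => 0) := by
  have hK0 : 0 ≤ K := by linarith
  have K3 : K ^ 3 ≤ K ^ 4 := pow_le_pow_right₀ hK (by norm_num)
  have K2 : K ^ 2 ≤ K ^ 4 := pow_le_pow_right₀ hK (by norm_num)
  have h2 : 0 ≤ τ * g := by positivity
  refine isReference_of_residual hab hT hM hτ hK0 hg hnT hs hb hG (fun k hk => ⟨rfl, rfl⟩)
    (fun k hk j hj hjM => by simpa using hK0) (fun k hk j hj hjM => ?_) (fun k hk j hj hjM => ?_)
  · have r := abs_residual_E_sample_le (γ := 2 * (K * g)) hab hT hM hτ hτ1 hε1 hK hg hnT hs hb hG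
      (by positivity) (fun x hx s hs' t ht hst => by
        have h1 := hG.le x hx s hs'
        have h3 := hG.le x hx t ht
        exact (abs_sub _ _).trans (by linarith)) k hk j hj hjM
    have hx := node_mem_Icc hab hM hjM.le
    have hkt := time_mem_Icc hτ.le hnT (show k + 1 ≤ n by omega)
    have f : |sample a b M τ F (k + 1) j * avg (sample a b M τ E) (k + 1) j| ≤ K * ε * K := by
      refine abs_mul_le (hb.F_le _ hkt _ hx) ?_
      have a1 := hb.E_le _ (time_mem_Icc hτ.le hnT hk) _ hx
      have a2 := hb.E_le _ (time_mem_Icc hτ.le hnT (show k ≤ n by omega)) _ hx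
      have e : avg (sample a b M τ E) (k + 1) j
          = (E (node a b M j) ((k + 2 : ℕ) * τ) + E (node a b M j) (k * τ)) / 2 := rfl
      rw [e, abs_div, abs_two, div_le_iff₀ two_pos]
      exact (abs_add_le _ _).trans (by linarith)
    have q0 : mesh a b M ^ 2 * K ^ 3 ≤ mesh a b M ^ 2 * K ^ 4 := by gcongr
    have q1 : τ ^ 2 * K ^ 3 ≤ τ ^ 2 * K ^ 4 := by gcongr
    have q2 : ε * K ^ 2 ≤ ε * K ^ 4 := by gcongr
    have q3 : 0 ≤ mesh a b M ^ 2 * K ^ 4 := by positivity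
    have q4 : 0 ≤ τ ^ 2 * K ^ 4 := by positivity
    have q5 : 0 ≤ τ * g * K ^ 4 := by positivity
    have q6 : 0 ≤ ε * K ^ 4 := by positivity
    rw [abs_le] at r f ⊢
    constructor <;> linarith only [r, f, q0, q1, q2, q3, q4, q5, q6]
  · obtain ⟨hx, hp, hm, htp, htm⟩ := stencil_mem hab hτ.le hnT hk hj hjM
    have hxI := Ioo_subset_Icc_self hx
    obtain ⟨h1, h2', h3, -⟩ := mem_Icc_of_symm hτ.le htp htm
    have d := (hs.regular_E.hasTwoDerivs_sq hab hT hxI).abs_second_diff_le (C := 4 * K ^ 2)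
      h1 h2' h3 fun s hs' => by
        have b0 := hb.E_le s hs' _ hxI
        have b1 := hb.E_dt_le s hs' _ hxI
        have b2 := hb.E_dtt_le s hs' _ hxI
        have c1 : dt T 1 E (node a b M j) s ^ 2 ≤ K ^ 2 := sq_le_sq' (abs_le.1 b1).1 (abs_le.1 b1).2
        have c0 := sq_nonneg (dt T 1 E (node a b M j) s)
        have c2 := abs_le.1 (abs_mul_le b0 b2)
        rw [abs_le]
        constructor <;> linarith [c2.1, c2.2]
    have e : deltaT2 τ (fun l i => sample a b M τ E l i ^ 2) (k + 1) j
        = (E (node a b M j) (((k + 1 : ℕ) : ℝ) * τ + τ) ^ 2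
          - 2 * E (node a b M j) (((k + 1 : ℕ) : ℝ) * τ) ^ 2
          + E (node a b M j) (((k + 1 : ℕ) : ℝ) * τ - τ) ^ 2) / τ ^ 2 := by
      exact deltaT2_sample (u := fun x t => E x t ^ 2) k j
    have z1 : deltaT2 τ (fun _ _ => (0 : ℝ)) (k + 1) j = 0 := by simp [deltaT2]
    have z2 : deltaX2 (mesh a b M) (fun _ => (0 : ℝ) + 0) j = 0 := by simp [deltaX2]
    rw [z1, z2, mul_zero, zero_add, zero_sub, abs_neg, e, abs_div,
      abs_of_pos (by positivity : 0 < τ ^ 2)]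
    have d' := div_le_of_le_mul₀ (by positivity) (by positivity) d
    have q3 : 0 ≤ K ^ 4 * mesh a b M ^ 2 := by positivity
    have q4 : 0 ≤ K ^ 4 * τ ^ 2 := by positivity
    have q5 : 0 ≤ K ^ 4 * (τ * g) := by positivity
    have q6 : 0 ≤ K ^ 4 * ε := by positivity
    calc _ ≤ ε * (2 * (4 * K ^ 2)) := by gcongr
      _ ≤ ε * (2 * (4 * K ^ 4)) := by gcongr
      _ ≤ _ := by linarith

end Grid

/-! ### The initial values of the scheme -/

section Start

variable {a b T ε K h τ g α : ℝ} {M j k n : ℕ} {E₀ E₁ ω₀ : ℝ → ℝ} {G E F u : ℝ → ℝ → ℝ}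
  {U V Φ : ℕ → ℕ → ℝ}

/-- The grid functions `U`, `V` have the initial values prescribed in the scheme at the time
levels zero and one. -/
structure IsStart (a b α ε : ℝ) (E₀ E₁ ω₀ : ℝ → ℝ) (M : ℕ) (τ : ℝ) (U V : ℕ → ℕ → ℝ) :
    Prop where
  zero : ∀ j ≤ M, U 0 j = E₀ (node a b M j) ∧ V 0 j = 0
  bdry : U 1 0 = 0 ∧ U 1 M = 0 ∧ V 1 0 = 0 ∧ V 1 M = 0
  first : ∀ j, 1 ≤ j → j < M →
    U 1 j = E₀ (node a b M j) + τ * E₁ (node a b M j)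
        + τ ^ 2 / 2 * ett0 a b α ε E₀ ω₀ (node a b M j) ∧
      V 1 j = τ ^ 2 / 2 * ftt0 a b α ε E₀ E₁ ω₀ (node a b M j)

lemma IsSchemeSolution.isStart (hτT : τ ≤ T)
    (h : IsSchemeSolution a b T α ε E₀ E₁ ω₀ G M τ U V) :
    IsStart a b α ε E₀ E₁ ω₀ M τ U V where
  zero := h.init
  bdry := h.bdry 1 (by simpa using hτT)
  first := h.first

/-- The errors at the first time level are Taylor remainders of the exact solution, up to the
boundary. -/
lemma IsStart.error_one (hab : a < b) (hT : 0 < T) (hM : 0 < M) (hτ : 0 ≤ τ) (hτT : τ ≤ T)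
    (hs : IsKGZSolution a b T ε E₀ E₁ G E F) (hG : IsC2 a b T G)
    (hG0 : ∀ x ∈ Icc a b, G x 0 = ε ^ α * ω₀ x)
    (hU : IsStart a b α ε E₀ E₁ ω₀ M τ U V) (hj : j ≤ M) :
    sample a b M τ E 1 j - U 1 j = taylorRemainder T E τ (node a b M j) ∧
      sample a b M τ F 1 j - V 1 j = taylorRemainder T F τ (node a b M j) := by
  have bd : ∀ i, node a b M i ∈ ({a, b} : Set ℝ) → U 1 i = 0 → V 1 i = 0 →
      sample a b M τ E 1 i - U 1 i = taylorRemainder T E τ (node a b M i) ∧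
        sample a b M τ F 1 i - V 1 i = taylorRemainder T F τ (node a b M i) := by
    intro i hi hUi hVi
    have hE : ∀ t ∈ Icc 0 T, E (node a b M i) t = 0 := fun t ht => by
      rcases hi with hi | hi <;> rw [hi]
      exacts [(hs.bdry_E t ht).1, (hs.bdry_E t ht).2]
    have hF : ∀ t ∈ Icc 0 T, F (node a b M i) t = 0 := fun t ht => by
      rcases hi with hi | hi <;> rw [hi]
      exacts [(hs.bdry_F t ht).1, (hs.bdry_F t ht).2]
    rw [taylorRemainder_eq_zero hT hE hτ hτT, taylorRemainder_eq_zero hT hF hτ hτT, hUi, hVi,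
      sample, sample, Nat.cast_one, one_mul, hE τ ⟨hτ, hτT⟩, hF τ ⟨hτ, hτT⟩, sub_zero]
    exact ⟨rfl, rfl⟩
  rcases Nat.eq_zero_or_pos j with rfl | hj0
  · exact bd 0 (Or.inl node_zero) hU.bdry.1 hU.bdry.2.2.1
  rcases hj.eq_or_lt with rfl | hjM
  · exact bd j (Or.inr (node_last hM)) hU.bdry.2.1 hU.bdry.2.2.2
  have hx := node_mem_Ioo hab hj0 hjM
  have hxI := Ioo_subset_Icc_self hx
  obtain ⟨d1, d2⟩ := hs.dt_two_zero hab hT hG hG0 hx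
  obtain ⟨i1, i2⟩ := hs.init_E _ hxI
  obtain ⟨i3, i4⟩ := hs.init_F _ hxI
  obtain ⟨f1, f2⟩ := hU.first j hj0 hjM
  unfold taylorRemainder sample
  rw [f1, f2, d1, d2, i1, i2, i3, i4, Nat.cast_one, one_mul]
  constructor <;> ring

lemma IsStart.deltaX_error_one (hab : a < b) (hT : 0 < T) (hM : 0 < M) (hτ : 0 ≤ τ) (hτT : τ ≤ T)
    (hs : IsKGZSolution a b T ε E₀ E₁ G E F) (hG : IsC2 a b T G)
    (hG0 : ∀ x ∈ Icc a b, G x 0 = ε ^ α * ω₀ x)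
    (hU : IsStart a b α ε E₀ E₁ ω₀ M τ U V) (hj : j < M) {C : ℝ}
    (hC : |taylorRemainder T E τ (node a b M (j + 1)) - taylorRemainder T E τ (node a b M j)|
      ≤ C * mesh a b M) :
    |deltaX (mesh a b M) (fun i => sample a b M τ E 1 i - U 1 i) j| ≤ C := by
  have hh := mesh_pos hab hM
  rw [deltaX, (hU.error_one hab hT hM hτ hτT hs hG hG0 (j := j + 1) hj).1,
    (hU.error_one hab hT hM hτ hτT hs hG hG0 hj.le).1, abs_div, abs_of_pos hh, div_le_iff₀ hh]
  exact hC

lemma abs_node_succ_sub (hab : a < b) (hM : 0 < M) (j : ℕ) :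
    |node a b M (j + 1) - node a b M j| = mesh a b M := by
  rw [node_succ, add_sub_cancel_left, abs_of_pos (mesh_pos hab hM)]

/-- Initial errors with respect to the exact solution, from the bounds of size `1 / ε` on the third time
derivatives. -/
lemma IsStart.isClose (hab : a < b) (hT : 0 < T) (hM : 0 < M) (hτ : 0 < τ)
    (hτ1 : τ ≤ 1) (hτT : τ ≤ T) (hε : 0 < ε) (hε1 : ε ≤ 1) (hK : 1 ≤ K)
    (hs : IsKGZSolution a b T ε E₀ E₁ G E F) (hb : UniformBounds a b T ε K E F)
    (hG : IsC2 a b T G)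
    (hG0 : ∀ x ∈ Icc a b, G x 0 = ε ^ α * ω₀ x)
    (hU : IsStart a b α ε E₀ E₁ ω₀ M τ U V) :
    IsClose M (mesh a b M) τ ε (120 * K ^ 4 * (mesh a b M ^ 2 + τ ^ 2 / ε))
      (sample a b M τ E) (sample a b M τ F) U V := by
  have hh := mesh_pos hab hM
  have hK0 : 0 ≤ K := by linarith
  have q : K * (τ ^ 2 / ε) ≤ 120 * K ^ 4 * (mesh a b M ^ 2 + τ ^ 2 / ε) := by
    have h1 : K ≤ K ^ 4 := le_self_pow₀ hK (by norm_num)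
    have h2 : K * (τ ^ 2 / ε) ≤ K ^ 4 * (τ ^ 2 / ε) := by gcongr
    have h3 : 0 ≤ K ^ 4 * (τ ^ 2 / ε) := by positivity
    have h4 : 0 ≤ K ^ 4 * mesh a b M ^ 2 := by positivity
    linarith
  have q0 : 0 ≤ K * (τ ^ 2 / ε) := by positivity
  have e : K / ε * τ * τ ^ 2 = K * (τ ^ 2 / ε) * τ := by ring
  have hF : ∀ j, 1 ≤ j → j < M → |sample a b M τ F 1 j - V 1 j| ≤ K * (τ ^ 2 / ε) * τ := by
    intro j _ hjM
    have hx := node_mem_Icc hab hM hjM.le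
    rw [(hU.error_one hab hT hM hτ.le hτT hs hG hG0 hjM.le).2, ← e]
    exact hs.regular_F.abs_taylorRemainder_le hab hT (by positivity) hτ.le hτT hx
      fun s hs' => hb.F_dttt_le s hs' _ hx
  refine ⟨fun j hj => ?_, fun j hj => ?_, fun j hj hjM => ?_, fun j hjM => ?_,
    fun j hj hjM => ?_, fun j hj hjM => ?_⟩
  · rw [(hU.zero j hj).1, sample, Nat.cast_zero, zero_mul]
    exact (hs.init_E _ (node_mem_Icc hab hM hj)).1
  · rw [(hU.zero j hj).2, sample, Nat.cast_zero, zero_mul]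
    exact (hs.init_F _ (node_mem_Icc hab hM hj)).1
  · have hx := node_mem_Icc hab hM hjM.le
    rw [(hU.error_one hab hT hM hτ.le hτT hs hG hG0 hjM.le).1]
    refine (hs.regular_E.abs_taylorRemainder_le hab hT (K := K / ε) (by positivity) hτ.le hτT hx
      fun s hs' => hb.E_dttt_le s hs' _ hx).trans ?_
    rw [e]
    gcongr
  · have hx := node_mem_Icc hab hM hjM.le
    have hy := node_mem_Icc hab hM (j := j + 1) hjM
    refine hU.deltaX_error_one hab hT hM hτ.le hτT hs hG hG0 hjM ?_
    refine (hs.regular_E.abs_taylorRemainder_sub_le hab hT hτ.le hτT (C := K / ε * mesh a b M)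
      (by positivity) hx hy fun s hs' => ?_).trans ?_
    · have := hb.E_dttt_lip s hs' _ hx _ hy
      rwa [abs_node_succ_sub hab hM] at this
    · calc K / ε * mesh a b M * τ * τ ^ 2 = K * (τ ^ 2 / ε) * τ * mesh a b M := by ring
        _ ≤ K * (τ ^ 2 / ε) * mesh a b M :=
          mul_le_mul_of_nonneg_right (mul_le_of_le_one_right q0 hτ1) hh.le
        _ ≤ _ := by gcongr
  · exact (hF j hj hjM).trans ((mul_le_of_le_one_right q0 hτ1).trans q)
  · have h1 : ε * |sample a b M τ F 1 j - V 1 j| ≤ |sample a b M τ F 1 j - V 1 j| :=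
      mul_le_of_le_one_left (abs_nonneg _) hε1
    exact h1.trans ((hF j hj hjM).trans (by gcongr))

/-- Initial errors with respect to `(E, 0)`, from bounds that are uniform in `ε`. -/
lemma IsStart.isClose_zero (hab : a < b) (hT : 0 < T) (hM : 0 < M) (hτ : 0 < τ)
    (hτ1 : τ ≤ 1) (hτT : τ ≤ T) (hε : 0 < ε) (hK : 1 ≤ K) (hg0 : 0 ≤ g)
    (hs : IsKGZSolution a b T ε E₀ E₁ G E F) (hb : UniformBounds a b T ε K E F)
    (hG : PotentialBounds a b T ε K g G)
    (hG0 : ∀ x ∈ Icc a b, G x 0 = ε ^ α * ω₀ x)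
    (hU : IsStart a b α ε E₀ E₁ ω₀ M τ U V) :
    IsClose M (mesh a b M) τ ε (120 * K ^ 4 * (mesh a b M ^ 2 + τ ^ 2 + τ * g + ε))
      (sample a b M τ E) (fun _ _ => 0) U V := by
  have hh := mesh_pos hab hM
  have hK0 : 0 ≤ K := by linarith
  have K1 : K ≤ K ^ 4 := le_self_pow₀ hK (by norm_num)
  have K3 : K ^ 3 ≤ K ^ 4 := pow_le_pow_right₀ hK (by norm_num)
  have q3 : 0 ≤ K ^ 4 * mesh a b M ^ 2 := by positivity
  have q4 : 0 ≤ K ^ 4 * τ ^ 2 := by positivity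
  have q5 : 0 ≤ K ^ 4 * (τ * g) := by positivity
  have q6 : 0 ≤ K ^ 4 * ε := by positivity
  have hF : ∀ j, 1 ≤ j → j < M → |0 - V 1 j| ≤ K * τ ^ 2 := by
    intro j hj hjM
    have hx := node_mem_Ioo hab hj hjM
    rw [(hU.first j hj hjM).2, ← (hs.dt_two_zero hab hT hG.isC2 hG0 hx).2, zero_sub, abs_neg,
      abs_mul, abs_of_nonneg (by positivity : 0 ≤ τ ^ 2 / 2)]
    have := hb.F_dtt_le 0 (zero_mem_Icc hT) _ (Ioo_subset_Icc_self hx)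
    calc τ ^ 2 / 2 * |dt T 2 F (node a b M j) 0| ≤ τ ^ 2 * K := by
          gcongr
          exact half_le_self (sq_nonneg τ)
      _ = _ := mul_comm _ _
  refine ⟨fun j hj => ?_, fun j hj => ((hU.zero j hj).2).symm, fun j hj hjM => ?_,
    fun j hjM => ?_, fun j hj hjM => ?_, fun j hj hjM => ?_⟩
  · rw [(hU.zero j hj).1, sample, Nat.cast_zero, zero_mul]
    exact (hs.init_E _ (node_mem_Icc hab hM hj)).1
  · have hx := node_mem_Ioo hab hj hjM
    rw [(hU.error_one hab hT hM hτ.le hτT hs hG.isC2 hG0 hjM.le).1]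
    refine (abs_taylorRemainder_uniform_le hab hT hK hε hs hG.isC2 hb hx hh
      (by rw [← node_succ]; exact node_mem_Icc hab hM hjM)
      (by rw [← node_pred hj]; exact node_mem_Icc hab hM (by omega)) hτ.le hτT hg0
      fun s hs' => hG.le _ (Ioo_subset_Icc_self hx) s hs').trans ?_
    calc 5 * K ^ 3 * (mesh a b M ^ 2 + τ + ε + g) * τ ^ 2
        = 5 * K ^ 3 * (mesh a b M ^ 2 * τ + τ ^ 2 + τ * g + ε * τ) * τ := by ring
      _ ≤ 120 * K ^ 4 * (mesh a b M ^ 2 * 1 + τ ^ 2 + τ * g + ε * 1) * τ := by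
          gcongr; norm_num
      _ = _ := by ring
  · have hx := node_mem_Icc hab hM hjM.le
    have hy := node_mem_Icc hab hM (j := j + 1) hjM
    refine hU.deltaX_error_one hab hT hM hτ.le hτT hs hG.isC2 hG0 hjM ?_
    refine (hs.regular_E.isC2.abs_taylorRemainder_sub_le hab hT hτ.le hτT
      (C := K * mesh a b M + K * mesh a b M) hx hy fun s hs' => ?_).trans ?_
    · have h1 := hb.E_dtt_lip _ (mul_mem_Icc hτ.le hτT hs').1 _ hx _ hy
      have h2 := hb.E_dtt_lip _ (zero_mem_Icc hT) _ hx _ hy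
      rw [abs_node_succ_sub hab hM] at h1 h2
      exact (abs_sub _ _).trans (add_le_add h1 h2)
    · have : 2 * (K * τ ^ 2) ≤ 120 * K ^ 4 * (mesh a b M ^ 2 + τ ^ 2 + τ * g + ε) := by
        have : K * τ ^ 2 ≤ K ^ 4 * τ ^ 2 := by gcongr
        linarith
      calc (K * mesh a b M + K * mesh a b M) * τ ^ 2 = 2 * (K * τ ^ 2) * mesh a b M := by ring
        _ ≤ _ := by gcongr
  · refine (hF j hj hjM).trans ?_
    have : K * τ ^ 2 ≤ K ^ 4 * τ ^ 2 := by gcongr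
    linarith
  · calc ε * |0 - V 1 j| ≤ ε * (K * τ ^ 2) := by gcongr; exact hF j hj hjM
      _ = K * ε * τ * τ := by ring
      _ ≤ K * ε * 1 * τ := by gcongr
      _ ≤ _ := by
        refine mul_le_mul_of_nonneg_right ?_ hτ.le
        have : K * ε ≤ K ^ 4 * ε := by gcongr
        linarith

end Start

/-! ### Solvability of the scheme and error bounds -/

section Final

variable {a b T ε K τ g α R : ℝ} {M k n : ℕ} {E₀ E₁ ω₀ : ℝ → ℝ} {G E F : ℝ → ℝ → ℝ}
  {U V X Φ : ℕ → ℕ → ℝ}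

lemma IsSchemeSolution.isLevelSolution (hτ : 0 ≤ τ) (hnT : n * τ ≤ T)
    (h : IsSchemeSolution a b T α ε E₀ E₁ ω₀ G M τ U V) :
    IsLevelSolution M (mesh a b M) τ ε n (potential a b M τ G) U V where
  bdry k hk := h.bdry k (time_mem_Icc hτ hnT hk).2
  eqn_E k hk j hj hjM := by
    have := h.eqn_E (k + 1) (by omega) (by exact_mod_cast (time_mem_Icc hτ hnT hk).2) j hj hjM
    rwa [sq_abs] at this
  eqn_F k hk j hj hjM := by
    have := h.eqn_F (k + 1) (by omega) (by exact_mod_cast (time_mem_Icc hτ hnT hk).2) j hj hjM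
    simpa only [sq_abs, Nat.add_sub_cancel] using this

lemma IsLevelSolution.isSchemeSolution (hn : ∀ k : ℕ, (k : ℝ) * τ ≤ T → k ≤ n)
    (h : IsLevelSolution M (mesh a b M) τ ε n (potential a b M τ G) U V)
    (hU : IsStart a b α ε E₀ E₁ ω₀ M τ U V) :
    IsSchemeSolution a b T α ε E₀ E₁ ω₀ G M τ U V where
  bdry k hk := h.bdry k (hn k hk)
  init := hU.zero
  first := hU.first
  eqn_E k hk hkT j hj hjM := by
    obtain ⟨i, rfl⟩ := Nat.exists_eq_add_of_le' hk
    rw [sq_abs]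
    exact h.eqn_E i (hn _ (by exact_mod_cast hkT)) j hj hjM
  eqn_F k hk hkT j hj hjM := by
    obtain ⟨i, rfl⟩ := Nat.exists_eq_add_of_le' hk
    simp only [sq_abs, Nat.add_sub_cancel]
    exact h.eqn_F i (hn _ (by exact_mod_cast hkT)) j hj hjM

/-- Existence for the scheme and distance to a reference solution, in a form common to the two
regimes of the time step. -/
lemma exists_and_error_le (hab : a < b) (hT : 0 < T) (hM : 0 < M) (hτ : 0 < τ) (hτT : τ ≤ T)
    (hε : 0 < ε) (hε1 : ε ≤ 1) (hK : 1 ≤ K) (hL : b - a ≤ K) (hR : 0 ≤ R)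
    (hτK : 500 * (4 * K ^ 2) ^ 9 * τ ≤ 1 / 2) (hRK : growth K T * R ^ 2 ≤ 1)
    (hs : IsKGZSolution a b T ε E₀ E₁ G E F)
    (hX : ∀ n : ℕ, n * τ ≤ T →
      IsReference M (mesh a b M) τ ε K R n (potential a b M τ G) X Φ)
    (hc : ∀ U V : ℕ → ℕ → ℝ, IsStart a b α ε E₀ E₁ ω₀ M τ U V →
      IsClose M (mesh a b M) τ ε R X Φ U V) :
    (∃ U V : ℕ → ℕ → ℝ, IsSchemeSolution a b T α ε E₀ E₁ ω₀ G M τ U V) ∧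
      ∀ U V : ℕ → ℕ → ℝ, IsSchemeSolution a b T α ε E₀ E₁ ω₀ G M τ U V →
        ∀ k : ℕ, (k : ℝ) ≤ T / τ →
          gridNorm M (mesh a b M) (fun j => X k j - U k j)
            + gridSemiNorm M (mesh a b M) (fun j => X k j - U k j)
            + gridNorm M (mesh a b M) (fun j => Φ k j - V k j)
              ≤ (K ^ 2 + 2) * (2 * growth K T) * R := by
  have hh := mesh_pos hab hM
  have hL' : M * mesh a b M ≤ K := by rwa [natCast_mul_mesh hM]
  set n := ⌊T / τ⌋₊ with hndef
  have hnT : n * τ ≤ T := by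
    rw [← le_div_iff₀ hτ]
    exact Nat.floor_le (by positivity)
  have hn : ∀ k : ℕ, (k : ℝ) * τ ≤ T → k ≤ n := fun k hk =>
    Nat.le_floor (by rwa [le_div_iff₀ hτ])
  have hn1 : 1 ≤ n := hn 1 (by simpa using hτT)
  constructor
  · set u₀ : ℕ → ℝ := fun j => E₀ (node a b M j)
    set u₁ : ℕ → ℝ := fun j => if 1 ≤ j ∧ j < M then E₀ (node a b M j) + τ * E₁ (node a b M j)
      + τ ^ 2 / 2 * ett0 a b α ε E₀ ω₀ (node a b M j) else 0
    set v₁ : ℕ → ℝ := fun j => if 1 ≤ j ∧ j < M then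
      τ ^ 2 / 2 * ftt0 a b α ε E₀ E₁ ω₀ (node a b M j) else 0
    have h0 := zero_mem_Icc hT
    have st : ∀ U V : ℕ → ℕ → ℝ, U 0 = u₀ → U 1 = u₁ → V 0 = (fun _ => 0) → V 1 = v₁ →
        IsStart a b α ε E₀ E₁ ω₀ M τ U V := fun U V e1 e2 e3 e4 =>
      ⟨fun j _ => by simp [e1, e3, u₀], by simp [e2, e4, u₁, v₁],
        fun j hj hjM => by simp [e2, e4, u₁, v₁, hj, hjM]⟩
    have hu0 : u₀ 0 = 0 ∧ u₀ M = 0 := by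
      simp only [u₀, node_zero, node_last hM]
      exact ⟨((hs.init_E a (left_mem_Icc.2 hab.le)).1).symm.trans (hs.bdry_E 0 h0).1,
        ((hs.init_E b (right_mem_Icc.2 hab.le)).1).symm.trans (hs.bdry_E 0 h0).2⟩
    obtain ⟨U, V, hUV, e1, e2, e3, e4⟩ := exists_levelSolution (u₀ := u₀) (u₁ := u₁)
      (v₀ := fun _ => 0) (v₁ := v₁) hh hτ hε hε1 hL' hK hT.le hR hτK hRK hnT (hX n hnT)
      (by
        rintro u (rfl | rfl | rfl | rfl)
        · exact hu0
        · simp [u₁]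
        · simp
        · simp [v₁])
      fun U V e1 e2 e3 e4 => hc U V (st U V e1 e2 e3 e4)
    exact ⟨U, V, hUV.isSchemeSolution hn (st U V e1 e2 e3 e4)⟩
  · intro U V hUV k hk
    exact (stability hh hτ hε hε1 hL' hK hT.le hR hτK hRK hn1 hnT (hX n hnT)
      (hUV.isLevelSolution hτ.le hnT) (hc U V (hUV.isStart hτT)) (hn k (by
        rwa [← le_div_iff₀ hτ]))).1

/-- The smallness assumption of `stability`, for a residual `c ρ` with `ρ ≤ h² + 3 τ`. -/
lemma growth_mul_sq_le_one {γ c h ρ : ℝ} (hγ : 1 ≤ γ) (hc : 1 ≤ c)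
    (hh : 0 < h) (hh₀ : h ≤ 1 / (4 * γ * c)) (hτ₀ : τ ≤ 1 / (4 * γ * c)) (hρ0 : 0 ≤ ρ)
    (hρ : ρ ≤ h ^ 2 + 3 * τ) : γ * (c * ρ) ^ 2 ≤ 1 := by
  have hγ0 : 0 < γ := by linarith
  have hc0 : 0 < c := by linarith
  have h1 : h ≤ 1 := hh₀.trans (by
    rw [div_le_one (by positivity)]
    nlinarith)
  have h2 : h ^ 2 ≤ h := by rw [sq]; exact mul_le_of_le_one_right hh.le h1
  have h3 : ρ ≤ 1 / (γ * c) := by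
    have : 4 * (1 / (4 * γ * c)) = 1 / (γ * c) := by field_simp
    linarith
  have h4 : c * ρ ≤ 1 / γ := by
    calc c * ρ ≤ c * (1 / (γ * c)) := by gcongr
      _ = 1 / γ := by field_simp
  calc γ * (c * ρ) ^ 2 ≤ γ * (1 / γ) ^ 2 := by gcongr
    _ = 1 / γ := by field_simp
    _ ≤ 1 := by rw [div_le_one hγ0]; exact hγ

end Final

end KGZ

theorem theorem1 (a b T α β : ℝ) (hab : a < b) (hT : 0 < T) (hα : 0 ≤ α) (hβ : -1 ≤ β)
    (E₀ E₁ ω₀ ω₁ : ℝ → ℝ) (G E F Et : ℝ → ℝ → ℝ → ℝ)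
    (hG : ∀ ε ∈ Ioc (0 : ℝ) 1, KGZ.IsWaveSolution a b T α β ε ω₀ ω₁ (G ε))
    (hEF : ∀ ε ∈ Ioc (0 : ℝ) 1, KGZ.IsKGZSolution a b T ε E₀ E₁ (G ε) (E ε) (F ε))
    (hEt : ∀ ε ∈ Ioc (0 : ℝ) 1, KGZ.IsKGOPSolution a b T E₀ E₁ (G ε) (Et ε))
    (hA : KGZ.AssumptionA a b T α β E F Et)
    (hB : KGZ.AssumptionB a b E₀ E₁ ω₀ ω₁) :
    ∃ h₀ > (0 : ℝ), ∃ τ₀ > (0 : ℝ), ∃ C > (0 : ℝ),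
      ∀ ε ∈ Ioc (0 : ℝ) 1, ∀ M : ℕ, 0 < M → KGZ.mesh a b M ≤ h₀ →
      ∀ τ : ℝ, 0 < τ → τ ≤ τ₀ →
        (∃ U V : ℕ → ℕ → ℝ, KGZ.IsSchemeSolution a b T α ε E₀ E₁ ω₀ (G ε) M τ U V) ∧
        ∀ U V : ℕ → ℕ → ℝ, KGZ.IsSchemeSolution a b T α ε E₀ E₁ ω₀ (G ε) M τ U V →
          ∀ k : ℕ, (k : ℝ) ≤ T / τ →
            KGZ.totalError a b M τ (E ε) (F ε) U V k
                ≤ C * (KGZ.mesh a b M ^ 2 + τ ^ 2 / ε) ∧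
            KGZ.totalError a b M τ (E ε) (F ε) U V k
                ≤ C * (KGZ.mesh a b M ^ 2 + τ ^ 2 + τ * ε ^ KGZ.alphaStar α β + ε) ∧
            KGZ.totalError a b M τ (E ε) (F ε) U V k
                ≤ C * (KGZ.mesh a b M ^ 2 + τ) := by
  obtain ⟨K₁, hK₁, hwave⟩ := KGZ.exists_wave_bound hab hT hG
  obtain ⟨K₂, hK₂, hunif⟩ := KGZ.exists_uniformBounds hab hT hEF hA
  obtain ⟨K, hKdef⟩ : ∃ K, K = K₁ + K₂ + (b - a) + 1 := ⟨_, rfl⟩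
  have hK : 1 ≤ K := by linarith
  have hK0 : 0 ≤ K := by linarith
  -- the reference solutions are bounded by `2 K`, their residuals by `c` times the claimed rates
  obtain ⟨γ, hγdef⟩ : ∃ γ, γ = KGZ.growth (2 * K) T := ⟨_, rfl⟩
  have hγ : 1 ≤ γ := by
    rw [hγdef]
    exact KGZ.one_le_growth (by linarith) hT.le
  obtain ⟨c, hcdef⟩ : ∃ c, c = 120 * K ^ 4 := ⟨_, rfl⟩
  have hc : 1 ≤ c := by
    have : 1 ≤ K ^ 4 := one_le_pow₀ hK
    linarith
  obtain ⟨A, hAdef⟩ : ∃ A, A = ((2 * K) ^ 2 + 2) * (2 * γ) * c := ⟨_, rfl⟩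
  have hA0 : 0 < A := by rw [hAdef]; positivity
  obtain ⟨L, hLdef⟩ : ∃ L, L = (4 * (2 * K) ^ 2) ^ 9 := ⟨_, rfl⟩
  have hL0 : 0 < L := by rw [hLdef]; positivity
  -- the thresholds make `stability` applicable; the factor `3` in the final constant compares the
  -- rates within each regime, and `2 K * K * ε` bounds the norm of `F`
  refine ⟨1 / (4 * γ * c), by positivity,
    min (1 / (4 * γ * c)) (min (min 1 T) (1 / (1000 * L))), ?_,
    3 * (A + 2 * K * K), by positivity, ?_⟩
  · refine lt_min (by positivity) (lt_min (lt_min one_pos hT) (by positivity))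
  intro ε hε M hM hh₀ τ hτ hτ₀
  simp only [le_min_iff] at hτ₀
  obtain ⟨hτγ, ⟨hτ1, hτT⟩, hτK⟩ := hτ₀
  have hh := KGZ.mesh_pos hab hM
  set h := KGZ.mesh a b M with hhdef
  set g := ε ^ KGZ.alphaStar α β with hgdef
  have hg0 : 0 ≤ g := Real.rpow_nonneg hε.1.le _
  have hg1 : g ≤ 1 := Real.rpow_le_one hε.1.le hε.2 (le_min hα (by linarith))
  have hs := hEF ε hε
  have hb := (hunif ε hε).mono hε.1 (show K₂ ≤ K by linarith)
  have hP : KGZ.PotentialBounds a b T ε K g (G ε) := by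
    refine ⟨(hG ε hε).regular, fun x hx t ht => ((hwave ε hε x hx t ht).2).trans ?_,
      fun x hx t ht => ((hwave ε hε x hx t ht).1).trans ?_⟩
    · gcongr
      linarith
    · rw [Real.rpow_sub_one hε.1.ne', ← mul_div_assoc]
      gcongr
      · exact hε.1.le
      · linarith
  have hG0 : ∀ x ∈ Icc a b, G ε x 0 = ε ^ α * ω₀ x := fun x hx => ((hG ε hε).init x hx).1
  have hτK' : 500 * (4 * (2 * K) ^ 2) ^ 9 * τ ≤ 1 / 2 := by
    rw [le_div_iff₀ (by positivity)] at hτK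
    rw [← hLdef]
    linarith
  have h2K : b - a ≤ 2 * K := by linarith
  have hε0 := hε.1
  have hτε : 0 ≤ τ ^ 2 / ε := by positivity
  rcases le_or_gt τ ε with hle | hlt
  · -- for `τ ≤ ε` one has `τ² / ε ≤ τ` and `τ² / ε ≤ ε`
    have hr : τ ^ 2 / ε ≤ τ := by
      rw [div_le_iff₀ hε0, sq]
      gcongr
    have hρ0 : 0 ≤ h ^ 2 + τ ^ 2 / ε := by positivity
    obtain ⟨hex, herr⟩ := KGZ.exists_and_error_le (K := 2 * K) (R := c * (h ^ 2 + τ ^ 2 / ε))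
      (α := α) (ω₀ := ω₀) hab hT hM hτ hτT hε0 hε.2 (by linarith) h2K (by positivity) hτK'
      (by rw [← hγdef]; exact KGZ.growth_mul_sq_le_one hγ hc hh hh₀ hτγ hρ0 (by linarith)) hs
      (fun n hnT => by
        rw [hcdef]
        exact KGZ.isReference_sample hab hT hM hτ hτ1 hε0 hε.2 hK hg1 hnT hs hb hP)
      (fun U V hUV => by
        rw [hcdef]
        exact hUV.isClose hab hT hM hτ hτ1 hτT hε0 hε.2 hK hs hb hP.isC2 hG0)
    refine ⟨hex, fun U V hUV k hk => ?_⟩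
    have e : KGZ.totalError a b M τ (E ε) (F ε) U V k ≤ A * (h ^ 2 + τ ^ 2 / ε) := by
      rw [hAdef, mul_assoc _ c, hγdef]
      exact herr U V hUV k hk
    have hC : A ≤ 3 * (A + 2 * K * K) := by
      have : 0 ≤ 2 * K * K := by positivity
      linarith
    refine ⟨e.trans (by gcongr), e.trans ?_, e.trans ?_⟩
    · have : h ^ 2 + τ ^ 2 / ε ≤ h ^ 2 + τ ^ 2 + τ * g + ε := by
        have : 0 ≤ τ * g := by positivity
        have : 0 ≤ τ ^ 2 := by positivity
        linarith
      gcongr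
    · gcongr
  · -- for `ε < τ` the second rate is at most `h² + 3 τ`, and `τ ≤ τ² / ε`
    have hτg : τ * g ≤ τ := mul_le_of_le_one_right hτ.le hg1
    have hτ2 : τ ^ 2 ≤ τ := by rw [sq]; exact mul_le_of_le_one_right hτ.le hτ1
    have hr : τ ≤ τ ^ 2 / ε := by
      rw [le_div_iff₀ hε0, sq]
      gcongr
    have hρ0 : 0 ≤ h ^ 2 + τ ^ 2 + τ * g + ε := by positivity
    obtain ⟨hex, herr⟩ := KGZ.exists_and_error_le (K := 2 * K)
      (R := c * (h ^ 2 + τ ^ 2 + τ * g + ε))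
      (α := α) (ω₀ := ω₀) hab hT hM hτ hτT hε0 hε.2 (by linarith) h2K (by positivity) hτK'
      (by rw [← hγdef]; exact KGZ.growth_mul_sq_le_one hγ hc hh hh₀ hτγ hρ0 (by linarith)) hs
      (fun n hnT => by
        rw [hcdef]
        exact KGZ.isReference_sample_zero hab hT hM hτ hτ1 hε0 hε.2 hK hg0 hg1 hnT hs hb hP)
      (fun U V hUV => by
        rw [hcdef]
        exact hUV.isClose_zero hab hT hM hτ hτ1 hτT hε0 hK hg0 hs hb hP hG0)
    refine ⟨hex, fun U V hUV k hk => ?_⟩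
    have e : KGZ.totalError a b M τ (E ε) (F ε) U V k
        ≤ (A + 2 * K * K) * (h ^ 2 + τ ^ 2 + τ * g + ε) := by
      have e1 := herr U V hUV k hk
      rw [← mul_assoc, ← hγdef, ← hAdef] at e1
      have e2 : KGZ.gridNorm M h (KGZ.sample a b M τ (F ε) k) ≤ 2 * K * (K * ε) :=
        KGZ.gridNorm_le_sup hh.le (by rw [KGZ.natCast_mul_mesh hM]; exact h2K) (by linarith)
          (by positivity) fun j _ hjM => hb.F_le _ ⟨by positivity, by rwa [← le_div_iff₀ hτ]⟩ _
            (KGZ.node_mem_Icc hab hM hjM.le)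
      have e3 : KGZ.gridNorm M h (KGZ.gridError a b M τ (F ε) V k)
          ≤ KGZ.gridNorm M h (KGZ.sample a b M τ (F ε) k)
            + KGZ.gridNorm M h (fun j => 0 - V k j) := by
        refine le_trans (le_of_eq ?_) (KGZ.gridNorm_add_le hh.le _ _)
        congr 1
        funext j
        rw [zero_sub, ← sub_eq_add_neg]
        rfl
      have e4 : 2 * K * (K * ε) ≤ 2 * K * K * (h ^ 2 + τ ^ 2 + τ * g + ε) := by
        rw [← mul_assoc]
        gcongr
        have : 0 ≤ h ^ 2 + τ ^ 2 + τ * g := by positivity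
        linarith
      have e5 : KGZ.totalError a b M τ (E ε) (F ε) U V k
          = KGZ.gridNorm M h (fun j => KGZ.sample a b M τ (E ε) k j - U k j)
            + KGZ.gridSemiNorm M h (fun j => KGZ.sample a b M τ (E ε) k j - U k j)
            + KGZ.gridNorm M h (KGZ.gridError a b M τ (F ε) V k) := rfl
      rw [e5, add_mul]
      linarith
    have hC : A + 2 * K * K ≤ 3 * (A + 2 * K * K) := by
      have : 0 ≤ A + 2 * K * K := by positivity
      linarith
    refine ⟨e.trans ?_, e.trans (by gcongr), e.trans ?_⟩
    · calc (A + 2 * K * K) * (h ^ 2 + τ ^ 2 + τ * g + ε)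
          ≤ (A + 2 * K * K) * (3 * (h ^ 2 + τ ^ 2 / ε)) :=
            mul_le_mul_of_nonneg_left (by linarith [sq_nonneg h]) (by positivity)
        _ = _ := by ring
    · calc (A + 2 * K * K) * (h ^ 2 + τ ^ 2 + τ * g + ε)
          ≤ (A + 2 * K * K) * (3 * (h ^ 2 + τ)) :=
            mul_le_mul_of_nonneg_left (by linarith [sq_nonneg h]) (by positivity)
        _ = _ := by ring
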